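/- Let $M$ be a connected smooth 3-manifold (Hausdorff, $\sigma$-compact) with a paracontact metric structure $(\varphi,\xi,\eta,g)$. That is: $\varphi$ is a $(1,1)$-tensor, $\xi$ a vector field, $\eta$ a 1-form and $g$ a pseudo-Riemannian metric (all smooth) with $\varphi\xi=0$, $\eta\circ\varphi=0$, $\eta(\xi)=1$, $\varphi^2=\mathrm{Id}-\eta\otimes\xi$, the $\pm1$-eigenspaces of $\varphi$ on $\ker\eta$ have equal dimension, $g(\varphi X,\varphi Y)=-g(X,Y)+\eta(X)\eta(Y)$, and $d\eta(X,Y)=g(X,\varphi Y)$, where $d\eta(X,Y)=\tfrac12\big(X\eta(Y)-Y\eta(X)-\eta([X,Y])\big)$. The structure is *paraSasakian* if moreover $[\varphi,\varphi]-2\,d\eta\otimes\xi=0$, where $[\varphi,\varphi]$ is the Nijenhuis torsion of $\varphi$. Let $\nabla$ be the Levi-Civita connection, $R(X,Y)=\nabla_{[X,Y]}-[\nabla_X,\nabla_Y]$, $\varrho(Y,Z)=\mathrm{tr}(W\mapsto R(Y,W)Z)$ the Ricci tensor, $r$ the scalar curvature, $h=\frac12\mathcal L_\xi\varphi$, and $U=\{p\in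 M: h_p\neq0\}$, which is open. For smooth functions $\kappa,\mu$, the *$(\kappa,\mu)$-condition* is $$R(X,Y)\xi=\kappa(\eta(X)Y-\eta(Y)X)+\mu(\eta(X)hY-\eta(Y)hX);$$ $M$ is a *$(\kappa,\mu)$-space* if there are smooth functions $\kappa,\mu$ on $M$ such that this holds on all of $M$. The field $\xi$ is an *infinitesimal harmonic transformation* if $\mathrm{tr}_g(\mathcal L_\xi\nabla)=0$. The structure is a *nontrivial paracontact Ricci soliton* if $\mathcal L_\xi g+\varrho=\lambda g$ for some constant $\lambda\in\mathbb R$ and $g$ is not Einstein (that is, $\varrho=c\,g$ for no constant $c$). A *local $\varphi$-basis* is a pseudo-orthonormal frame $\{\xi,e,\varphi e\}$ on an open set, with $e$ smooth, $\xi,e$ space-like and $\varphi e$ time-like. For such a frame put $he=a_1e+a_2\varphi e$, $a_3=g(\nabla_\xi\varphi e,e)$ and, for $\varepsilon=\pm1$, $A=\xi(a_1)+2\varepsilon a_1a_3$. A *sign function* is a function $\varepsilon$ that takes values in $\{1,-1\}$ on $U$ and satisfies $a_2=\varepsilon a_1$ at every point of $U$ and in every local $\varphi$-basis there. (a) If $M$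 is not paraSasakian and $\xi$ is an infinitesimal harmonic transformation, then $U\neq\emptyset$, there is a sign function $\varepsilon$ which is smooth (hence locally constant) on $U$, and on the open dense set $U\cup\mathrm{int}(M\setminus U)$ the $(\kappa,\mu)$-condition holds with $\kappa=-1$ and a smooth function $\mu$ such that at every point of $U$ and in every local $\varphi$-basis there $a_1\neq0$ and $\mu=-\varepsilon A/a_1$. In particular, if $h$ vanishes nowhere, then $M$ is a $(\kappa,\mu)$-space with $\kappa=-1$ and $\mu=-\varepsilon A/a_1$. (b) $M$ is a nontrivial paracontact Ricci soliton if and only if $M$ is not paraSasakian, has scalar curvature $r=-6$, and is a $(\kappa,\mu)$-space with $\kappa=-1$ and a smooth function $\mu$ on $M$ such that, for some sign function $\varepsilon$, $\mu=-2\varepsilon$ on $U$. -/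

import Mathlib

open scoped Manifold ContDiff

namespace Paracontact

/-! ### Vector fields and pseudo-Riemannian geometry on a smooth manifold of dimension `d` -/

section Geometry

/-- The model space `ℝ^d`. -/
abbrev Model (d : ℕ) : Type := EuclideanSpace ℝ (Fin d)

/-- (Not necessarily smooth) vector fields on `M`. -/
abbrev VField (d : ℕ) (M : Type*) [TopologicalSpace M] [ChartedSpace (Model d) M] : Type _ :=
  ∀ p : M, TangentSpace (𝓡 d) p

variable {d : ℕ} {M : Type*} [TopologicalSpace M] [ChartedSpace (Model d) M]
  [IsManifold (𝓡 d) ∞ M]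

/-- The vector field `X` is smooth on the set `U`. -/
def SmoothFieldOn (U : Set M) (X : VField d M) : Prop :=
  ContMDiffOn (𝓡 d) (𝓡 d).tangent ∞ (fun p => (⟨p, X p⟩ : TangentBundle (𝓡 d) M)) U

/-- The vector field `X` is smooth on all of `M`. -/
def SmoothField (X : VField d M) : Prop :=
  ContMDiff (𝓡 d) (𝓡 d).tangent ∞ (fun p => (⟨p, X p⟩ : TangentBundle (𝓡 d) M))

/-- The derivative `X(f)` of a function `f` along a vector field `X`. -/
noncomputable def dirDeriv (X : VField d M) (f : M → ℝ) (p : M) : ℝ :=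
  mvfderiv (𝓡 d) f p (X p)

/-- The Lie bracket `[X, Y]`. -/
noncomputable def bracket (X Y : VField d M) : VField d M :=
  VectorField.mlieBracket (𝓡 d) X Y

/-- The basis vector `∂ᵢ` of `T_p M` given by the preferred chart at `p`. -/
noncomputable def basisVec (p : M) (i : Fin d) : TangentSpace (𝓡 d) p :=
  (EuclideanSpace.single i (1 : ℝ) : Model d)

/-- The `i`-th component of `v ∈ T_p M` in the basis `basisVec p`. -/
noncomputable def component {p : M} (v : TangentSpace (𝓡 d) p) (i : Fin d) : ℝ :=
  (show Model d from v) i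

/-- A vector field, smooth near `p`, with value `basisVec p i` at `p`. -/
noncomputable def basisField (p : M) (i : Fin d) : VField d M :=
  FiberBundle.extend (Model d) (basisVec p i)

/-- A smooth pseudo-Riemannian metric: a smooth field of nondegenerate symmetric bilinear forms.
(On a connected manifold the index is automatically constant.) -/
structure PseudoRiemannianMetric (d : ℕ) (M : Type*) [TopologicalSpace M]
    [ChartedSpace (Model d) M] [IsManifold (𝓡 d) ∞ M] where
  val : ∀ p : M, TangentSpace (𝓡 d) p →L[ℝ] TangentSpace (𝓡 d) p →L[ℝ] ℝ
  symm : ∀ (p : M) (v w : TangentSpace (𝓡 d) p), val p v w = val p w v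
  nondegenerate : ∀ (p : M) (v : TangentSpace (𝓡 d) p), (∀ w, val p v w = 0) → v = 0
  smooth : ContMDiff (𝓡 d) ((𝓡 d).prod 𝓘(ℝ, Model d →L[ℝ] Model d →L[ℝ] ℝ)) ∞
    (fun p => Bundle.TotalSpace.mk' (Model d →L[ℝ] Model d →L[ℝ] ℝ)
      (E := fun p : M => TangentSpace (𝓡 d) p →L[ℝ] TangentSpace (𝓡 d) p →L[ℝ] ℝ) p (val p))

namespace PseudoRiemannianMetric

variable (g : PseudoRiemannianMetric d M)

/-- The function `g(X, Y)`. -/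
noncomputable def inner (X Y : VField d M) (p : M) : ℝ := g.val p (X p) (Y p)

/-- The components `g^{ij}` at `p` of the inverse metric, in the basis `basisVec p`. -/
noncomputable def inverse (p : M) (i j : Fin d) : ℝ :=
  (Matrix.of fun k l => g.val p (basisVec p k) (basisVec p l))⁻¹ i j

/-- The right-hand side of the Koszul formula, which is `2 g(∇_X Y, Z)`. -/
noncomputable def koszul (X Y Z : VField d M) (p : M) : ℝ :=
  dirDeriv X (g.inner Y Z) p + dirDeriv Y (g.inner Z X) p - dirDeriv Z (g.inner X Y) p
    + g.inner (bracket X Y) Z p - g.inner (bracket Y Z) X p + g.inner (bracket Z X) Y p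

/-- The Levi-Civita connection `∇_X Y`: the metric dual of `Z ↦ koszul X Y Z / 2`. -/
noncomputable def nabla (X Y : VField d M) : VField d M := fun p =>
  ∑ i : Fin d, ∑ j : Fin d,
    ((1 / 2 : ℝ) * g.inverse p i j * g.koszul X Y (basisField p i) p) • basisVec p j

/-- The curvature tensor, with the sign convention `R(X,Y) = ∇_{[X,Y]} - [∇_X, ∇_Y]`. -/
noncomputable def curvature (X Y Z : VField d M) : VField d M := fun p =>
  g.nabla (bracket X Y) Z p - (g.nabla X (g.nabla Y Z) p - g.nabla Y (g.nabla X Z) p)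

/-- The Ricci tensor `ϱ(Y, Z) = tr (W ↦ R(Y, W) Z)`. With the sign convention of `curvature` this is
the usual Ricci tensor, which is positive on round spheres. -/
noncomputable def ricci (Y Z : VField d M) (p : M) : ℝ :=
  ∑ i : Fin d, component (g.curvature Y (basisField p i) Z p) i

/-- The scalar curvature `r = tr_g ϱ`. -/
noncomputable def scalarCurvature (p : M) : ℝ :=
  ∑ i : Fin d, ∑ j : Fin d, g.inverse p i j * g.ricci (basisField p i) (basisField p j) p

/-- The Lie derivative `(L_V g)(X, Y)`. -/
noncomputable def lieMetric (V X Y : VField d M) (p : M) : ℝ :=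
  dirDeriv V (g.inner X Y) p - g.inner (bracket V X) Y p - g.inner X (bracket V Y) p

/-- The Lie derivative of the connection,
`(L_V ∇)(X, Y) = [V, ∇_X Y] - ∇_{[V,X]} Y - ∇_X [V,Y]`. -/
noncomputable def lieNabla (V X Y : VField d M) : VField d M := fun p =>
  bracket V (g.nabla X Y) p - g.nabla (bracket V X) Y p - g.nabla X (bracket V Y) p

/-- `V` is an infinitesimal harmonic transformation: `tr_g (L_V ∇) = 0`. -/
def IsInfinitesimalHarmonic (V : VField d M) : Prop :=
  ∀ p : M, ∑ i : Fin d, ∑ j : Fin d,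
    g.inverse p i j • g.lieNabla V (basisField p i) (basisField p j) p = 0

/-- The vector field `V` satisfies the Ricci soliton equation `L_V g + ϱ = lam g` for some
constant `lam`. -/
def IsRicciSoliton (V : VField d M) : Prop :=
  ∃ lam : ℝ, ∀ X Y : VField d M, SmoothField X → SmoothField Y → ∀ p : M,
    g.lieMetric V X Y p + g.ricci X Y p = lam * g.inner X Y p

/-- `g` is an Einstein metric: `ϱ = c g` for some constant `c`. -/
def IsEinstein : Prop :=
  ∃ c : ℝ, ∀ X Y : VField d M, SmoothField X → SmoothField Y → ∀ p : M,
    g.ricci X Y p = c * g.inner X Y p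

end PseudoRiemannianMetric

end Geometry

/-! ### Almost paracontact metric structures -/

section Structures

/-- An almost paracontact metric structure `(φ, ξ, η, g)` on `M`. -/
structure AlmostParacontactMetric (d : ℕ) (M : Type*) [TopologicalSpace M]
    [ChartedSpace (Model d) M] [IsManifold (𝓡 d) ∞ M] where
  phi : ∀ p : M, TangentSpace (𝓡 d) p →L[ℝ] TangentSpace (𝓡 d) p
  xi : VField d M
  eta : ∀ p : M, TangentSpace (𝓡 d) p →L[ℝ] ℝ
  g : PseudoRiemannianMetric d M
  phi_smooth : ContMDiff (𝓡 d) ((𝓡 d).prod 𝓘(ℝ, Model d →L[ℝ] Model d)) ∞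
    (fun p => Bundle.TotalSpace.mk' (Model d →L[ℝ] Model d)
      (E := fun p : M => TangentSpace (𝓡 d) p →L[ℝ] TangentSpace (𝓡 d) p) p (phi p))
  xi_smooth : SmoothField xi
  eta_smooth : ContMDiff (𝓡 d) ((𝓡 d).prod 𝓘(ℝ, Model d →L[ℝ] ℝ)) ∞
    (fun p => Bundle.TotalSpace.mk' (Model d →L[ℝ] ℝ)
      (E := fun p : M => TangentSpace (𝓡 d) p →L[ℝ] ℝ) p (eta p))
  phi_xi : ∀ p, phi p (xi p) = 0
  eta_phi : ∀ p v, eta p (phi p v) = 0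
  eta_xi : ∀ p, eta p (xi p) = 1
  phi_phi : ∀ p v, phi p (phi p v) = v - eta p v • xi p
  /-- The eigenspaces of `φ` for `1` and `-1` (which lie in `ker η`) have equal dimension. -/
  eigen_finrank : ∀ p,
    Module.finrank ℝ (LinearMap.ker ((phi p - ContinuousLinearMap.id ℝ _ :
      TangentSpace (𝓡 d) p →L[ℝ] TangentSpace (𝓡 d) p) :
        TangentSpace (𝓡 d) p →ₗ[ℝ] TangentSpace (𝓡 d) p)) =
    Module.finrank ℝ (LinearMap.ker ((phi p + ContinuousLinearMap.id ℝ _ :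
      TangentSpace (𝓡 d) p →L[ℝ] TangentSpace (𝓡 d) p) :
        TangentSpace (𝓡 d) p →ₗ[ℝ] TangentSpace (𝓡 d) p))
  compatible : ∀ p v w, g.val p (phi p v) (phi p w) = -g.val p v w + eta p v * eta p w

namespace AlmostParacontactMetric

variable {d : ℕ} {M : Type*} [TopologicalSpace M] [ChartedSpace (Model d) M]
  [IsManifold (𝓡 d) ∞ M] (S : AlmostParacontactMetric d M)

/-- The vector field `φ X`. -/
noncomputable def phiF (X : VField d M) : VField d M := fun p => S.phi p (X p)

/-- The function `η(X)`. -/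
noncomputable def etaF (X : VField d M) (p : M) : ℝ := S.eta p (X p)

/-- The exterior derivative, `dη(X,Y) = (X(η(Y)) - Y(η(X)) - η([X,Y])) / 2`. -/
noncomputable def dEta (X Y : VField d M) (p : M) : ℝ :=
  (1 / 2 : ℝ) * (dirDeriv X (S.etaF Y) p - dirDeriv Y (S.etaF X) p - S.etaF (bracket X Y) p)

/-- The structure is paracontact metric: `dη = Φ`, where `Φ(X, Y) = g(X, φ Y)`. -/
def IsParacontactMetric : Prop :=
  ∀ X Y : VField d M, SmoothField X → SmoothField Y → ∀ p : M,
    S.g.inner X (S.phiF Y) p = S.dEta X Y p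

/-- The Nijenhuis torsion
`[φ, φ](X, Y) = φ² [X, Y] + [φ X, φ Y] - φ [φ X, Y] - φ [X, φ Y]`. -/
noncomputable def nijenhuis (X Y : VField d M) : VField d M := fun p =>
  S.phi p (S.phi p (bracket X Y p)) + bracket (S.phiF X) (S.phiF Y) p
    - S.phi p (bracket (S.phiF X) Y p) - S.phi p (bracket X (S.phiF Y) p)

/-- The structure is normal: `[φ, φ] - 2 dη ⊗ ξ = 0`. -/
def IsNormal : Prop :=
  ∀ X Y : VField d M, SmoothField X → SmoothField Y → ∀ p : M,
    S.nijenhuis X Y p - (2 * S.dEta X Y p) • S.xi p = 0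

/-- A paraSasakian structure is a normal paracontact metric structure. -/
def IsParaSasakian : Prop := S.IsParacontactMetric ∧ S.IsNormal

/-- The tensor `h X = (L_ξ φ) X / 2 = ([ξ, φ X] - φ [ξ, X]) / 2`. -/
noncomputable def h (X : VField d M) : VField d M := fun p =>
  (1 / 2 : ℝ) • (bracket S.xi (S.phiF X) p - S.phi p (bracket S.xi X p))

/-- The (open) set of points at which the tensor `h` does not vanish. -/
def hSupport : Set M := {p | ∃ X : VField d M, SmoothField X ∧ S.h X p ≠ 0}

/-- On the set `U`, the `(κ, μ)`-condition
`R(X,Y)ξ = κ (η(X) Y - η(Y) X) + μ (η(X) h Y - η(Y) h X)` holds, with `κ`, `μ` smooth on `U`. -/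
def IsKappaMuOn (U : Set M) (κ μ : M → ℝ) : Prop :=
  ContMDiffOn (𝓡 d) 𝓘(ℝ, ℝ) ∞ κ U ∧ ContMDiffOn (𝓡 d) 𝓘(ℝ, ℝ) ∞ μ U ∧
  ∀ X Y : VField d M, SmoothField X → SmoothField Y → ∀ p ∈ U,
    S.g.curvature X Y S.xi p =
      κ p • (S.etaF X p • Y p - S.etaF Y p • X p)
        + μ p • (S.etaF X p • S.h Y p - S.etaF Y p • S.h X p)

/-- `M` is a `(κ, μ)`-space, for smooth functions `κ`, `μ` on `M`. -/
def IsKappaMuSpace (κ μ : M → ℝ) : Prop := S.IsKappaMuOn Set.univ κ μ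

/-- A nontrivial paracontact Ricci soliton: the structure is paracontact metric, `ξ` satisfies the
Ricci soliton equation, and `g` is not Einstein. -/
def IsNontrivialParacontactRicciSoliton : Prop :=
  S.IsParacontactMetric ∧ S.g.IsRicciSoliton S.xi ∧ ¬ S.g.IsEinstein

end AlmostParacontactMetric

end Structures

/-! ### Local `φ`-bases in dimension three -/

namespace AlmostParacontactMetric

variable {M : Type*} [TopologicalSpace M] [ChartedSpace (Model 3) M]
  [IsManifold (𝓡 3) ∞ M] (S : AlmostParacontactMetric 3 M)

/-- `{ξ, e, φ e}` is a `φ`-basis on the open set `V`: a pseudo-orthonormal frame with `ξ`, `e`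
space-like and `φ e` time-like. -/
structure IsPhiBasis (V : Set M) (e : VField 3 M) : Prop where
  isOpen : IsOpen V
  smooth : SmoothFieldOn V e
  xi_xi : ∀ p ∈ V, S.g.inner S.xi S.xi p = 1
  e_e : ∀ p ∈ V, S.g.inner e e p = 1
  phi_phi : ∀ p ∈ V, S.g.inner (S.phiF e) (S.phiF e) p = -1
  xi_e : ∀ p ∈ V, S.g.inner S.xi e p = 0
  xi_phi : ∀ p ∈ V, S.g.inner S.xi (S.phiF e) p = 0
  e_phi : ∀ p ∈ V, S.g.inner e (S.phiF e) p = 0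

/-- The coefficient `a₁` in `h e = a₁ e + a₂ φ e`. -/
noncomputable def a₁ (e : VField 3 M) (p : M) : ℝ := S.g.inner (S.h e) e p

/-- The coefficient `a₂` in `h e = a₁ e + a₂ φ e` (recall that `g(φ e, φ e) = -1`). -/
noncomputable def a₂ (e : VField 3 M) (p : M) : ℝ := -S.g.inner (S.h e) (S.phiF e) p

/-- The function `a₃ = g(∇_ξ (φ e), e)`. -/
noncomputable def a₃ (e : VField 3 M) (p : M) : ℝ :=
  S.g.inner (S.g.nabla S.xi (S.phiF e)) e p

/-- The function `A = ξ(a₁) + 2 ε a₁ a₃`. -/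
noncomputable def A (ε : ℝ) (e : VField 3 M) (p : M) : ℝ :=
  dirDeriv S.xi (S.a₁ e) p + 2 * ε * S.a₁ e p * S.a₃ e p

/-- `ε = ±1` is the sign with `a₂ = ε a₁`, at every point where `h ≠ 0` and in every local
`φ`-basis. -/
def IsSignFunction (ε : M → ℝ) : Prop :=
  (∀ p ∈ S.hSupport, ε p = 1 ∨ ε p = -1) ∧
  ∀ (V : Set M) (e : VField 3 M), S.IsPhiBasis V e →
    ∀ p ∈ V ∩ S.hSupport, S.a₂ e p = ε p * S.a₁ e p

end AlmostParacontactMetric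

end Paracontact

/-! Everything is computed in a local φ-basis `ξ`, `e`, `φe`. There `h` is given by `a₁`, `a₂`, and
the connection by these together with `a₃` and two further coefficients `b`, `c` (`coefB`, `coefC`).
The condition `dη = Φ`, with `d(dη) = 0`, gives `∇ξ = -φ + φh`. All curvature components then reduce
to four quantities: `sqH = a₁² - a₂²`, for which `h² = sqH · Id` on `ker η`; the tensor `∇_ξ h`; the
terms `divH₁`, `divH₂`, which are up to sign the values of `ϱ(ξ, ·)` on `e`, `φe`; and one
coefficient `coefK` for the plane of `e` and `φe`. In dimension three the structure is paraSasakian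
exactly when `h = 0` (`isParaSasakian_iff`).

With `Q` the Ricci operator, the trace of `L_ξ∇` is `2(Qξ + 2ξ)`, so `ξ` is harmonic exactly when
`sqH`, `divH₁` and `divH₂` vanish (`IsPhiBasis.harmonic_iff`). The `(κ, μ)`-condition with `κ = -1`
says the same and in addition `∇_ξ h = -μ φh` (`IsPhiBasis.isKappaMuAt_neg_one_iff`). In (a), `h² =
0` means `a₂ = ε a₁`, that is `φh = εh`. Differentiating `a₁² = a₂²` along `ξ` shows that `∇_ξ h` is
a multiple of `h` wherever `h ≠ 0`, which produces `μ`. Where `h` vanishes on an open set the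
additional equation is empty.

In (b), `L_ξ g = 2g(φh ·, ·)`. The `ξξ`-component of the soliton equation makes `sqH` constant, and
the others give `∇_ξ h = 2h`. Since the derivative of the constant `sqH` along `ξ` is zero, `sqH =
0`, whence `λ = -2`, `coefK = -1`, `r = -6` and `μ = -2ε` where `h ≠ 0`. These equations can be read
backwards. If `g` were Einstein, then `∇_ξ h = 0`, against `∇_ξ h = 2h ≠ 0`.

The delicate point in (b) is that `-2ε` must extend to a smooth function on all of `M`, so the sign
must not jump across the zero set of `h`. Put `α = a₁ + a₂` and `β = a₁ - a₂`, so that `αβ = 0`. The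
zero set of `α` is invariant under the flows of `ξ` and `e + φe`, that of `β` under the flow of `e -
φe`. If `α ≠ 0` at a point and `β ≠ 0` at another, both close to `p`, then a curve from the first
tangent to `ξ`, `e + φe` and a curve from the second tangent to `e - φe` can be made to meet. At the
meeting point `αβ ≠ 0`, a contradiction (`eventually_eq_zero_or_eventually_eq_zero`). So the regions
`ε = 1` and `ε = -1` have disjoint closures, and a smooth Urysohn function extends `μ`. -/

set_option linter.unusedSectionVars false

namespace Paracontact

/-! ### Calculus of functions and vector fields that are smooth on an open set. -/

section Calculus

variable {d : ℕ} {M : Type*} [TopologicalSpace M] [ChartedSpace (Model d) M]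

/-- The function `f` is smooth on the set `V`. -/
def SmoothFunOn (V : Set M) (f : M → ℝ) : Prop := ContMDiffOn (𝓡 d) 𝓘(ℝ, ℝ) ∞ f V

variable [IsManifold (𝓡 d) ∞ M] {V : Set M} {f g : M → ℝ} {X Y Z : VField d M} {p : M}

theorem SmoothField.on (h : SmoothField X) (V : Set M) : SmoothFieldOn V X :=
  ContMDiff.contMDiffOn h

theorem SmoothFieldOn.mono {W : Set M} (h : SmoothFieldOn V X) (hW : W ⊆ V) :
    SmoothFieldOn W X := ContMDiffOn.mono h hW

theorem SmoothFieldOn.mdiffAt (h : SmoothFieldOn V X) (hV : IsOpen V) (hp : p ∈ V) :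
    MDifferentiableAt (𝓡 d) (𝓡 d).tangent (fun p => (⟨p, X p⟩ : TangentBundle (𝓡 d) M)) p :=
  (h.contMDiffAt (hV.mem_nhds hp)).mdifferentiableAt (by simp)

theorem SmoothFieldOn.congr (h : SmoothFieldOn V X) (hXY : ∀ q ∈ V, Y q = X q) :
    SmoothFieldOn V Y :=
  ContMDiffOn.congr h fun q hq => by rw [hXY q hq]

theorem SmoothFieldOn.add (hX : SmoothFieldOn V X) (hY : SmoothFieldOn V Y) :
    SmoothFieldOn V (X + Y) := ContMDiffOn.add_section hX hY

theorem SmoothFieldOn.sub (hX : SmoothFieldOn V X) (hY : SmoothFieldOn V Y) :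
    SmoothFieldOn V (X - Y) := ContMDiffOn.sub_section hX hY

theorem SmoothFunOn.smul (hf : SmoothFunOn (d := d) V f) (hX : SmoothFieldOn V X) :
    SmoothFieldOn V (f • X) := ContMDiffOn.smul_section hf hX

theorem SmoothFieldOn.zero : SmoothFieldOn V (0 : VField d M) :=
  (Bundle.contMDiff_zeroSection ℝ (TangentSpace (𝓡 d) : M → Type _)).contMDiffOn

theorem SmoothFunOn.mdiffAt (h : SmoothFunOn (d := d) V f) (hV : IsOpen V) (hp : p ∈ V) :
    MDifferentiableAt (𝓡 d) 𝓘(ℝ, ℝ) f p :=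
  (h.contMDiffAt (hV.mem_nhds hp)).mdifferentiableAt (by simp)

theorem SmoothFunOn.mono {W : Set M} (h : SmoothFunOn (d := d) V f) (hW : W ⊆ V) :
    SmoothFunOn (d := d) W f := ContMDiffOn.mono h hW

theorem SmoothFunOn.congr (h : SmoothFunOn (d := d) V f) (hfg : ∀ q ∈ V, g q = f q) :
    SmoothFunOn (d := d) V g :=
  ContMDiffOn.congr h hfg

theorem SmoothFunOn.const (c : ℝ) : SmoothFunOn (d := d) V (fun _ : M => c) := contMDiffOn_const

theorem SmoothFunOn.add (hf : SmoothFunOn (d := d) V f) (hg : SmoothFunOn (d := d) V g) :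
    SmoothFunOn (d := d) V (fun q => f q + g q) := ContMDiffOn.add hf hg

theorem SmoothFunOn.sub (hf : SmoothFunOn (d := d) V f) (hg : SmoothFunOn (d := d) V g) :
    SmoothFunOn (d := d) V (fun q => f q - g q) := ContMDiffOn.sub hf hg

theorem SmoothFunOn.neg (hf : SmoothFunOn (d := d) V f) :
    SmoothFunOn (d := d) V (fun q => -f q) := ContMDiffOn.neg hf

theorem SmoothFunOn.mul (hf : SmoothFunOn (d := d) V f) (hg : SmoothFunOn (d := d) V g) :
    SmoothFunOn (d := d) V (fun q => f q * g q) := ContMDiffOn.mul hf hg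

theorem SmoothFunOn.inv (hf : SmoothFunOn (d := d) V f) (h0 : ∀ q ∈ V, f q ≠ 0) :
    SmoothFunOn (d := d) V (fun q => (f q)⁻¹) := fun q hq =>
  (contDiffAt_inv ℝ (h0 q hq)).contMDiffAt.comp_contMDiffWithinAt q (hf q hq)

theorem SmoothFunOn.sqrt (hf : SmoothFunOn (d := d) V f) (h0 : ∀ q ∈ V, f q ≠ 0) :
    SmoothFunOn (d := d) V (fun q => √(f q)) := fun q hq =>
  (Real.contDiffAt_sqrt (h0 q hq)).contMDiffAt.comp_contMDiffWithinAt q (hf q hq)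

/-! #### Directional derivatives -/

theorem dirDeriv_congr (hV : IsOpen V) (hp : p ∈ V) (h : ∀ q ∈ V, f q = g q) :
    dirDeriv X f p = dirDeriv X g p := by
  have : f =ᶠ[nhds p] g := Filter.eventually_of_mem (hV.mem_nhds hp) h
  simp only [dirDeriv, mvfderiv, this.mfderiv_eq]
  rw [h p hp]

theorem dirDeriv_const (c : ℝ) : dirDeriv X (fun _ => c) p = 0 := by
  simp [dirDeriv, mvfderiv_const]

theorem dirDeriv_add (hV : IsOpen V) (hp : p ∈ V) (hf : SmoothFunOn (d := d) V f)
    (hg : SmoothFunOn (d := d) V g) :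
    dirDeriv X (fun q => f q + g q) p = dirDeriv X f p + dirDeriv X g p := by
  simp [dirDeriv, mvfderiv_fun_add (hf.mdiffAt hV hp) (hg.mdiffAt hV hp)]

theorem dirDeriv_sub (hV : IsOpen V) (hp : p ∈ V) (hf : SmoothFunOn (d := d) V f)
    (hg : SmoothFunOn (d := d) V g) :
    dirDeriv X (fun q => f q - g q) p = dirDeriv X f p - dirDeriv X g p := by
  simp [dirDeriv, mvfderiv_fun_sub (hf.mdiffAt hV hp) (hg.mdiffAt hV hp)]

theorem dirDeriv_neg : dirDeriv X (fun q => -f q) p = -dirDeriv X f p := by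
  simp [dirDeriv, mvfderiv_fun_neg]

theorem dirDeriv_mul (hV : IsOpen V) (hp : p ∈ V) (hf : SmoothFunOn (d := d) V f)
    (hg : SmoothFunOn (d := d) V g) :
    dirDeriv X (fun q => f q * g q) p = f p * dirDeriv X g p + g p * dirDeriv X f p := by
  simp [dirDeriv, mvfderiv_fun_mul (hf.mdiffAt hV hp) (hg.mdiffAt hV hp)]

@[simp] theorem dirDeriv_add_field : dirDeriv (X + Y) f p = dirDeriv X f p + dirDeriv Y f p :=
  map_add _ _ _

@[simp] theorem dirDeriv_smul_field : dirDeriv (g • X) f p = g p * dirDeriv X f p :=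
  map_smul (mvfderiv (𝓡 d) f p) (g p) (X p)

/-- The derivative of a smooth vector-valued function along a smooth vector field is smooth. -/
theorem contMDiffOn_mvfderiv_apply {n : ℕ} {F : M → Model n} (hV : IsOpen V)
    (hF : ContMDiffOn (𝓡 d) (𝓡 n) ∞ F V) (hX : SmoothFieldOn V X) :
    ContMDiffOn (𝓡 d) (𝓡 n) ∞ (fun q => mvfderiv (𝓡 d) F q (X q)) V := by
  have h1 := hF.contMDiffOn_tangentMapWithin (m := ∞) (by simp) hV.uniqueMDiffOn
  have h2 := h1.comp hX (fun q hq => hq)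
  have h3 := (contMDiff_snd_tangentBundle_modelSpace (Model n) (𝓡 n) (n := ∞)).comp_contMDiffOn h2
  refine h3.congr fun q hq => ?_
  simp only [Function.comp, tangentMapWithin, mfderivWithin_of_isOpen hV hq]
  rfl

theorem SmoothFunOn.dirDeriv (hV : IsOpen V) (hf : SmoothFunOn (d := d) V f)
    (hX : SmoothFieldOn V X) : SmoothFunOn (d := d) V (dirDeriv X f) := by
  have h1 := ContMDiffOn.contMDiffOn_tangentMapWithin (m := ∞) hf (by simp) hV.uniqueMDiffOn
  have h2 := h1.comp hX (fun q hq => hq)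
  have h3 := (contMDiff_snd_tangentBundle_modelSpace ℝ 𝓘(ℝ, ℝ) (n := ∞)).comp_contMDiffOn h2
  refine ContMDiffOn.congr h3 fun q hq => ?_
  simp only [Function.comp, tangentMapWithin, mfderivWithin_of_isOpen hV hq]
  rfl

/-! #### Lie brackets -/

theorem isManifold_minSmoothness (n : ℕ) : IsManifold (𝓡 d) (minSmoothness ℝ n) M := by
  simp only [minSmoothness_of_isRCLikeNormedField]
  exact IsManifold.of_le (n := ∞) (by exact_mod_cast (le_top : (n : ℕ∞) ≤ ⊤))

theorem bracket_congr {X' Y' : VField d M} (hV : IsOpen V) (hp : p ∈ V)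
    (hX : ∀ q ∈ V, X q = X' q) (hY : ∀ q ∈ V, Y q = Y' q) :
    bracket X Y p = bracket X' Y' p :=
  Filter.EventuallyEq.mlieBracket_vectorField_eq
    (Filter.eventually_of_mem (hV.mem_nhds hp) hX) (Filter.eventually_of_mem (hV.mem_nhds hp) hY)

theorem bracket_swap : bracket X Y p = -bracket Y X p := VectorField.mlieBracket_swap_apply

theorem bracket_self : bracket X X p = 0 := by simp [bracket]

theorem SmoothFieldOn.bracket (hV : IsOpen V) (hX : SmoothFieldOn V X) (hY : SmoothFieldOn V Y) :
    SmoothFieldOn V (bracket X Y) := fun q hq =>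
  have : IsManifold (𝓡 d) (minSmoothness ℝ 2) M := isManifold_minSmoothness 2
  -- Here `∞ + 1 = ∞`, so the bracket of smooth fields loses no regularity.
  have : IsManifold (𝓡 d) (((⊤ : ℕ∞) : WithTop ℕ∞) + 1) M := ‹IsManifold (𝓡 d) ∞ M›
  (ContMDiffAt.mlieBracket_vectorField (m := ⊤) (n := ⊤) (hX.contMDiffAt (hV.mem_nhds hq))
    (hY.contMDiffAt (hV.mem_nhds hq)) (by simp)).contMDiffWithinAt

theorem bracket_add_left (hV : IsOpen V) (hp : p ∈ V) (hX : SmoothFieldOn V X)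
    (hY : SmoothFieldOn V Y) : bracket (X + Y) Z p = bracket X Z p + bracket Y Z p :=
  VectorField.mlieBracket_add_left (hX.mdiffAt hV hp) (hY.mdiffAt hV hp)

theorem bracket_add_right (hV : IsOpen V) (hp : p ∈ V) (hX : SmoothFieldOn V X)
    (hY : SmoothFieldOn V Y) : bracket Z (X + Y) p = bracket Z X p + bracket Z Y p :=
  VectorField.mlieBracket_add_right (hX.mdiffAt hV hp) (hY.mdiffAt hV hp)

theorem bracket_smul_left (hV : IsOpen V) (hp : p ∈ V) (hf : SmoothFunOn (d := d) V f)
    (hX : SmoothFieldOn V X) :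
    bracket (f • X) Y p = -dirDeriv Y f p • X p + f p • bracket X Y p :=
  VectorField.mlieBracket_smul_left (hf.mdiffAt hV hp) (hX.mdiffAt hV hp)

theorem bracket_smul_right (hV : IsOpen V) (hp : p ∈ V) (hf : SmoothFunOn (d := d) V f)
    (hY : SmoothFieldOn V Y) :
    bracket X (f • Y) p = dirDeriv X f p • Y p + f p • bracket X Y p :=
  VectorField.mlieBracket_smul_right (hf.mdiffAt hV hp) (hY.mdiffAt hV hp)

theorem bracket_jacobi (hV : IsOpen V) (hp : p ∈ V) (hX : SmoothFieldOn V X)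
    (hY : SmoothFieldOn V Y) (hZ : SmoothFieldOn V Z) :
    bracket X (bracket Y Z) p = bracket (bracket X Y) Z p + bracket Y (bracket X Z) p := by
  have : IsManifold (𝓡 d) (minSmoothness ℝ 3) M := isManifold_minSmoothness 3
  have h : ∀ {W : VField d M}, SmoothFieldOn V W → ContMDiffAt (𝓡 d) (𝓡 d).tangent
      (minSmoothness ℝ 2) (fun p => (⟨p, W p⟩ : TangentBundle (𝓡 d) M)) p := fun {W} hW => by
    simp only [minSmoothness_of_isRCLikeNormedField]
    exact (hW.contMDiffAt (hV.mem_nhds hp)).of_le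
      (WithTop.coe_le_coe.2 (le_top : (2 : ℕ∞) ≤ ⊤))
  exact VectorField.leibniz_identity_mlieBracket_apply (h hX) (h hY) (h hZ)

/-- A bracket acts on functions as the commutator of derivations. -/
theorem dirDeriv_bracket (hV : IsOpen V) (hp : p ∈ V) (hf : SmoothFunOn (d := d) V f)
    (hX : SmoothFieldOn V X) (hY : SmoothFieldOn V Y) (hZ : SmoothFieldOn V Z) (hZp : Z p ≠ 0) :
    dirDeriv (bracket X Y) f p =
      dirDeriv X (dirDeriv Y f) p - dirDeriv Y (dirDeriv X f) p := by
  -- The formula is read off from the Jacobi identity for `X`, `Y`, `f • Z`. The terms symmetric in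
  -- `X` and `Y` cancel, those with factor `f p` cancel by the Jacobi identity for `Z`, and what
  -- remains is a multiple of `Z p ≠ 0`.
  have key : ∀ {A B : VField d M}, SmoothFieldOn V A → SmoothFieldOn V B →
      bracket A (bracket B (f • Z)) p = dirDeriv A (dirDeriv B f) p • Z p
        + dirDeriv B f p • bracket A Z p + dirDeriv A f p • bracket B Z p
        + f p • bracket A (bracket B Z) p := fun {A B} hA hB => by
    rw [bracket_congr (X' := A) (Y' := dirDeriv B f • Z + f • bracket B Z) hV hp
      (fun _ _ => rfl) (fun q hq => bracket_smul_right hV hq hf hZ),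
      bracket_add_right hV hp ((hf.dirDeriv hV hB).smul hZ) (hf.smul (hB.bracket hV hZ)),
      bracket_smul_right hV hp (hf.dirDeriv hV hB) hZ,
      bracket_smul_right hV hp hf (hB.bracket hV hZ)]
    abel
  have h := bracket_jacobi hV hp hX hY (hf.smul hZ)
  rw [key hX hY, key hY hX, bracket_smul_right hV hp hf hZ, bracket_jacobi hV hp hX hY hZ] at h
  have h0 : (dirDeriv (bracket X Y) f p -
      (dirDeriv X (dirDeriv Y f) p - dirDeriv Y (dirDeriv X f) p)) • Z p = 0 := by
    rw [sub_smul, sub_smul, sub_eq_zero]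
    rw [smul_add] at h
    rw [eq_sub_iff_add_eq]
    have := sub_eq_zero.2 h
    rw [← sub_eq_zero, ← neg_eq_zero]
    rw [← this]
    abel
  exact sub_eq_zero.1 ((smul_eq_zero.1 h0).resolve_right hZp)

end Calculus

/-! ### Extension of tangent vectors to smooth fields. -/

section Extension

variable {d : ℕ} {M : Type*} [TopologicalSpace M] [ChartedSpace (Model d) M]
  [IsManifold (𝓡 d) ∞ M]

@[simp] theorem basisField_self (p : M) (i : Fin d) : basisField p i p = basisVec p i :=
  FiberBundle.extend_apply_self _ _

theorem exists_isOpen_smoothFieldOn_extend (p : M) :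
    ∃ V : Set M, IsOpen V ∧ p ∈ V ∧ ∀ v : TangentSpace (𝓡 d) p,
      SmoothFieldOn V (FiberBundle.extend (Model d) v) := by
  set t := trivializationAt (Model d) (TangentSpace (𝓡 d) : M → Type _) p with ht
  refine ⟨t.baseSet, t.open_baseSet, FiberBundle.mem_baseSet_trivializationAt' p, fun v => ?_⟩
  unfold SmoothFieldOn
  rw [show (fun q => (⟨q, FiberBundle.extend (Model d) v q⟩ : TangentBundle (𝓡 d) M)) =
    fun q => ⟨q, FiberBundle.extend (Model d) v q⟩ from rfl]
  have h := t.contMDiffOn_section_baseSet_iff (IB := 𝓡 d) (n := ∞)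
    (s := FiberBundle.extend (Model d) v)
  rw [h]
  -- In the trivialization at `p` the extended section is constant.
  refine (contMDiffOn_const (c := (t ⟨p, v⟩).2)).congr fun q hq => ?_
  simp [FiberBundle.extend, hq, ht.symm]

/-- Every tangent vector is the value of a global smooth vector field. -/
theorem exists_smoothField [T2Space M] (p : M) (v : TangentSpace (𝓡 d) p) :
    ∃ X : VField d M, SmoothField X ∧ X p = v := by
  obtain ⟨V, hV, hp, h⟩ := exists_isOpen_smoothFieldOn_extend (d := d) p
  obtain ⟨b, -, hb⟩ := (SmoothBumpFunction.nhds_basis_tsupport (I := 𝓡 d) p).mem_iff.1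
    (hV.mem_nhds hp)
  refine ⟨(b : M → ℝ) • FiberBundle.extend (Model d) v, ?_, ?_⟩
  · exact ContMDiffOn.smul_section_of_tsupport (b.contMDiff.contMDiffOn) hV hb (h v)
  · simp

end Extension

end Paracontact

namespace Paracontact

/-! ### Tensorial operations and traces in pseudo-orthonormal frames. -/

section Metric

variable {d : ℕ} {M : Type*} [TopologicalSpace M] [ChartedSpace (Model d) M]
  [IsManifold (𝓡 d) ∞ M] {V : Set M} {f : M → ℝ} {X Y Z : VField d M} {p : M}
  (g : PseudoRiemannianMetric d M)

theorem sum_component_smul {p : M} (v : TangentSpace (𝓡 d) p) :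
    ∑ i, component v i • basisVec p i = v := by
  have h : ∀ w : Model d, ∑ i, w i • (EuclideanSpace.single i (1 : ℝ) : Model d) = w := fun w => by
    simpa using (EuclideanSpace.basisFun (Fin d) ℝ).sum_repr w
  exact h v

/-- `T` is additive and `C^∞`-homogeneous at `p` on vector fields that are smooth on `V`. -/
structure TensorialOn {W : Type*} [AddCommGroup W] [Module ℝ W] (V : Set M) (p : M)
    (T : VField d M → W) : Prop where
  add : ∀ {X Y}, SmoothFieldOn V X → SmoothFieldOn V Y → T (X + Y) = T X + T Y
  smul : ∀ {f X}, SmoothFunOn (d := d) V f → SmoothFieldOn V X → T (f • X) = f p • T X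

namespace TensorialOn

variable {W : Type*} [AddCommGroup W] [Module ℝ W] {T : VField d M → W}

/-- The indicator function of `V` is smooth on `V`, equals 1 at `p`, and makes the two fields agree
everywhere after multiplication. So homogeneity already contains locality. -/
theorem congr (hT : TensorialOn V p T) (hp : p ∈ V) (hX : SmoothFieldOn V X)
    (hY : SmoothFieldOn V Y) (h : ∀ q ∈ V, X q = Y q) : T X = T Y := by
  classical
  set ψ : M → ℝ := fun q => if q ∈ V then 1 else 0
  have hψ : SmoothFunOn (d := d) V ψ :=
    (SmoothFunOn.const 1).congr fun q hq => by simp [ψ, hq]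
  have h1 : ψ • X = ψ • Y := by
    funext q
    by_cases hq : q ∈ V
    · simp [h q hq]
    · simp [ψ, hq]
  have h2 : ψ p = 1 := by simp [ψ, hp]
  rw [← one_smul ℝ (T X), ← h2, ← hT.smul hψ hX, h1, hT.smul hψ hY, h2, one_smul]

theorem zero (hT : TensorialOn V p T) : T 0 = 0 := by
  have := hT.add SmoothFieldOn.zero SmoothFieldOn.zero
  simpa using this

theorem sum (hT : TensorialOn V p T) {ι : Type*} (s : Finset ι) {F : ι → VField d M}
    (hF : ∀ i, SmoothFieldOn V (F i)) :
    SmoothFieldOn V (∑ i ∈ s, F i) ∧ T (∑ i ∈ s, F i) = ∑ i ∈ s, T (F i) := by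
  classical
  induction s using Finset.induction_on with
  | empty => exact ⟨by simpa using SmoothFieldOn.zero, by simpa using hT.zero⟩
  | insert a s ha ih =>
    rw [Finset.sum_insert ha, Finset.sum_insert ha]
    exact ⟨(hF a).add ih.1, by rw [hT.add (hF a) ih.1, ih.2]⟩

end TensorialOn

theorem SmoothFieldOn.inner (hX : SmoothFieldOn V X) (hY : SmoothFieldOn V Y) :
    SmoothFunOn (d := d) V (g.inner X Y) := by
  have h : ContMDiffOn (𝓡 d) ((𝓡 d).prod 𝓘(ℝ)) ∞ (fun m =>
      Bundle.TotalSpace.mk' ℝ (E := Bundle.Trivial M ℝ) m (g.val m (X m) (Y m))) V :=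
    ContMDiffOn.clm_bundle_apply₂ (F₁ := Model d) (F₂ := Model d)
      (E₁ := fun p : M => TangentSpace (𝓡 d) p) (E₂ := fun p : M => TangentSpace (𝓡 d) p)
      (E₃ := Bundle.Trivial M ℝ) g.smooth.contMDiffOn hX hY
  exact fun q hq => ((Bundle.contMDiffWithinAt_totalSpace (f := fun m =>
      Bundle.TotalSpace.mk' ℝ (E := Bundle.Trivial M ℝ) m (g.val m (X m) (Y m)))).1 (h q hq)).2

/-- A pseudo-orthonormal frame of smooth vector fields on the open set `V`, with signs `s`. -/
structure IsFrameOn (V : Set M) (E : Fin d → VField d M) (s : Fin d → ℝ) : Prop where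
  isOpen : IsOpen V
  smooth : ∀ a, SmoothFieldOn V (E a)
  sign : ∀ a, s a * s a = 1
  orth : ∀ p ∈ V, ∀ a b, g.val p (E a p) (E b p) = if a = b then s a else 0

namespace IsFrameOn

variable {g} {E : Fin d → VField d M} {s : Fin d → ℝ} (hE : IsFrameOn g V E s)
include hE

theorem mono {W : Set M} (hW : IsOpen W) (hWV : W ⊆ V) : IsFrameOn g W E s :=
  ⟨hW, fun a => (hE.smooth a).mono hWV, hE.sign, fun p hp => hE.orth p (hWV hp)⟩

theorem linearIndependent (hp : p ∈ V) : LinearIndependent ℝ (fun a => E a p) := by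
  rw [Fintype.linearIndependent_iff]
  intro c hc b
  have h := congrArg (fun v => g.val p v (E b p)) hc
  simp only [map_sum, map_smul, sum_apply, smul_apply,
    hE.orth p hp, smul_eq_mul, mul_ite, mul_zero, Finset.sum_ite_eq', Finset.mem_univ, if_true,
    map_zero, zero_apply] at h
  exact (mul_eq_zero.1 h).resolve_right fun h0 => by simpa [h0] using hE.sign b

/-- By a dimension count the frame is a basis, so the difference is orthogonal to every vector and
nondegeneracy applies. -/
theorem ext_inner (hp : p ∈ V) {v w : TangentSpace (𝓡 d) p}
    (h : ∀ a, g.val p v (E a p) = g.val p w (E a p)) : v = w := by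
  have hfin : Fintype.card (Fin d) = Module.finrank ℝ (TangentSpace (𝓡 d) p) := by
    rw [Fintype.card_fin]
    exact (finrank_euclideanSpace_fin (𝕜 := ℝ) (n := d)).symm
  have : FiniteDimensional ℝ (TangentSpace (𝓡 d) p) :=
    inferInstanceAs (FiniteDimensional ℝ (Model d))
  let b := basisOfLinearIndependentOfCardEqFinrank' _ (hE.linearIndependent hp) hfin
  refine sub_eq_zero.1 (g.nondegenerate p _ fun u => ?_)
  have : g.val p (v - w) = 0 := by
    refine ContinuousLinearMap.coe_injective (b.ext fun a => ?_)
    simp [b, h a]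
  simp [this]

theorem eq_sum (hp : p ∈ V) (v : TangentSpace (𝓡 d) p) :
    v = ∑ a, (s a * g.val p v (E a p)) • E a p := by
  refine hE.ext_inner hp fun b => ?_
  simp only [map_sum, map_smul, sum_apply, smul_apply,
    hE.orth p hp, smul_eq_mul, mul_ite, mul_zero, Finset.sum_ite_eq', Finset.mem_univ, if_true]
  rw [mul_right_comm, hE.sign, one_mul]

/-- The coefficients `s a * g(X, E a)` of `X` in the frame are smooth functions on `V`, so they can
be pulled out of `T`. -/
theorem tensorial_eq_sum {W : Type*} [AddCommGroup W] [Module ℝ W] {T : VField d M → W}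
    (hT : TensorialOn V p T) (hp : p ∈ V) (hX : SmoothFieldOn V X) :
    T X = ∑ a, (s a * g.val p (X p) (E a p)) • T (E a) := by
  have hc : ∀ a, SmoothFunOn (d := d) V (fun q => s a * g.inner X (E a) q) := fun a =>
    (SmoothFunOn.const _).mul (hX.inner g (hE.smooth a))
  have hs := hT.sum Finset.univ (F := fun a => (fun q => s a * g.inner X (E a) q) • E a)
    fun a => (hc a).smul (hE.smooth a)
  rw [hT.congr hp hX hs.1, hs.2]
  · exact Finset.sum_congr rfl fun a _ => hT.smul (hc a) (hE.smooth a)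
  · intro q hq
    rw [Finset.sum_apply]
    exact hE.eq_sum hq (X q)

theorem tensorial_ext {W : Type*} [AddCommGroup W] [Module ℝ W] {T : VField d M → W}
    (hT : TensorialOn V p T) (hp : p ∈ V) (hX : SmoothFieldOn V X) (hY : SmoothFieldOn V Y)
    (h : X p = Y p) : T X = T Y := by
  rw [hE.tensorial_eq_sum hT hp hX, hE.tensorial_eq_sum hT hp hY, h]

/-- If `N` has the components of the frame as rows, orthonormality reads `N G Nᵀ = diag s`. As `s² =
1`, this gives `G⁻¹ = Nᵀ (diag s) N`. -/
theorem inverse_eq (hp : p ∈ V) (i j : Fin d) :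
    g.inverse p i j = ∑ a, s a * component (E a p) i * component (E a p) j := by
  set G : Matrix (Fin d) (Fin d) ℝ := Matrix.of fun k l => g.val p (basisVec p k) (basisVec p l)
  set N : Matrix (Fin d) (Fin d) ℝ := Matrix.of fun a i => component (E a p) i
  have h1 : N * G * N.transpose = Matrix.diagonal s := by
    ext a b
    rw [Matrix.diagonal_apply, ← hE.orth p hp a b]
    conv_rhs => rw [← sum_component_smul (E a p), ← sum_component_smul (E b p)]
    simp only [Matrix.mul_apply, map_sum, map_smul, sum_apply,
      smul_apply, smul_eq_mul, Matrix.transpose_apply, N, G, Matrix.of_apply,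
      Finset.sum_mul, Finset.mul_sum]
    exact Finset.sum_congr rfl fun x _ => Finset.sum_congr rfl fun y _ => by ring
  have h2 : Matrix.diagonal s * (N * G * N.transpose) = 1 := by
    rw [h1, Matrix.diagonal_mul_diagonal, ← Matrix.diagonal_one]
    congr 1
    funext a
    exact hE.sign a
  have h3 : N.transpose * (Matrix.diagonal s * (N * G)) = 1 := by
    rw [mul_eq_one_comm, ← h2]
    simp only [Matrix.mul_assoc]
  have h4 : G⁻¹ = N.transpose * Matrix.diagonal s * N :=
    Matrix.inv_eq_left_inv (by rw [← h3]; simp only [Matrix.mul_assoc])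
  change G⁻¹ i j = _
  rw [h4, Matrix.mul_apply]
  refine Finset.sum_congr rfl fun a _ => ?_
  rw [Matrix.mul_diagonal]
  simp only [Matrix.transpose_apply, N, Matrix.of_apply]
  ring

/-- The trace of a bilinear map with respect to the metric. -/
theorem sum_inverse_smul (hp : p ∈ V) {W : Type*} [AddCommGroup W] [Module ℝ W]
    (L : TangentSpace (𝓡 d) p →ₗ[ℝ] TangentSpace (𝓡 d) p →ₗ[ℝ] W) :
    ∑ i, ∑ j, g.inverse p i j • L (basisVec p i) (basisVec p j) =
      ∑ a, s a • L (E a p) (E a p) := by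
  have h : ∀ a, L (E a p) (E a p) = ∑ i, ∑ j,
      (component (E a p) i * component (E a p) j) • L (basisVec p i) (basisVec p j) := fun a => by
    conv_lhs => rw [← sum_component_smul (E a p)]
    simp only [map_sum, map_smul, LinearMap.sum_apply, LinearMap.smul_apply, smul_smul,
      Finset.smul_sum]
    rw [Finset.sum_comm]
    exact Finset.sum_congr rfl fun i _ => Finset.sum_congr rfl fun j _ => by rw [mul_comm]
  simp only [h, hE.inverse_eq hp, Finset.sum_smul, Finset.smul_sum, smul_smul]
  rw [Finset.sum_comm' (t' := Finset.univ) (s' := fun _ => Finset.univ) (by simp)]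
  conv_rhs => rw [Finset.sum_comm]
  conv_lhs => rw [Finset.sum_comm]
  refine Finset.sum_congr rfl fun i _ => ?_
  conv_rhs => rw [Finset.sum_comm]
  exact Finset.sum_congr rfl fun j _ => Finset.sum_congr rfl fun a _ => by rw [mul_assoc]

/-- The trace of an endomorphism. -/
theorem sum_component (hp : p ∈ V) (L : TangentSpace (𝓡 d) p →ₗ[ℝ] TangentSpace (𝓡 d) p) :
    ∑ i, component (L (basisVec p i)) i = ∑ a, s a * g.val p (L (E a p)) (E a p) := by
  have h : ∀ i, component (L (basisVec p i)) i =
      ∑ a, s a * g.val p (basisVec p i) (E a p) * component (L (E a p)) i := fun i => by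
    conv_lhs => rw [hE.eq_sum hp (basisVec p i)]
    simp only [map_sum, map_smul]
    have : ∀ (c : Fin d → ℝ) (v : Fin d → TangentSpace (𝓡 d) p),
        component (∑ a, c a • v a) i = ∑ a, c a * component (v a) i := fun c v => by
      have h := map_sum (EuclideanSpace.proj (𝕜 := ℝ) i : Model d →L[ℝ] ℝ)
        (fun a => c a • (show Model d from v a)) Finset.univ
      exact h
    rw [this]
  simp only [h]
  rw [Finset.sum_comm]
  refine Finset.sum_congr rfl fun a _ => ?_
  conv_rhs => rw [← sum_component_smul (L (E a p))]
  simp only [map_sum, map_smul, sum_apply, smul_apply,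
    smul_eq_mul, Finset.mul_sum]
  exact Finset.sum_congr rfl fun i _ => by ring

/-- The linear map on the tangent space at `p` that a tensorial operation defines. -/
theorem exists_linearMap {W : Type*} [AddCommGroup W] [Module ℝ W] {T : VField d M → W}
    (hT : TensorialOn V p T) (hp : p ∈ V) :
    ∃ L : TangentSpace (𝓡 d) p →ₗ[ℝ] W, ∀ X, SmoothFieldOn V X → T X = L (X p) := by
  refine ⟨⟨⟨fun v => ∑ a, (s a * g.val p v (E a p)) • T (E a), fun v w => ?_⟩, fun c v => ?_⟩,
    fun X hX => hE.tensorial_eq_sum hT hp hX⟩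
  · simp only [map_add, add_apply, mul_add, add_smul, Finset.sum_add_distrib]
  · simp only [map_smul, smul_apply, smul_eq_mul, Finset.smul_sum, smul_smul, RingHom.id_apply]
    exact Finset.sum_congr rfl fun a _ => by rw [mul_left_comm]

end IsFrameOn

end Metric

end Paracontact

namespace Paracontact

/-! ### The Koszul formula and the Levi-Civita connection. -/

section LeviCivita

variable {d : ℕ} {M : Type*} [TopologicalSpace M] [ChartedSpace (Model d) M]
  [IsManifold (𝓡 d) ∞ M] {V : Set M} {f : M → ℝ} {X Y Z X' Y' : VField d M} {p : M}
  (g : PseudoRiemannianMetric d M)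

theorem inner_comm : g.inner X Y = g.inner Y X := funext fun p => g.symm p _ _

theorem inner_add_left : g.inner (X + Y) Z = fun q => g.inner X Z q + g.inner Y Z q := by
  funext q; simp [PseudoRiemannianMetric.inner]

theorem inner_smul_left : g.inner (f • X) Z = fun q => f q * g.inner X Z q := by
  funext q; simp [PseudoRiemannianMetric.inner]

theorem inner_add_right : g.inner Z (X + Y) = fun q => g.inner Z X q + g.inner Z Y q := by
  funext q; simp [PseudoRiemannianMetric.inner]

theorem inner_smul_right : g.inner Z (f • X) = fun q => f q * g.inner Z X q := by
  funext q; simp [PseudoRiemannianMetric.inner]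

theorem koszul_congr (hV : IsOpen V) (hp : p ∈ V) (hX : ∀ q ∈ V, X q = X' q)
    (hY : ∀ q ∈ V, Y q = Y' q) : g.koszul X Y Z p = g.koszul X' Y' Z p := by
  have h1 : dirDeriv X (g.inner Y Z) p = dirDeriv X' (g.inner Y' Z) p := by
    rw [dirDeriv_congr (g := g.inner Y' Z) hV hp fun q hq => by
      simp [PseudoRiemannianMetric.inner, hY q hq]]
    simp [dirDeriv, hX p hp]
  have h2 : dirDeriv Y (g.inner Z X) p = dirDeriv Y' (g.inner Z X') p := by
    rw [dirDeriv_congr (g := g.inner Z X') hV hp fun q hq => by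
      simp [PseudoRiemannianMetric.inner, hX q hq]]
    simp [dirDeriv, hY p hp]
  have h3 : dirDeriv Z (g.inner X Y) p = dirDeriv Z (g.inner X' Y') p :=
    dirDeriv_congr hV hp fun q hq => by
      simp [PseudoRiemannianMetric.inner, hX q hq, hY q hq]
  simp only [PseudoRiemannianMetric.koszul, h1, h2, h3, PseudoRiemannianMetric.inner, hX p hp,
    hY p hp, bracket_congr hV hp hX hY,
    bracket_congr (X := Y) (Y := Z) (Y' := Z) hV hp hY fun _ _ => rfl,
    bracket_congr (X := Z) (Y := X) (X' := Z) hV hp (fun _ _ => rfl) hX]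

section Koszul

variable (hV : IsOpen V) (hp : p ∈ V)
include hV hp

/-- The Leibniz terms from the derivatives of inner products cancel those from the brackets. Hence
the dual vector that defines `nabla` does not depend on how the test vectors are extended. -/
theorem koszul_tensorialOn (hX : SmoothFieldOn V X) (hY : SmoothFieldOn V Y) :
    TensorialOn V p (fun Z => g.koszul X Y Z p) where
  add {Z W} hZ hW := by
    simp only [PseudoRiemannianMetric.koszul, inner_add_right, inner_add_left,
      dirDeriv_add hV hp (hY.inner g hZ) (hY.inner g hW),
      dirDeriv_add hV hp (hZ.inner g hX) (hW.inner g hX), dirDeriv_add_field]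
    simp only [PseudoRiemannianMetric.inner, bracket_add_left hV hp hZ hW,
      bracket_add_right hV hp hZ hW, map_add, add_apply]
    ring
  smul {f Z} hf hZ := by
    simp only [PseudoRiemannianMetric.koszul, inner_smul_right, inner_smul_left,
      dirDeriv_mul hV hp hf (hY.inner g hZ), dirDeriv_mul hV hp hf (hZ.inner g hX),
      dirDeriv_smul_field]
    simp only [PseudoRiemannianMetric.inner, bracket_smul_left hV hp hf hZ,
      bracket_smul_right hV hp hf hZ, map_add, map_smul, add_apply, smul_apply, smul_eq_mul,
      g.symm p (Z p) (X p), g.symm p (Z p) (Y p), neg_smul, map_neg, neg_apply]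
    ring

theorem koszul_add_left (hX : SmoothFieldOn V X) (hX' : SmoothFieldOn V X')
    (hY : SmoothFieldOn V Y) (hZ : SmoothFieldOn V Z) :
    g.koszul (X + X') Y Z p = g.koszul X Y Z p + g.koszul X' Y Z p := by
  simp only [PseudoRiemannianMetric.koszul, inner_add_right, inner_add_left,
    dirDeriv_add hV hp (hZ.inner g hX) (hZ.inner g hX'),
    dirDeriv_add hV hp (hX.inner g hY) (hX'.inner g hY), dirDeriv_add_field]
  simp only [PseudoRiemannianMetric.inner, bracket_add_left hV hp hX hX',
    bracket_add_right hV hp hX hX', map_add, add_apply]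
  ring

theorem koszul_smul_left (hf : SmoothFunOn (d := d) V f) (hX : SmoothFieldOn V X)
    (hY : SmoothFieldOn V Y) (hZ : SmoothFieldOn V Z) :
    g.koszul (f • X) Y Z p = f p * g.koszul X Y Z p := by
  simp only [PseudoRiemannianMetric.koszul, inner_smul_right, inner_smul_left,
    dirDeriv_mul hV hp hf (hZ.inner g hX), dirDeriv_mul hV hp hf (hX.inner g hY),
    dirDeriv_smul_field]
  simp only [PseudoRiemannianMetric.inner, bracket_smul_left hV hp hf hX,
    bracket_smul_right hV hp hf hX, map_add, map_smul, add_apply, smul_apply, smul_eq_mul,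
    g.symm p (Z p) (X p), neg_smul, map_neg, neg_apply]
  ring

theorem koszul_add_middle (hX : SmoothFieldOn V X) (hY : SmoothFieldOn V Y)
    (hY' : SmoothFieldOn V Y') (hZ : SmoothFieldOn V Z) :
    g.koszul X (Y + Y') Z p = g.koszul X Y Z p + g.koszul X Y' Z p := by
  simp only [PseudoRiemannianMetric.koszul, inner_add_right, inner_add_left,
    dirDeriv_add hV hp (hY.inner g hZ) (hY'.inner g hZ),
    dirDeriv_add hV hp (hX.inner g hY) (hX.inner g hY'), dirDeriv_add_field]
  simp only [PseudoRiemannianMetric.inner, bracket_add_left hV hp hY hY',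
    bracket_add_right hV hp hY hY', map_add, add_apply]
  ring

theorem koszul_smul_middle (hf : SmoothFunOn (d := d) V f) (hX : SmoothFieldOn V X)
    (hY : SmoothFieldOn V Y) (hZ : SmoothFieldOn V Z) :
    g.koszul X (f • Y) Z p =
      f p * g.koszul X Y Z p + 2 * dirDeriv X f p * g.inner Y Z p := by
  simp only [PseudoRiemannianMetric.koszul, inner_smul_right, inner_smul_left,
    dirDeriv_mul hV hp hf (hY.inner g hZ), dirDeriv_mul hV hp hf (hX.inner g hY),
    dirDeriv_smul_field]
  simp only [PseudoRiemannianMetric.inner, bracket_smul_left hV hp hf hY,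
    bracket_smul_right hV hp hf hY, map_add, map_smul, add_apply, smul_apply, smul_eq_mul,
    g.symm p (X p) (Y p), neg_smul, map_neg, neg_apply]
  ring

end Koszul

namespace IsFrameOn

variable {g} {E : Fin d → VField d M} {s : Fin d → ℝ} (hE : IsFrameOn g V E s)
include hE

/-- The definition of `nabla` is a metric trace over coordinate vectors, and such a trace may be
taken in any pseudo-orthonormal frame. This replaces coordinates, which change with the point, by
one frame on all of `V`. -/
theorem nabla_eq_sum (hp : p ∈ V) (hX : SmoothFieldOn V X) (hY : SmoothFieldOn V Y) :
    g.nabla X Y p = ∑ a, (s a * (1 / 2 * g.koszul X Y (E a) p)) • E a p := by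
  obtain ⟨W, hW, hpW, hb⟩ := exists_isOpen_smoothFieldOn_extend (d := d) p
  have hE' := hE.mono (hE.isOpen.inter hW) Set.inter_subset_left
  have hT := koszul_tensorialOn g (hE.isOpen.inter hW) ⟨hp, hpW⟩
    (hX.mono Set.inter_subset_left) (hY.mono Set.inter_subset_left)
  obtain ⟨L, hL⟩ := hE'.exists_linearMap hT ⟨hp, hpW⟩
  have hLi : ∀ i, g.koszul X Y (basisField p i) p = L (basisVec p i) := fun i => by
    rw [← basisField_self]
    exact hL _ ((hb _).mono Set.inter_subset_right)
  have h := hE'.sum_inverse_smul ⟨hp, hpW⟩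
    (((1 / 2 : ℝ) • L).smulRight (LinearMap.id : TangentSpace (𝓡 d) p →ₗ[ℝ] _))
  simp only [PseudoRiemannianMetric.nabla, hLi]
  refine Eq.trans ?_ (h.trans ?_)
  · refine Finset.sum_congr rfl fun i _ => Finset.sum_congr rfl fun j _ => ?_
    simp only [LinearMap.smulRight_apply, LinearMap.smul_apply, LinearMap.id_apply, smul_smul,
      smul_eq_mul]
    congr 1
    ring
  · refine Finset.sum_congr rfl fun a _ => ?_
    simp only [LinearMap.smulRight_apply, LinearMap.smul_apply, LinearMap.id_apply, smul_smul,
      smul_eq_mul, hL _ (hE'.smooth a)]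

theorem inner_nabla_frame (hp : p ∈ V) (hX : SmoothFieldOn V X) (hY : SmoothFieldOn V Y)
    (b : Fin d) : g.val p (g.nabla X Y p) (E b p) = 1 / 2 * g.koszul X Y (E b) p := by
  rw [hE.nabla_eq_sum hp hX hY]
  simp only [map_sum, map_smul, sum_apply, smul_apply,
    hE.orth p hp, smul_eq_mul, mul_ite, mul_zero, Finset.sum_ite_eq', Finset.mem_univ, if_true]
  rw [mul_right_comm, hE.sign, one_mul]

/-- The Koszul formula. -/
theorem inner_nabla (hp : p ∈ V) (hX : SmoothFieldOn V X) (hY : SmoothFieldOn V Y)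
    (hZ : SmoothFieldOn V Z) :
    g.val p (g.nabla X Y p) (Z p) = 1 / 2 * g.koszul X Y Z p := by
  rw [hE.tensorial_eq_sum (koszul_tensorialOn g hE.isOpen hp hX hY) hp hZ]
  conv_lhs => rw [hE.eq_sum hp (Z p)]
  simp only [map_sum, map_smul, smul_eq_mul, hE.inner_nabla_frame hp hX hY, Finset.mul_sum]
  exact Finset.sum_congr rfl fun a _ => by ring

theorem smooth_koszul (hX : SmoothFieldOn V X) (hY : SmoothFieldOn V Y)
    (hZ : SmoothFieldOn V Z) : SmoothFunOn (d := d) V (g.koszul X Y Z) :=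
  have h := hE.isOpen
  ((((((hY.inner g hZ).dirDeriv h hX).add ((hZ.inner g hX).dirDeriv h hY)).sub
    ((hX.inner g hY).dirDeriv h hZ)).add ((hX.bracket h hY).inner g hZ)).sub
      ((hY.bracket h hZ).inner g hX)).add ((hZ.bracket h hX).inner g hY)

theorem smooth_nabla (hX : SmoothFieldOn V X) (hY : SmoothFieldOn V Y) :
    SmoothFieldOn V (g.nabla X Y) := by
  have h : ∀ t : Finset (Fin d), SmoothFieldOn V
      (∑ a ∈ t, (fun q => s a * (1 / 2 * g.koszul X Y (E a) q)) • E a) := fun t => by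
    classical
    induction t using Finset.induction_on with
    | empty => simpa using SmoothFieldOn.zero
    | insert a t ha ih =>
      rw [Finset.sum_insert ha]
      exact SmoothFieldOn.add (((SmoothFunOn.const _).mul ((SmoothFunOn.const _).mul
        (hE.smooth_koszul hX hY (hE.smooth a)))).smul (hE.smooth a)) ih
  refine (h Finset.univ).congr fun q hq => ?_
  rw [hE.nabla_eq_sum hq hX hY, Finset.sum_apply]
  rfl

theorem nabla_congr (hp : p ∈ V) (hX : SmoothFieldOn V X) (hY : SmoothFieldOn V Y)
    (hXX' : ∀ q ∈ V, X' q = X q) (hYY' : ∀ q ∈ V, Y' q = Y q) :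
    g.nabla X' Y' p = g.nabla X Y p := by
  rw [hE.nabla_eq_sum hp hX hY, hE.nabla_eq_sum hp (hX.congr hXX') (hY.congr hYY')]
  exact Finset.sum_congr rfl fun a _ => by rw [koszul_congr g hE.isOpen hp hXX' hYY']

theorem nabla_add_left (hp : p ∈ V) (hX : SmoothFieldOn V X) (hX' : SmoothFieldOn V X')
    (hY : SmoothFieldOn V Y) : g.nabla (X + X') Y p = g.nabla X Y p + g.nabla X' Y p := by
  refine hE.ext_inner hp fun a => ?_
  rw [map_add, add_apply, hE.inner_nabla_frame hp (hX.add hX') hY, hE.inner_nabla_frame hp hX hY,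
    hE.inner_nabla_frame hp hX' hY, koszul_add_left g hE.isOpen hp hX hX' hY (hE.smooth a)]
  ring

theorem nabla_smul_left (hp : p ∈ V) (hf : SmoothFunOn (d := d) V f) (hX : SmoothFieldOn V X)
    (hY : SmoothFieldOn V Y) : g.nabla (f • X) Y p = f p • g.nabla X Y p := by
  refine hE.ext_inner hp fun a => ?_
  rw [map_smul, smul_apply, hE.inner_nabla_frame hp (hf.smul hX) hY,
    hE.inner_nabla_frame hp hX hY, koszul_smul_left g hE.isOpen hp hf hX hY (hE.smooth a),
    smul_eq_mul]
  ring

theorem nabla_add_right (hp : p ∈ V) (hX : SmoothFieldOn V X) (hY : SmoothFieldOn V Y)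
    (hY' : SmoothFieldOn V Y') : g.nabla X (Y + Y') p = g.nabla X Y p + g.nabla X Y' p := by
  refine hE.ext_inner hp fun a => ?_
  rw [map_add, add_apply, hE.inner_nabla_frame hp hX (hY.add hY'), hE.inner_nabla_frame hp hX hY,
    hE.inner_nabla_frame hp hX hY', koszul_add_middle g hE.isOpen hp hX hY hY' (hE.smooth a)]
  ring

theorem nabla_smul_right (hp : p ∈ V) (hf : SmoothFunOn (d := d) V f) (hX : SmoothFieldOn V X)
    (hY : SmoothFieldOn V Y) :
    g.nabla X (f • Y) p = dirDeriv X f p • Y p + f p • g.nabla X Y p := by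
  refine hE.ext_inner hp fun a => ?_
  rw [map_add, add_apply, map_smul, map_smul, smul_apply, smul_apply,
    hE.inner_nabla_frame hp hX (hf.smul hY), hE.inner_nabla_frame hp hX hY,
    koszul_smul_middle g hE.isOpen hp hf hX hY (hE.smooth a), PseudoRiemannianMetric.inner]
  simp only [smul_eq_mul]
  ring

theorem nabla_sub_nabla (hp : p ∈ V) (hX : SmoothFieldOn V X) (hY : SmoothFieldOn V Y) :
    g.nabla X Y p - g.nabla Y X p = bracket X Y p := by
  refine hE.ext_inner hp fun a => ?_
  rw [map_sub, sub_apply, hE.inner_nabla_frame hp hX hY, hE.inner_nabla_frame hp hY hX]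
  simp only [PseudoRiemannianMetric.koszul, inner_comm g (X := X) (Y := E a),
    inner_comm g (X := Y) (Y := E a), inner_comm g (X := Y) (Y := X)]
  simp only [PseudoRiemannianMetric.inner, bracket_swap (X := Y) (Y := X),
    bracket_swap (X := E a) (Y := X), bracket_swap (X := E a) (Y := Y), map_neg, neg_apply]
  ring

theorem dirDeriv_inner (hp : p ∈ V) (hX : SmoothFieldOn V X) (hY : SmoothFieldOn V Y)
    (hZ : SmoothFieldOn V Z) :
    dirDeriv X (g.inner Y Z) p =
      g.val p (g.nabla X Y p) (Z p) + g.val p (Y p) (g.nabla X Z p) := by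
  rw [g.symm p (Y p), hE.inner_nabla hp hX hY hZ, hE.inner_nabla hp hX hZ hY]
  simp only [PseudoRiemannianMetric.koszul, inner_comm g (X := Z) (Y := X),
    inner_comm g (X := Y) (Y := X), inner_comm g (X := Z) (Y := Y)]
  simp only [PseudoRiemannianMetric.inner, bracket_swap (X := Y) (Y := X),
    bracket_swap (X := Z) (Y := X), bracket_swap (X := Z) (Y := Y), map_neg, neg_apply]
  ring

end IsFrameOn

end LeviCivita

end Paracontact

namespace Paracontact

/-! ### Tensoriality of curvature, Ricci tensor and `L_U ∇`. -/

section Tensors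

variable {d : ℕ} {M : Type*} [TopologicalSpace M] [ChartedSpace (Model d) M]
  [IsManifold (𝓡 d) ∞ M] {V : Set M} {f : M → ℝ} {U X Y Z X' Y' : VField d M} {p : M}
  {g : PseudoRiemannianMetric d M}

namespace IsFrameOn

variable {E : Fin d → VField d M} {s : Fin d → ℝ} (hE : IsFrameOn g V E s)
include hE

/-- A frame field never vanishes, so it serves as the auxiliary field of the general commutator
formula. In dimension 0 there are no frame fields, but then every derivative is zero. -/
theorem dirDeriv_bracket (hp : p ∈ V) (hf : SmoothFunOn (d := d) V f)
    (hX : SmoothFieldOn V X) (hY : SmoothFieldOn V Y) :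
    dirDeriv (bracket X Y) f p =
      dirDeriv X (dirDeriv Y f) p - dirDeriv Y (dirDeriv X f) p := by
  rcases isEmpty_or_nonempty (Fin d) with h | ⟨⟨a⟩⟩
  · have h0 : ∀ v : TangentSpace (𝓡 d) p, v = 0 := fun v => by
      rw [hE.eq_sum hp v, Finset.univ_eq_empty, Finset.sum_empty]
    have h1 : ∀ (A : VField d M) (k : M → ℝ), dirDeriv A k p = 0 := fun A k => by
      rw [dirDeriv, h0 (A p), map_zero]
    simp [h1]
  · refine Paracontact.dirDeriv_bracket hE.isOpen hp hf hX hY (hE.smooth a) fun h0 => ?_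
    have h1 := hE.orth p hp a a
    have h2 := hE.sign a
    simp only [h0, map_zero, if_true] at h1
    simp [← h1] at h2

theorem exists_bilinearMap {W : Type*} [AddCommGroup W] [Module ℝ W]
    {B : VField d M → VField d M → W} (hp : p ∈ V)
    (h1 : ∀ Y, SmoothFieldOn V Y → TensorialOn V p (fun X => B X Y))
    (h2 : ∀ X, SmoothFieldOn V X → TensorialOn V p (fun Y => B X Y)) :
    ∃ L : TangentSpace (𝓡 d) p →ₗ[ℝ] TangentSpace (𝓡 d) p →ₗ[ℝ] W,
      ∀ X Y, SmoothFieldOn V X → SmoothFieldOn V Y → B X Y = L (X p) (Y p) := by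
  refine ⟨LinearMap.mk₂ ℝ (fun v w => ∑ a, (s a * g.val p v (E a p)) •
    ∑ b, (s b * g.val p w (E b p)) • B (E a) (E b)) ?_ ?_ ?_ ?_, fun X Y hX hY => ?_⟩
  · intro v v' w
    simp only [map_add, add_apply, mul_add, add_smul, Finset.sum_add_distrib]
  · intro c v w
    simp only [map_smul, smul_apply, smul_eq_mul, Finset.smul_sum (r := c), smul_smul]
    exact Finset.sum_congr rfl fun a _ => by rw [mul_left_comm]
  · intro v w w'
    simp only [map_add, add_apply, mul_add, add_smul, Finset.sum_add_distrib, smul_add]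
  · intro c v w
    simp only [map_smul, smul_apply, smul_eq_mul, Finset.smul_sum, smul_smul]
    exact Finset.sum_congr rfl fun a _ => Finset.sum_congr rfl fun b _ => by congr 1; ring
  · rw [hE.tensorial_eq_sum (h1 Y hY) hp hX]
    exact Finset.sum_congr rfl fun a _ => by
      rw [hE.tensorial_eq_sum (h2 (E a) (hE.smooth a)) hp hY]

/-- The metric trace of a tensorial operation can be computed in a pseudo-orthonormal frame. -/
theorem sum_inverse_smul_basisField {W : Type*} [AddCommGroup W] [Module ℝ W]
    {B : VField d M → VField d M → W} (hp : p ∈ V)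
    (h1 : ∀ W : Set M, IsOpen W → p ∈ W → W ⊆ V → ∀ Y, SmoothFieldOn W Y →
      TensorialOn W p (fun X => B X Y))
    (h2 : ∀ W : Set M, IsOpen W → p ∈ W → W ⊆ V → ∀ X, SmoothFieldOn W X →
      TensorialOn W p (fun Y => B X Y)) :
    ∑ i, ∑ j, g.inverse p i j • B (basisField p i) (basisField p j) =
      ∑ a, s a • B (E a) (E a) := by
  -- The fields `basisField p i` are known to be smooth only near `p`, so the frame is restricted to
  -- a smaller neighbourhood. This is why tensoriality is assumed on all smaller open sets.
  obtain ⟨W, hW, hpW, hb⟩ := exists_isOpen_smoothFieldOn_extend (d := d) p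
  have hVW := hE.isOpen.inter hW
  have hE' := hE.mono hVW Set.inter_subset_left
  obtain ⟨L, hL⟩ := hE'.exists_bilinearMap ⟨hp, hpW⟩
    (h1 _ hVW ⟨hp, hpW⟩ Set.inter_subset_left) (h2 _ hVW ⟨hp, hpW⟩ Set.inter_subset_left)
  have hs : ∀ i, SmoothFieldOn (V ∩ W) (basisField p i) := fun i =>
    (hb _).mono Set.inter_subset_right
  have h := hE'.sum_inverse_smul ⟨hp, hpW⟩ L
  rw [show ∑ a, s a • B (E a) (E a) = ∑ a, s a • L (E a p) (E a p) from
    Finset.sum_congr rfl fun a _ => by rw [hL _ _ (hE'.smooth a) (hE'.smooth a)], ← h]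
  exact Finset.sum_congr rfl fun i _ => Finset.sum_congr rfl fun j _ => by
    rw [hL _ _ (hs i) (hs j), basisField_self, basisField_self]

theorem nabla_neg_left (hp : p ∈ V) (hX : SmoothFieldOn V X) (hY : SmoothFieldOn V Y) :
    g.nabla (-X) Y p = -g.nabla X Y p := by
  have h : -X = (fun _ : M => (-1 : ℝ)) • X := by funext q; simp
  rw [h, hE.nabla_smul_left hp (SmoothFunOn.const _) hX hY, neg_smul, one_smul]

theorem nabla_nabla_add (hp : p ∈ V) (hX : SmoothFieldOn V X) (hY : SmoothFieldOn V Y)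
    (hZ : SmoothFieldOn V Z) (hU : SmoothFieldOn V U) :
    g.nabla X (g.nabla Y (Z + U)) p =
      g.nabla X (g.nabla Y Z) p + g.nabla X (g.nabla Y U) p := by
  rw [← hE.nabla_add_right hp hX (hE.smooth_nabla hY hZ) (hE.smooth_nabla hY hU)]
  exact hE.nabla_congr hp hX ((hE.smooth_nabla hY hZ).add (hE.smooth_nabla hY hU))
    (fun _ _ => rfl) fun q hq => hE.nabla_add_right hq hY hZ hU

theorem nabla_nabla_smul (hp : p ∈ V) (hX : SmoothFieldOn V X) (hY : SmoothFieldOn V Y)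
    (hf : SmoothFunOn (d := d) V f) (hZ : SmoothFieldOn V Z) :
    g.nabla X (g.nabla Y (f • Z)) p =
      dirDeriv X (dirDeriv Y f) p • Z p + dirDeriv Y f p • g.nabla X Z p
        + dirDeriv X f p • g.nabla Y Z p + f p • g.nabla X (g.nabla Y Z) p := by
  have h1 := (hf.dirDeriv hE.isOpen hY).smul hZ
  have h2 := hf.smul (hE.smooth_nabla hY hZ)
  rw [hE.nabla_congr (X' := X) (Y' := g.nabla Y (f • Z)) hp hX (h1.add h2) (fun _ _ => rfl)
    fun q hq => hE.nabla_smul_right hq hf hY hZ, hE.nabla_add_right hp hX h1 h2,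
    hE.nabla_smul_right hp (hf.dirDeriv hE.isOpen hY) hX hZ,
    hE.nabla_smul_right hp hf hX (hE.smooth_nabla hY hZ)]
  abel

/-- The terms with first derivatives of `f` are symmetric in `X` and `Y`. The second derivatives
combine to `[X,Y]f - (XYf - YXf) = 0`. -/
theorem curvature_tensorialOn_right (hp : p ∈ V) (hX : SmoothFieldOn V X)
    (hY : SmoothFieldOn V Y) : TensorialOn V p (fun Z => g.curvature X Y Z p) where
  add {Z U} hZ hU := by
    simp only [PseudoRiemannianMetric.curvature,
      hE.nabla_add_right hp (hX.bracket hE.isOpen hY) hZ hU, hE.nabla_nabla_add hp hX hY hZ hU,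
      hE.nabla_nabla_add hp hY hX hZ hU]
    abel
  smul {f Z} hf hZ := by
    simp only [PseudoRiemannianMetric.curvature,
      hE.nabla_smul_right hp hf (hX.bracket hE.isOpen hY) hZ,
      hE.nabla_nabla_smul hp hX hY hf hZ, hE.nabla_nabla_smul hp hY hX hf hZ,
      hE.dirDeriv_bracket hp hf hX hY, sub_smul, smul_sub]
    abel

theorem curvature_tensorialOn_left (hp : p ∈ V) (hY : SmoothFieldOn V Y)
    (hZ : SmoothFieldOn V Z) : TensorialOn V p (fun X => g.curvature X Y Z p) where
  add {X U} hX hU := by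
    have hV := hE.isOpen
    simp only [PseudoRiemannianMetric.curvature]
    rw [hE.nabla_congr (X' := bracket (X + U) Y) (Y' := Z) hp
        ((hX.bracket hV hY).add (hU.bracket hV hY)) hZ
        (fun q hq => bracket_add_left hV hq hX hU) (fun _ _ => rfl),
      hE.nabla_add_left hp (hX.bracket hV hY) (hU.bracket hV hY) hZ,
      hE.nabla_add_left hp hX hU (hE.smooth_nabla hY hZ),
      hE.nabla_congr (X' := Y) (Y' := g.nabla (X + U) Z) hp hY
        ((hE.smooth_nabla hX hZ).add (hE.smooth_nabla hU hZ)) (fun _ _ => rfl)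
        (fun q hq => hE.nabla_add_left hq hX hU hZ),
      hE.nabla_add_right hp hY (hE.smooth_nabla hX hZ) (hE.smooth_nabla hU hZ)]
    abel
  smul {f X} hf hX := by
    have hV := hE.isOpen
    have hYf := (hf.dirDeriv hV hY).neg
    simp only [PseudoRiemannianMetric.curvature]
    rw [hE.nabla_congr (X' := bracket (f • X) Y) (Y' := Z) hp
        ((hYf.smul hX).add (hf.smul (hX.bracket hV hY))) hZ
        (fun q hq => bracket_smul_left hV hq hf hX) (fun _ _ => rfl),
      hE.nabla_add_left hp (hYf.smul hX) (hf.smul (hX.bracket hV hY)) hZ,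
      hE.nabla_smul_left hp hYf hX hZ, hE.nabla_smul_left hp hf (hX.bracket hV hY) hZ,
      hE.nabla_smul_left hp hf hX (hE.smooth_nabla hY hZ),
      hE.nabla_congr (X' := Y) (Y' := g.nabla (f • X) Z) hp hY
        (hf.smul (hE.smooth_nabla hX hZ)) (fun _ _ => rfl)
        (fun q hq => hE.nabla_smul_left hq hf hX hZ),
      hE.nabla_smul_right hp hf hY (hE.smooth_nabla hX hZ), neg_smul, smul_sub, smul_sub]
    abel

theorem curvature_swap (hp : p ∈ V) (hX : SmoothFieldOn V X) (hY : SmoothFieldOn V Y)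
    (hZ : SmoothFieldOn V Z) : g.curvature X Y Z p = -g.curvature Y X Z p := by
  have h : bracket X Y = -bracket Y X := VectorField.mlieBracket_swap
  simp only [PseudoRiemannianMetric.curvature]
  rw [h, hE.nabla_neg_left hp (hY.bracket hE.isOpen hX) hZ]
  abel

theorem curvature_tensorialOn_middle (hp : p ∈ V) (hX : SmoothFieldOn V X)
    (hZ : SmoothFieldOn V Z) : TensorialOn V p (fun Y => g.curvature X Y Z p) where
  add {Y U} hY hU := by
    rw [hE.curvature_swap hp hX (hY.add hU) hZ, (hE.curvature_tensorialOn_left hp hX hZ).add hY hU,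
      hE.curvature_swap hp hX hY hZ, hE.curvature_swap hp hX hU hZ, neg_add]
  smul {f Y} hf hY := by
    rw [hE.curvature_swap hp hX (hf.smul hY) hZ,
      (hE.curvature_tensorialOn_left hp hX hZ).smul hf hY, hE.curvature_swap hp hX hY hZ, smul_neg]

theorem ricci_eq_sum (hp : p ∈ V) (hY : SmoothFieldOn V Y) (hZ : SmoothFieldOn V Z) :
    g.ricci Y Z p = ∑ a, s a * g.val p (g.curvature Y (E a) Z p) (E a p) := by
  obtain ⟨W, hW, hpW, hb⟩ := exists_isOpen_smoothFieldOn_extend (d := d) p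
  have hE' := hE.mono (hE.isOpen.inter hW) Set.inter_subset_left
  obtain ⟨L, hL⟩ := hE'.exists_linearMap (hE'.curvature_tensorialOn_middle ⟨hp, hpW⟩
    (hY.mono Set.inter_subset_left) (hZ.mono Set.inter_subset_left)) ⟨hp, hpW⟩
  simp only [PseudoRiemannianMetric.ricci]
  rw [show ∑ i, component (g.curvature Y (basisField p i) Z p) i =
    ∑ i, component (L (basisVec p i)) i from Finset.sum_congr rfl fun i _ => by
      rw [hL (basisField p i) ((hb _).mono Set.inter_subset_right), basisField_self],
    hE'.sum_component ⟨hp, hpW⟩ L]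
  exact Finset.sum_congr rfl fun a _ => by rw [hL _ (hE'.smooth a)]

theorem ricci_tensorialOn_left (hp : p ∈ V) (hZ : SmoothFieldOn V Z) :
    TensorialOn V p (fun Y => g.ricci Y Z p) where
  add {X Y} hX hY := by
    rw [hE.ricci_eq_sum hp (hX.add hY) hZ, hE.ricci_eq_sum hp hX hZ, hE.ricci_eq_sum hp hY hZ,
      ← Finset.sum_add_distrib]
    exact Finset.sum_congr rfl fun a _ => by
      rw [(hE.curvature_tensorialOn_left hp (hE.smooth a) hZ).add hX hY, map_add, add_apply, mul_add]
  smul {f X} hf hX := by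
    rw [hE.ricci_eq_sum hp (hf.smul hX) hZ, hE.ricci_eq_sum hp hX hZ, Finset.smul_sum]
    exact Finset.sum_congr rfl fun a _ => by
      rw [(hE.curvature_tensorialOn_left hp (hE.smooth a) hZ).smul hf hX, map_smul, smul_apply,
        smul_eq_mul, smul_eq_mul, mul_left_comm]

theorem ricci_tensorialOn_right (hp : p ∈ V) (hY : SmoothFieldOn V Y) :
    TensorialOn V p (fun Z => g.ricci Y Z p) where
  add {X Z} hX hZ := by
    rw [hE.ricci_eq_sum hp hY (hX.add hZ), hE.ricci_eq_sum hp hY hX, hE.ricci_eq_sum hp hY hZ,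
      ← Finset.sum_add_distrib]
    exact Finset.sum_congr rfl fun a _ => by
      rw [(hE.curvature_tensorialOn_right hp hY (hE.smooth a)).add hX hZ, map_add, add_apply,
        mul_add]
  smul {f X} hf hX := by
    rw [hE.ricci_eq_sum hp hY (hf.smul hX), hE.ricci_eq_sum hp hY hX, Finset.smul_sum]
    exact Finset.sum_congr rfl fun a _ => by
      rw [(hE.curvature_tensorialOn_right hp hY (hE.smooth a)).smul hf hX, map_smul, smul_apply,
        smul_eq_mul, smul_eq_mul, mul_left_comm]

theorem scalarCurvature_eq_sum (hp : p ∈ V) :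
    g.scalarCurvature p = ∑ a, s a * g.ricci (E a) (E a) p :=
  hE.sum_inverse_smul_basisField (B := fun X Y => g.ricci X Y p) hp
    (fun _ hW hpW hWV _ hY => (hE.mono hW hWV).ricci_tensorialOn_left hpW hY)
    (fun _ hW hpW hWV _ hX => (hE.mono hW hWV).ricci_tensorialOn_right hpW hX)

theorem lieNabla_tensorialOn_left (hp : p ∈ V) (hU : SmoothFieldOn V U)
    (hY : SmoothFieldOn V Y) : TensorialOn V p (fun X => g.lieNabla U X Y p) where
  add {X Z} hX hZ := by
    have hV := hE.isOpen
    have h1 := hE.smooth_nabla hX hY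
    have h2 := hE.smooth_nabla hZ hY
    simp only [PseudoRiemannianMetric.lieNabla]
    rw [bracket_congr (X := U) (Y := g.nabla (X + Z) Y) (X' := U) hV hp (fun _ _ => rfl)
        (fun q hq => hE.nabla_add_left hq hX hZ hY),
      hE.nabla_congr (X' := bracket U (X + Z)) (Y' := Y) hp
        ((hU.bracket hV hX).add (hU.bracket hV hZ)) hY
        (fun q hq => bracket_add_right hV hq hX hZ) (fun _ _ => rfl),
      hE.nabla_add_left hp (hU.bracket hV hX) (hU.bracket hV hZ) hY,
      hE.nabla_add_left hp hX hZ (hU.bracket hV hY)]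
    erw [bracket_add_right (X := g.nabla X Y) (Y := g.nabla Z Y) hV hp h1 h2]
    abel
  smul {f X} hf hX := by
    have hV := hE.isOpen
    have h1 := hE.smooth_nabla hX hY
    have hUf := hf.dirDeriv hV hU
    simp only [PseudoRiemannianMetric.lieNabla]
    rw [bracket_congr (X := U) (Y := g.nabla (f • X) Y) (X' := U) (Y' := f • g.nabla X Y) hV hp
        (fun _ _ => rfl) (fun q hq => hE.nabla_smul_left hq hf hX hY),
      hE.nabla_congr (X' := bracket U (f • X)) (Y' := Y) hp
        ((hUf.smul hX).add (hf.smul (hU.bracket hV hX))) hY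
        (fun q hq => bracket_smul_right hV hq hf hX) (fun _ _ => rfl),
      hE.nabla_add_left hp (hUf.smul hX) (hf.smul (hU.bracket hV hX)) hY,
      hE.nabla_smul_left hp hUf hX hY, hE.nabla_smul_left hp hf (hU.bracket hV hX) hY,
      hE.nabla_smul_left hp hf hX (hU.bracket hV hY), bracket_smul_right hV hp hf h1,
      smul_sub, smul_sub]
    abel

/-- The second derivatives of `f` enter as `UXf - XUf - [U,X]f`, which is zero. -/
theorem lieNabla_tensorialOn_right (hp : p ∈ V) (hU : SmoothFieldOn V U)
    (hX : SmoothFieldOn V X) : TensorialOn V p (fun Y => g.lieNabla U X Y p) where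
  add {Y Z} hY hZ := by
    have hV := hE.isOpen
    have h1 := hE.smooth_nabla hX hY
    have h2 := hE.smooth_nabla hX hZ
    simp only [PseudoRiemannianMetric.lieNabla]
    rw [bracket_congr (X := U) (Y := g.nabla X (Y + Z)) (X' := U)
        (Y' := g.nabla X Y + g.nabla X Z) hV hp (fun _ _ => rfl)
        (fun q hq => hE.nabla_add_right hq hX hY hZ),
      hE.nabla_congr (X' := X) (Y' := bracket U (Y + Z)) hp hX
        ((hU.bracket hV hY).add (hU.bracket hV hZ)) (fun _ _ => rfl)
        (fun q hq => bracket_add_right hV hq hY hZ),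
      hE.nabla_add_right hp hX (hU.bracket hV hY) (hU.bracket hV hZ),
      hE.nabla_add_right hp (hU.bracket hV hX) hY hZ, bracket_add_right hV hp h1 h2]
    abel
  smul {f Y} hf hY := by
    have hV := hE.isOpen
    have h1 := hE.smooth_nabla hX hY
    have hUf := hf.dirDeriv hV hU
    have hXf := hf.dirDeriv hV hX
    simp only [PseudoRiemannianMetric.lieNabla]
    rw [bracket_congr (X := U) (Y := g.nabla X (f • Y)) (X' := U)
        (Y' := dirDeriv X f • Y + f • g.nabla X Y) hV hp
        (fun _ _ => rfl) (fun q hq => hE.nabla_smul_right hq hf hX hY),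
      hE.nabla_congr (X' := X) (Y' := bracket U (f • Y)) hp hX
        ((hUf.smul hY).add (hf.smul (hU.bracket hV hY))) (fun _ _ => rfl)
        (fun q hq => bracket_smul_right hV hq hf hY),
      hE.nabla_add_right hp hX (hUf.smul hY) (hf.smul (hU.bracket hV hY)),
      hE.nabla_smul_right hp hUf hX hY, hE.nabla_smul_right hp hf hX (hU.bracket hV hY),
      hE.nabla_smul_right hp hf (hU.bracket hV hX) hY, hE.dirDeriv_bracket hp hf hU hX,
      bracket_add_right hV hp (hXf.smul hY) (hf.smul h1), bracket_smul_right hV hp hf h1,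
      bracket_smul_right hV hp hXf hY, smul_sub, smul_sub, sub_smul]
    abel

theorem trace_lieNabla (hp : p ∈ V) (hU : SmoothFieldOn V U) :
    ∑ i, ∑ j, g.inverse p i j • g.lieNabla U (basisField p i) (basisField p j) p =
      ∑ a, s a • g.lieNabla U (E a) (E a) p :=
  hE.sum_inverse_smul_basisField (B := fun X Y => g.lieNabla U X Y p) hp
    (fun _ hW hpW hWV _ hY => (hE.mono hW hWV).lieNabla_tensorialOn_left hpW (hU.mono hWV) hY)
    (fun _ hW hpW hWV _ hX => (hE.mono hW hWV).lieNabla_tensorialOn_right hpW (hU.mono hWV) hX)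

/-- `L_U g` is the symmetrisation of `∇ U`. -/
theorem lieMetric_eq (hp : p ∈ V) (hU : SmoothFieldOn V U) (hX : SmoothFieldOn V X)
    (hY : SmoothFieldOn V Y) :
    g.lieMetric U X Y p = g.val p (g.nabla X U p) (Y p) + g.val p (X p) (g.nabla Y U p) := by
  simp only [PseudoRiemannianMetric.lieMetric, hE.dirDeriv_inner hp hU hX hY]
  simp only [PseudoRiemannianMetric.inner, ← hE.nabla_sub_nabla hp hU hX,
    ← hE.nabla_sub_nabla hp hU hY, map_sub, sub_apply]
  ring

end IsFrameOn

end Tensors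

/-! ### Algebra of the structure tensors; tensoriality of `h`, `dη` and the Nijenhuis torsion. -/

section Structures

variable {d : ℕ} {M : Type*} [TopologicalSpace M] [ChartedSpace (Model d) M]
  [IsManifold (𝓡 d) ∞ M] {V : Set M} {f : M → ℝ} {X Y Z : VField d M} {p : M}
  (S : AlmostParacontactMetric d M)

namespace AlmostParacontactMetric

theorem smooth_phiF (hX : SmoothFieldOn V X) : SmoothFieldOn V (S.phiF X) :=
  ContMDiffOn.clm_bundle_apply (F₁ := Model d) (F₂ := Model d)
    (E₁ := fun p : M => TangentSpace (𝓡 d) p) (E₂ := fun p : M => TangentSpace (𝓡 d) p)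
    S.phi_smooth.contMDiffOn hX

theorem smooth_etaF (hX : SmoothFieldOn V X) : SmoothFunOn (d := d) V (S.etaF X) := by
  have h : ContMDiffOn (𝓡 d) ((𝓡 d).prod 𝓘(ℝ)) ∞ (fun m =>
      Bundle.TotalSpace.mk' ℝ (E := Bundle.Trivial M ℝ) m (S.eta m (X m))) V :=
    ContMDiffOn.clm_bundle_apply (F₁ := Model d) (F₂ := ℝ)
      (E₁ := fun p : M => TangentSpace (𝓡 d) p) (E₂ := Bundle.Trivial M ℝ)
      S.eta_smooth.contMDiffOn hX
  exact fun q hq => ((Bundle.contMDiffWithinAt_totalSpace (f := fun m =>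
      Bundle.TotalSpace.mk' ℝ (E := Bundle.Trivial M ℝ) m (S.eta m (X m)))).1 (h q hq)).2

theorem phiF_add : S.phiF (X + Y) = S.phiF X + S.phiF Y := by funext q; simp [phiF]

theorem phiF_smul : S.phiF (f • X) = f • S.phiF X := by funext q; simp [phiF]

theorem etaF_add : S.etaF (X + Y) = fun q => S.etaF X q + S.etaF Y q := by funext q; simp [etaF]

theorem etaF_smul : S.etaF (f • X) = fun q => f q * S.etaF X q := by funext q; simp [etaF]

/-- Compatibility of `g` and `φ`, applied to `v` and `ξ`; the left side vanishes because `φξ = 0`.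
-/
theorem val_xi_right (v : TangentSpace (𝓡 d) p) : S.g.val p v (S.xi p) = S.eta p v := by
  have h := S.compatible p v (S.xi p)
  rw [S.phi_xi, map_zero, S.eta_xi] at h
  linarith

theorem val_xi_left (v : TangentSpace (𝓡 d) p) : S.g.val p (S.xi p) v = S.eta p v := by
  rw [S.g.symm, S.val_xi_right]

theorem val_phi_left (v w : TangentSpace (𝓡 d) p) :
    S.g.val p (S.phi p v) w = -S.g.val p v (S.phi p w) := by
  have h := S.compatible p v (S.phi p w)
  rw [S.phi_phi, map_sub, map_smul, S.val_xi_right, S.eta_phi, S.eta_phi] at h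
  simpa using h

variable (hV : IsOpen V) (hp : p ∈ V)
include hV hp

theorem h_tensorialOn : TensorialOn V p (fun X => S.h X p) where
  add {X Y} hX hY := by
    simp only [h, phiF_add, bracket_add_right hV hp hX hY,
      bracket_add_right hV hp (S.smooth_phiF hX) (S.smooth_phiF hY), map_add, smul_add, smul_sub]
    abel
  smul {f X} hf hX := by
    simp only [h, phiF_smul, bracket_smul_right hV hp hf hX,
      bracket_smul_right hV hp hf (S.smooth_phiF hX), map_add, map_smul, phiF, add_sub_add_left_eq_sub,
      ← smul_sub, smul_comm (f p)]

theorem dEta_tensorialOn_right :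
    TensorialOn V p (fun Y => S.dEta X Y p) where
  add {Y Z} hY hZ := by
    simp only [dEta, etaF_add, dirDeriv_add hV hp (S.smooth_etaF hY) (S.smooth_etaF hZ),
      dirDeriv_add_field]
    simp only [etaF, bracket_add_right hV hp hY hZ, map_add]
    ring
  smul {f Y} hf hY := by
    simp only [dEta, etaF_smul, dirDeriv_mul hV hp hf (S.smooth_etaF hY), dirDeriv_smul_field]
    simp only [etaF, bracket_smul_right hV hp hf hY, map_add, map_smul, smul_eq_mul]
    ring

theorem dEta_tensorialOn_left :
    TensorialOn V p (fun X => S.dEta X Y p) where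
  add {X Z} hX hZ := by
    simp only [dEta, etaF_add, dirDeriv_add hV hp (S.smooth_etaF hX) (S.smooth_etaF hZ),
      dirDeriv_add_field]
    simp only [etaF, bracket_add_left hV hp hX hZ, map_add]
    ring
  smul {f X} hf hX := by
    simp only [dEta, etaF_smul, dirDeriv_mul hV hp hf (S.smooth_etaF hX), dirDeriv_smul_field]
    simp only [etaF, bracket_smul_left hV hp hf hX, map_add, map_smul, smul_eq_mul, neg_smul,
      map_neg]
    ring

theorem nijenhuis_tensorialOn_right :
    TensorialOn V p (fun Y => S.nijenhuis X Y p) where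
  add {Y Z} hY hZ := by
    simp only [nijenhuis, phiF_add, bracket_add_right hV hp hY hZ,
      bracket_add_right hV hp (S.smooth_phiF hY) (S.smooth_phiF hZ), map_add]
    abel
  smul {f Y} hf hY := by
    simp only [nijenhuis, phiF_smul, bracket_smul_right hV hp hf hY,
      bracket_smul_right hV hp hf (S.smooth_phiF hY), map_add, map_smul, phiF, smul_add, smul_sub]
    abel

omit hV hp in
theorem nijenhuis_swap : S.nijenhuis X Y p = -S.nijenhuis Y X p := by
  simp only [nijenhuis, bracket_swap (X := X) (Y := Y), bracket_swap (X := S.phiF X) (Y := Y),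
    bracket_swap (X := X) (Y := S.phiF Y), bracket_swap (X := S.phiF X) (Y := S.phiF Y), map_neg]
  abel

end AlmostParacontactMetric

end Structures

end Paracontact

namespace Paracontact

/-! ### Existence of local φ-bases and components with respect to them. -/

namespace AlmostParacontactMetric

variable {M : Type*} [TopologicalSpace M] [ChartedSpace (Model 3) M]
  [IsManifold (𝓡 3) ∞ M] {S : AlmostParacontactMetric 3 M} {V : Set M} {e X Y Z : VField 3 M}
  {p : M}

-- On `ker η` the map `φ` reverses the sign of `g(v, v)`. If no vector there were space-like, `g`
-- would vanish on `ker η`, nondegeneracy would give `ker η = 0`, and the dimension would be at most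
-- one.
variable (S) in
theorem exists_val_self_pos (p : M) :
    ∃ v : TangentSpace (𝓡 3) p, S.eta p v = 0 ∧ 0 < S.g.val p v v := by
  by_contra! hcon
  have hneg : ∀ v, S.eta p v = 0 → S.g.val p (S.phi p v) (S.phi p v) = -S.g.val p v v :=
    fun v hv => by rw [S.compatible, hv]; ring
  have h0 : ∀ v, S.eta p v = 0 → S.g.val p v v = 0 := fun v hv => by
    have h1 := hcon v hv
    have h2 := hcon (S.phi p v) (S.eta_phi p v)
    rw [hneg v hv] at h2
    linarith
  have h1 : ∀ v w, S.eta p v = 0 → S.eta p w = 0 → S.g.val p v w = 0 := fun v w hv hw => by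
    have h := h0 (v + w) (by rw [map_add, hv, hw, add_zero])
    simp only [map_add, add_apply, h0 v hv, h0 w hw, S.g.symm p w v] at h
    linarith
  have h2 : ∀ v, S.eta p v = 0 → v = 0 := fun v hv => S.g.nondegenerate p v fun w => by
    have h3 := h1 v (w - S.eta p w • S.xi p) hv (by simp [S.eta_xi])
    rw [map_sub, map_smul, S.val_xi_right, hv] at h3
    simpa using h3
  have h3 : ∀ v, v = S.eta p v • S.xi p := fun v =>
    sub_eq_zero.1 (h2 _ (by simp [S.eta_xi]))
  have h4 : Module.finrank ℝ (TangentSpace (𝓡 3) p) ≤ 1 :=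
    finrank_le_one (S.xi p) fun v => ⟨S.eta p v, (h3 v).symm⟩
  have h5 : Module.finrank ℝ (TangentSpace (𝓡 3) p) = 3 :=
    finrank_euclideanSpace_fin (𝕜 := ℝ) (n := 3)
  omega

variable (S) in
/-- Every point has a neighbourhood with a `φ`-basis. -/
theorem exists_isPhiBasis (p : M) : ∃ (V : Set M) (e : VField 3 M), p ∈ V ∧ S.IsPhiBasis V e := by
  obtain ⟨v, hv, hpos⟩ := S.exists_val_self_pos p
  obtain ⟨W, hW, hpW, hb⟩ := exists_isOpen_smoothFieldOn_extend (d := 3) p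
  -- The map `φ²` is the projection to `ker η`. It puts the extended field into `ker η` everywhere
  -- and does not change its value `v` at `p`.
  set X : VField 3 M := S.phiF (S.phiF (FiberBundle.extend (Model 3) v))
  have hX : SmoothFieldOn W X := S.smooth_phiF (S.smooth_phiF (hb v))
  have hXp : X p = v := by simp [X, phiF, S.phi_phi, hv]
  have hXη : ∀ q, S.eta q (X q) = 0 := fun q => S.eta_phi q _
  set ρ : M → ℝ := S.g.inner X X
  have hρ : SmoothFunOn (d := 3) W ρ := hX.inner S.g hX
  have hρp : 0 < ρ p := by simpa [ρ, PseudoRiemannianMetric.inner, hXp] using hpos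
  set V := W ∩ ρ ⁻¹' Set.Ioi 0
  have hV : IsOpen V := (ContMDiffOn.continuousOn hρ).isOpen_inter_preimage hW isOpen_Ioi
  have hVW : V ⊆ W := Set.inter_subset_left
  have hpos : ∀ q ∈ V, 0 < ρ q := fun q hq => hq.2
  have hsq : ∀ q ∈ V, 0 < √(ρ q) := fun q hq => Real.sqrt_pos.2 (hpos q hq)
  set e : VField 3 M := (fun q => (√(ρ q))⁻¹) • X
  have hee : ∀ q ∈ V, S.g.val q (e q) (e q) = 1 := fun q hq => by
    have h1 : S.g.val q (e q) (e q) = (√(ρ q))⁻¹ * ((√(ρ q))⁻¹ * ρ q) := by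
      simp [e, ρ, PseudoRiemannianMetric.inner]
    rw [h1]
    nth_rewrite 3 [← Real.mul_self_sqrt (hpos q hq).le]
    have := (hsq q hq).ne'
    field_simp
  have heη : ∀ q, S.eta q (e q) = 0 := fun q => by simp [e, hXη]
  refine ⟨V, e, ⟨hpW, hρp⟩, hV, ?_, ?_, hee, ?_, ?_, ?_, ?_⟩
  · exact (((hρ.mono hVW).sqrt fun q hq => (hpos q hq).ne').inv fun q hq => (hsq q hq).ne').smul
      (hX.mono hVW)
  · intro q _
    rw [PseudoRiemannianMetric.inner, S.val_xi_left, S.eta_xi]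
  · intro q hq
    rw [PseudoRiemannianMetric.inner, phiF, S.compatible, hee q hq, heη]
    ring
  · intro q _
    rw [PseudoRiemannianMetric.inner, S.val_xi_left, heη]
  · intro q _
    rw [PseudoRiemannianMetric.inner, phiF, S.val_xi_left, S.eta_phi]
  · intro q _
    have h1 := S.val_phi_left (e q) (e q)
    rw [S.g.symm] at h1
    rw [PseudoRiemannianMetric.inner, phiF]
    linarith

variable (S) in
/-- The vector `x ξ + y e + z φ e` at `p`. -/
noncomputable def vec (e : VField 3 M) (p : M) (x y z : ℝ) : TangentSpace (𝓡 3) p :=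
  x • S.xi p + y • e p + z • S.phiF e p

variable (S) in
/-- The vector field `u ξ + v e + w φ e`. -/
noncomputable def comb (e : VField 3 M) (u v w : M → ℝ) : VField 3 M :=
  fun p => S.vec e p (u p) (v p) (w p)

variable (S) in
/-- The connection coefficient `b = g(∇_e φe, e)`. -/
noncomputable def coefB (e : VField 3 M) (p : M) : ℝ :=
  S.g.inner (S.g.nabla e (S.phiF e)) e p

variable (S) in
/-- The connection coefficient `c = g(∇_{φe} φe, e)`. -/
noncomputable def coefC (e : VField 3 M) (p : M) : ℝ :=
  S.g.inner (S.g.nabla (S.phiF e) (S.phiF e)) e p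

theorem vec_add (x y z x' y' z' : ℝ) :
    S.vec e p x y z + S.vec e p x' y' z' = S.vec e p (x + x') (y + y') (z + z') := by
  simp only [vec]; module

theorem vec_sub (x y z x' y' z' : ℝ) :
    S.vec e p x y z - S.vec e p x' y' z' = S.vec e p (x - x') (y - y') (z - z') := by
  simp only [vec]; module

theorem vec_smul (r x y z : ℝ) : r • S.vec e p x y z = S.vec e p (r * x) (r * y) (r * z) := by
  simp only [vec]; module

theorem vec_neg (x y z : ℝ) : -S.vec e p x y z = S.vec e p (-x) (-y) (-z) := by
  simp only [vec]; module

namespace IsPhiBasis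

variable (hB : S.IsPhiBasis V e)
include hB

theorem frame : IsFrameOn S.g V ![S.xi, e, S.phiF e] ![1, 1, -1] where
  isOpen := hB.isOpen
  smooth a := by
    fin_cases a
    · exact S.xi_smooth.on V
    · exact hB.smooth
    · exact S.smooth_phiF hB.smooth
  sign a := by fin_cases a <;> norm_num
  orth p hp a b := by
    have h1 := hB.xi_xi p hp
    have h2 := hB.e_e p hp
    have h3 := hB.phi_phi p hp
    have h4 := hB.xi_e p hp
    have h5 := hB.xi_phi p hp
    have h6 := hB.e_phi p hp
    simp only [PseudoRiemannianMetric.inner] at h1 h2 h3 h4 h5 h6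
    fin_cases a <;> fin_cases b <;>
      simp [h1, h2, h3, h4, h5, h6, S.g.symm p (e p) (S.xi p),
        S.g.symm p (S.phiF e p) (S.xi p), S.g.symm p (S.phiF e p) (e p)]

theorem smooth_xi : SmoothFieldOn V S.xi := S.xi_smooth.on V

theorem smooth_phi : SmoothFieldOn V (S.phiF e) := S.smooth_phiF hB.smooth

theorem eq_vec (hp : p ∈ V) (v : TangentSpace (𝓡 3) p) :
    v = S.vec e p (S.g.val p v (S.xi p)) (S.g.val p v (e p)) (-S.g.val p v (S.phiF e p)) := by
  conv_lhs => rw [hB.frame.eq_sum hp v]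
  simp [Fin.sum_univ_three, vec]

theorem val_vec_xi (hp : p ∈ V) (x y z : ℝ) : S.g.val p (S.vec e p x y z) (S.xi p) = x := by
  have h1 := hB.xi_xi p hp
  have h2 := hB.xi_e p hp
  have h3 := hB.xi_phi p hp
  simp only [PseudoRiemannianMetric.inner] at h1 h2 h3
  simp [vec, h1, h2, h3, S.g.symm p _ (S.xi p)]

theorem val_vec_e (hp : p ∈ V) (x y z : ℝ) : S.g.val p (S.vec e p x y z) (e p) = y := by
  have h1 := hB.e_e p hp
  have h2 := hB.xi_e p hp
  have h3 := hB.e_phi p hp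
  simp only [PseudoRiemannianMetric.inner] at h1 h2 h3
  simp [vec, h1, h2, h3, S.g.symm p (S.phiF e p) (e p)]

theorem val_vec_phi (hp : p ∈ V) (x y z : ℝ) :
    S.g.val p (S.vec e p x y z) (S.phiF e p) = -z := by
  have h1 := hB.phi_phi p hp
  have h2 := hB.xi_phi p hp
  have h3 := hB.e_phi p hp
  simp only [PseudoRiemannianMetric.inner] at h1 h2 h3
  simp [vec, h1, h2, h3]

theorem vec_inj (hp : p ∈ V) {x y z x' y' z' : ℝ} :
    S.vec e p x y z = S.vec e p x' y' z' ↔ x = x' ∧ y = y' ∧ z = z' := by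
  refine ⟨fun h => ⟨?_, ?_, ?_⟩, fun ⟨h1, h2, h3⟩ => by rw [h1, h2, h3]⟩
  · rw [← hB.val_vec_xi hp x y z, h, hB.val_vec_xi hp]
  · rw [← hB.val_vec_e hp x y z, h, hB.val_vec_e hp]
  · rw [← neg_inj, ← hB.val_vec_phi hp x y z, h, hB.val_vec_phi hp]

theorem vec_eq_zero (hp : p ∈ V) {x y z : ℝ} :
    S.vec e p x y z = 0 ↔ x = 0 ∧ y = 0 ∧ z = 0 := by
  rw [← hB.vec_inj hp]
  simp [vec]

theorem eta_e (hp : p ∈ V) : S.eta p (e p) = 0 := by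
  rw [← S.val_xi_left]; exact hB.xi_e p hp

theorem phi_phi_e (hp : p ∈ V) : S.phi p (S.phiF e p) = e p := by
  rw [phiF, S.phi_phi, hB.eta_e hp, zero_smul, sub_zero]

theorem phiF_phiF_e (hp : p ∈ V) : S.phiF (S.phiF e) p = e p := hB.phi_phi_e hp

theorem phi_vec (hp : p ∈ V) (x y z : ℝ) : S.phi p (S.vec e p x y z) = S.vec e p 0 z y := by
  simp only [vec, map_add, map_smul, S.phi_xi, hB.phi_phi_e hp]
  rw [show S.phi p (e p) = S.phiF e p from rfl]
  module

theorem eta_vec (hp : p ∈ V) (x y z : ℝ) : S.eta p (S.vec e p x y z) = x := by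
  rw [← S.val_xi_right, hB.val_vec_xi hp]

theorem smooth_comb {u v w : M → ℝ} (hu : SmoothFunOn (d := 3) V u)
    (hv : SmoothFunOn (d := 3) V v) (hw : SmoothFunOn (d := 3) V w) :
    SmoothFieldOn V (S.comb e u v w) :=
  ((hu.smul hB.smooth_xi).add (hv.smul hB.smooth)).add (hw.smul hB.smooth_phi)

theorem smooth_h (hX : SmoothFieldOn V X) : SmoothFieldOn V (S.h X) :=
  (SmoothFunOn.const (1 / 2)).smul ((hB.smooth_xi.bracket hB.isOpen (S.smooth_phiF hX)).sub
    (S.smooth_phiF (hB.smooth_xi.bracket hB.isOpen hX)))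

theorem smooth_a₁ : SmoothFunOn (d := 3) V (S.a₁ e) :=
  (hB.smooth_h hB.smooth).inner S.g hB.smooth

theorem smooth_a₂ : SmoothFunOn (d := 3) V (S.a₂ e) :=
  ((hB.smooth_h hB.smooth).inner S.g hB.smooth_phi).neg

theorem smooth_a₃ : SmoothFunOn (d := 3) V (S.a₃ e) :=
  (hB.frame.smooth_nabla hB.smooth_xi hB.smooth_phi).inner S.g hB.smooth

theorem smooth_coefB : SmoothFunOn (d := 3) V (S.coefB e) :=
  (hB.frame.smooth_nabla hB.smooth hB.smooth_phi).inner S.g hB.smooth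

theorem smooth_coefC : SmoothFunOn (d := 3) V (S.coefC e) :=
  (hB.frame.smooth_nabla hB.smooth_phi hB.smooth_phi).inner S.g hB.smooth

/-- Two fields with constant scalar product. -/
theorem val_nabla_add_val_nabla (hp : p ∈ V) (hX : SmoothFieldOn V X) (hY : SmoothFieldOn V Y)
    (hZ : SmoothFieldOn V Z) (r : ℝ) (hr : ∀ q ∈ V, S.g.inner Y Z q = r) :
    S.g.val p (S.g.nabla X Y p) (Z p) + S.g.val p (S.g.nabla X Z p) (Y p) = 0 := by
  have h := hB.frame.dirDeriv_inner hp hX hY hZ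
  rw [dirDeriv_congr hB.isOpen hp hr, dirDeriv_const, S.g.symm p (Y p)] at h
  exact h.symm

/-- The hypothesis `hS` speaks of globally smooth fields only. Both sides are tensorial, so local
fields may be exchanged for global ones with the same values at `p`. -/
theorem dEta_eq [T2Space M] (hS : S.IsParacontactMetric) (hp : p ∈ V) (hX : SmoothFieldOn V X)
    (hY : SmoothFieldOn V Y) : S.dEta X Y p = S.g.val p (X p) (S.phi p (Y p)) := by
  obtain ⟨X', hX', hXX'⟩ := exists_smoothField p (X p)
  obtain ⟨Y', hY', hYY'⟩ := exists_smoothField p (Y p)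
  have hV := hB.isOpen
  have hF := hB.frame
  rw [hF.tensorial_ext (S.dEta_tensorialOn_right hV hp (X := X)) hp hY (hY'.on V) hYY'.symm,
    hF.tensorial_ext (S.dEta_tensorialOn_left hV hp (Y := Y')) hp hX (hX'.on V) hXX'.symm,
    ← hS X' Y' hX' hY' p, PseudoRiemannianMetric.inner, phiF, hXX', hYY']

/-- The bracket of two fields on which `η` is constant. -/
theorem eta_bracket [T2Space M] (hS : S.IsParacontactMetric) (hp : p ∈ V)
    (hX : SmoothFieldOn V X) (hY : SmoothFieldOn V Y) (r t : ℝ) (hr : ∀ q ∈ V, S.etaF X q = r)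
    (ht : ∀ q ∈ V, S.etaF Y q = t) :
    S.eta p (bracket X Y p) = -2 * S.g.val p (X p) (S.phi p (Y p)) := by
  rw [← hB.dEta_eq hS hp hX hY, dEta, dirDeriv_congr hB.isOpen hp hr,
    dirDeriv_congr hB.isOpen hp ht, dirDeriv_const, dirDeriv_const, etaF]
  ring

end IsPhiBasis

end AlmostParacontactMetric

end Paracontact

namespace Paracontact

/-! ### The connection and the brackets in a φ-basis. -/

namespace AlmostParacontactMetric

variable {M : Type*} [TopologicalSpace M] [ChartedSpace (Model 3) M]
  [IsManifold (𝓡 3) ∞ M] {S : AlmostParacontactMetric 3 M} {V : Set M} {e X Y Z : VField 3 M}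
  {p : M}

namespace IsPhiBasis

variable (hB : S.IsPhiBasis V e)
include hB

theorem val_nabla_xi_xi (hp : p ∈ V) (hX : SmoothFieldOn V X) :
    S.g.val p (S.g.nabla X S.xi p) (S.xi p) = 0 := by
  have := hB.val_nabla_add_val_nabla hp hX hB.smooth_xi hB.smooth_xi 1 hB.xi_xi
  linarith

theorem val_nabla_e_e (hp : p ∈ V) (hX : SmoothFieldOn V X) :
    S.g.val p (S.g.nabla X e p) (e p) = 0 := by
  have := hB.val_nabla_add_val_nabla hp hX hB.smooth hB.smooth 1 hB.e_e
  linarith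

theorem val_nabla_phi_phi (hp : p ∈ V) (hX : SmoothFieldOn V X) :
    S.g.val p (S.g.nabla X (S.phiF e) p) (S.phiF e p) = 0 := by
  have := hB.val_nabla_add_val_nabla hp hX hB.smooth_phi hB.smooth_phi (-1) hB.phi_phi
  linarith

theorem val_nabla_xi_e (hp : p ∈ V) (hX : SmoothFieldOn V X) :
    S.g.val p (S.g.nabla X S.xi p) (e p) = -S.g.val p (S.g.nabla X e p) (S.xi p) := by
  have := hB.val_nabla_add_val_nabla hp hX hB.smooth_xi hB.smooth 0 hB.xi_e
  linarith

theorem val_nabla_xi_phi (hp : p ∈ V) (hX : SmoothFieldOn V X) :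
    S.g.val p (S.g.nabla X S.xi p) (S.phiF e p) =
      -S.g.val p (S.g.nabla X (S.phiF e) p) (S.xi p) := by
  have := hB.val_nabla_add_val_nabla hp hX hB.smooth_xi hB.smooth_phi 0 hB.xi_phi
  linarith

theorem val_nabla_e_phi (hp : p ∈ V) (hX : SmoothFieldOn V X) :
    S.g.val p (S.g.nabla X e p) (S.phiF e p) =
      -S.g.val p (S.g.nabla X (S.phiF e) p) (e p) := by
  have := hB.val_nabla_add_val_nabla hp hX hB.smooth hB.smooth_phi 0 hB.e_phi
  linarith

theorem etaF_e : ∀ q ∈ V, S.etaF e q = 0 := fun _ hq => hB.eta_e hq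

omit hB in
theorem _root_.Paracontact.AlmostParacontactMetric.etaF_xi (S : AlmostParacontactMetric 3 M)
    (V : Set M) : ∀ q ∈ V, S.etaF S.xi q = 1 := fun q _ => S.eta_xi q

omit hB in
theorem _root_.Paracontact.AlmostParacontactMetric.etaF_phi (S : AlmostParacontactMetric 3 M)
    (V : Set M) (X : VField 3 M) : ∀ q ∈ V, S.etaF (S.phiF X) q = 0 := fun q _ => S.eta_phi q _

variable [T2Space M] (hS : S.IsParacontactMetric)
include hS

theorem eta_bracket_xi (hp : p ∈ V) (hY : SmoothFieldOn V Y) (t : ℝ)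
    (ht : ∀ q ∈ V, S.etaF Y q = t) : S.eta p (bracket S.xi Y p) = 0 := by
  rw [hB.eta_bracket hS hp hB.smooth_xi hY 1 t (S.etaF_xi V) ht, S.val_xi_left, S.eta_phi,
    mul_zero]

theorem eta_bracket_e_phi (hp : p ∈ V) : S.eta p (bracket e (S.phiF e) p) = -2 := by
  rw [hB.eta_bracket hS hp hB.smooth hB.smooth_phi 0 0 hB.etaF_e (S.etaF_phi V e),
    hB.phi_phi_e hp, show S.g.val p (e p) (e p) = 1 from hB.e_e p hp, mul_one]

/-- The field `ξ` is geodesic. -/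
theorem nabla_xi_xi (hp : p ∈ V) : S.g.nabla S.xi S.xi p = S.vec e p 0 0 0 := by
  have hF := hB.frame
  have h0 := hB.val_nabla_xi_xi hp hB.smooth_xi
  -- As `η(Y)` is constant, `η([ξ, Y]) = 0`. So `g(∇_ξ Y, ξ) = g(∇_Y ξ, ξ) = 0`, and `∇_ξ ξ` is
  -- orthogonal to `Y` because `g(ξ, Y)` is constant.
  have key : ∀ Y, SmoothFieldOn V Y → ∀ t, (∀ q ∈ V, S.etaF Y q = t) →
      S.g.val p (S.g.nabla Y S.xi p) (S.xi p) = 0 →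
      S.g.val p (S.g.nabla S.xi S.xi p) (Y p) = 0 := fun Y hY t ht h1 => by
    have h2 := hB.eta_bracket_xi hS hp hY t ht
    rw [← hF.nabla_sub_nabla hp hB.smooth_xi hY, ← S.val_xi_right, map_sub, sub_apply, h1] at h2
    have h3 := hB.val_nabla_add_val_nabla hp hB.smooth_xi hB.smooth_xi hY t fun q hq => by
      rw [PseudoRiemannianMetric.inner, S.val_xi_left]; exact ht q hq
    linarith
  rw [hB.eq_vec hp (S.g.nabla S.xi S.xi p), h0,
    key e hB.smooth 0 hB.etaF_e (hB.val_nabla_xi_xi hp hB.smooth),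
    key _ hB.smooth_phi 0 (S.etaF_phi V e) (hB.val_nabla_xi_xi hp hB.smooth_phi), neg_zero]

/-- The field `ξ` is divergence free: a consequence of `d(dη) = 0`. -/
theorem val_nabla_e_add_val_nabla_phi (hp : p ∈ V) :
    S.g.val p (S.g.nabla e S.xi p) (e p) =
      S.g.val p (S.g.nabla (S.phiF e) S.xi p) (S.phiF e p) := by
  have hV := hB.isOpen
  have hF := hB.frame
  have hx := hB.smooth_xi
  have he := hB.smooth
  have hf := hB.smooth_phi
  -- The function `η([e, φe])` is the constant `-2`, so `η([ξ, [e, φe]]) = 0`. The Jacobi identity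
  -- expands this double bracket into two others, on which `η` is known through `dη`.
  have h1 := hB.eta_bracket_xi hS hp (he.bracket hV hf) (-2) fun q hq =>
    hB.eta_bracket_e_phi hS hq
  have h2 := hB.eta_bracket hS hp (hx.bracket hV he) hf 0 0
    (fun q hq => hB.eta_bracket_xi hS hq he 0 hB.etaF_e) (S.etaF_phi V e)
  have h3 := hB.eta_bracket hS hp he (hx.bracket hV hf) 0 0 hB.etaF_e
    (fun q hq => hB.eta_bracket_xi hS hq hf 0 (S.etaF_phi V e))
  rw [bracket_jacobi hV hp hx he hf, map_add, h2, h3, hB.phi_phi_e hp,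
    ← neg_neg (S.g.val p (e p) _), ← S.val_phi_left, S.g.symm p (S.phi p (e p)),
    ← hF.nabla_sub_nabla hp hx he, ← hF.nabla_sub_nabla hp hx hf, map_sub, map_sub, sub_apply,
    sub_apply, hB.val_nabla_e_e hp hx] at h1
  have h4 := hB.val_nabla_phi_phi hp hx
  simp only [phiF] at h1 h4 ⊢
  rw [h4] at h1
  linarith

/-- Four linear equations determine the four components: `ξ` is divergence free, `η([e, φe]) = -2`,
and `a₁`, `a₂` are expressed by `h = L_ξ φ / 2` with torsion-free brackets. The terms with `∇_ξ`
cancel. The result is `∇ξ = -φ + φh` on `ker η`. -/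
theorem nabla_xi_aux (hp : p ∈ V) :
    S.g.val p (S.g.nabla e S.xi p) (e p) = S.a₂ e p ∧
    S.g.val p (S.g.nabla e S.xi p) (S.phiF e p) = 1 - S.a₁ e p ∧
    S.g.val p (S.g.nabla (S.phiF e) S.xi p) (e p) = -(1 + S.a₁ e p) ∧
    S.g.val p (S.g.nabla (S.phiF e) S.xi p) (S.phiF e p) = S.a₂ e p := by
  have hV := hB.isOpen
  have hF := hB.frame
  have hx := hB.smooth_xi
  have he := hB.smooth
  have hf := hB.smooth_phi
  have hsum := hB.val_nabla_e_add_val_nabla_phi hS hp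
  have hc := hB.eta_bracket_e_phi hS hp
  rw [← hF.nabla_sub_nabla hp he hf, ← S.val_xi_right, map_sub, sub_apply] at hc
  have h1 := hB.val_nabla_xi_phi hp he
  have h2 := hB.val_nabla_xi_e hp hf
  have h3 := hB.val_nabla_e_phi hp hx
  have h4 := hB.val_nabla_e_e hp hx
  have h5 := hB.val_nabla_phi_phi hp hx
  have hh : S.h e p = (1 / 2 : ℝ) • ((S.g.nabla S.xi (S.phiF e) p - S.g.nabla (S.phiF e) S.xi p)
      - S.phi p (S.g.nabla S.xi e p - S.g.nabla e S.xi p)) := by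
    rw [hF.nabla_sub_nabla hp hx he, hF.nabla_sub_nabla hp hx hf, h]
  have ha1 : S.a₁ e p = 1 / 2 * (S.g.val p (S.g.nabla S.xi (S.phiF e) p) (e p) -
      S.g.val p (S.g.nabla (S.phiF e) S.xi p) (e p) +
      (S.g.val p (S.g.nabla S.xi e p) (S.phiF e p) -
        S.g.val p (S.g.nabla e S.xi p) (S.phiF e p))) := by
    rw [a₁, PseudoRiemannianMetric.inner, hh]
    simp only [map_smul, smul_apply, map_sub, sub_apply, S.val_phi_left, smul_eq_mul, phiF]
    ring
  have ha2 : S.a₂ e p = -(1 / 2 * (S.g.val p (S.g.nabla S.xi (S.phiF e) p) (S.phiF e p) -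
      S.g.val p (S.g.nabla (S.phiF e) S.xi p) (S.phiF e p) +
      (S.g.val p (S.g.nabla S.xi e p) (e p) - S.g.val p (S.g.nabla e S.xi p) (e p)))) := by
    rw [a₂, PseudoRiemannianMetric.inner, hh]
    simp only [map_smul, smul_apply, map_sub, sub_apply, S.val_phi_left, smul_eq_mul,
      hB.phi_phi_e hp]
    ring
  refine ⟨?_, ?_, ?_, ?_⟩ <;> linarith

theorem nabla_e_xi (hp : p ∈ V) :
    S.g.nabla e S.xi p = S.vec e p 0 (S.a₂ e p) (S.a₁ e p - 1) := by
  obtain ⟨h1, h2, -, -⟩ := hB.nabla_xi_aux hS hp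
  rw [hB.eq_vec hp (S.g.nabla e S.xi p), hB.val_nabla_xi_xi hp hB.smooth, h1, h2, neg_sub]

theorem nabla_phi_xi (hp : p ∈ V) :
    S.g.nabla (S.phiF e) S.xi p = S.vec e p 0 (-(1 + S.a₁ e p)) (-S.a₂ e p) := by
  obtain ⟨-, -, h1, h2⟩ := hB.nabla_xi_aux hS hp
  rw [hB.eq_vec hp (S.g.nabla _ S.xi p), hB.val_nabla_xi_xi hp hB.smooth_phi, h1, h2]

theorem nabla_xi_e (hp : p ∈ V) : S.g.nabla S.xi e p = S.vec e p 0 0 (S.a₃ e p) := by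
  have h1 := hB.val_nabla_xi_e hp hB.smooth_xi
  rw [hB.nabla_xi_xi hS hp, hB.val_vec_e hp] at h1
  rw [hB.eq_vec hp (S.g.nabla S.xi e p), hB.val_nabla_e_e hp hB.smooth_xi,
    hB.val_nabla_e_phi hp hB.smooth_xi, neg_neg, ← neg_eq_iff_eq_neg.2 h1, neg_zero]
  rfl

theorem nabla_xi_phi (hp : p ∈ V) :
    S.g.nabla S.xi (S.phiF e) p = S.vec e p 0 (S.a₃ e p) 0 := by
  have h1 := hB.val_nabla_xi_phi hp hB.smooth_xi
  rw [hB.nabla_xi_xi hS hp, hB.val_vec_phi hp] at h1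
  rw [hB.eq_vec hp (S.g.nabla S.xi _ p), hB.val_nabla_phi_phi hp hB.smooth_xi,
    ← neg_eq_iff_eq_neg.2 h1, neg_zero, neg_zero]
  rfl

theorem nabla_e_e (hp : p ∈ V) :
    S.g.nabla e e p = S.vec e p (-S.a₂ e p) 0 (S.coefB e p) := by
  have h1 := hB.val_nabla_xi_e hp hB.smooth
  rw [hB.nabla_e_xi hS hp, hB.val_vec_e hp] at h1
  rw [hB.eq_vec hp (S.g.nabla e e p), hB.val_nabla_e_e hp hB.smooth,
    hB.val_nabla_e_phi hp hB.smooth, neg_neg, ← neg_eq_iff_eq_neg.2 h1]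
  rfl

theorem nabla_e_phi (hp : p ∈ V) :
    S.g.nabla e (S.phiF e) p = S.vec e p (S.a₁ e p - 1) (S.coefB e p) 0 := by
  have h1 := hB.val_nabla_xi_phi hp hB.smooth
  rw [hB.nabla_e_xi hS hp, hB.val_vec_phi hp, neg_inj] at h1
  rw [hB.eq_vec hp (S.g.nabla e _ p), hB.val_nabla_phi_phi hp hB.smooth, ← h1, neg_zero]
  rfl

theorem nabla_phi_e (hp : p ∈ V) :
    S.g.nabla (S.phiF e) e p = S.vec e p (1 + S.a₁ e p) 0 (S.coefC e p) := by
  have h1 := hB.val_nabla_xi_e hp hB.smooth_phi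
  rw [hB.nabla_phi_xi hS hp, hB.val_vec_e hp, neg_inj] at h1
  rw [hB.eq_vec hp (S.g.nabla _ e p), hB.val_nabla_e_e hp hB.smooth_phi,
    hB.val_nabla_e_phi hp hB.smooth_phi, neg_neg, ← h1]
  rfl

theorem nabla_phi_phi (hp : p ∈ V) :
    S.g.nabla (S.phiF e) (S.phiF e) p = S.vec e p (-S.a₂ e p) (S.coefC e p) 0 := by
  have h1 := hB.val_nabla_xi_phi hp hB.smooth_phi
  rw [hB.nabla_phi_xi hS hp, hB.val_vec_phi hp, neg_inj] at h1
  rw [hB.eq_vec hp (S.g.nabla _ (S.phiF e) p), hB.val_nabla_phi_phi hp hB.smooth_phi, ← h1,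
    neg_zero]
  rfl

theorem bracket_xi_e (hp : p ∈ V) :
    bracket S.xi e p = S.vec e p 0 (-S.a₂ e p) (S.a₃ e p - S.a₁ e p + 1) := by
  rw [← hB.frame.nabla_sub_nabla hp hB.smooth_xi hB.smooth, hB.nabla_xi_e hS hp,
    hB.nabla_e_xi hS hp, vec_sub, hB.vec_inj hp]
  refine ⟨?_, ?_, ?_⟩ <;> ring

theorem bracket_xi_phi (hp : p ∈ V) :
    bracket S.xi (S.phiF e) p = S.vec e p 0 (S.a₃ e p + S.a₁ e p + 1) (S.a₂ e p) := by
  rw [← hB.frame.nabla_sub_nabla hp hB.smooth_xi hB.smooth_phi, hB.nabla_xi_phi hS hp,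
    hB.nabla_phi_xi hS hp, vec_sub, hB.vec_inj hp]
  refine ⟨?_, ?_, ?_⟩ <;> ring

theorem bracket_e_phi (hp : p ∈ V) :
    bracket e (S.phiF e) p = S.vec e p (-2) (S.coefB e p) (-S.coefC e p) := by
  rw [← hB.frame.nabla_sub_nabla hp hB.smooth hB.smooth_phi, hB.nabla_e_phi hS hp,
    hB.nabla_phi_e hS hp, vec_sub, hB.vec_inj hp]
  refine ⟨?_, ?_, ?_⟩ <;> ring

theorem h_e (hp : p ∈ V) : S.h e p = S.vec e p 0 (S.a₁ e p) (S.a₂ e p) := by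
  rw [h, hB.bracket_xi_e hS hp, hB.bracket_xi_phi hS hp, hB.phi_vec hp, vec_sub, vec_smul,
    hB.vec_inj hp]
  refine ⟨?_, ?_, ?_⟩ <;> ring

theorem h_phi (hp : p ∈ V) : S.h (S.phiF e) p = S.vec e p 0 (-S.a₂ e p) (-S.a₁ e p) := by
  rw [h, bracket_congr (X' := S.xi) (Y' := e) hB.isOpen hp (fun _ _ => rfl)
    (fun q hq => hB.phiF_phiF_e hq), hB.bracket_xi_e hS hp, hB.bracket_xi_phi hS hp, hB.phi_vec hp,
    vec_sub, vec_smul, hB.vec_inj hp]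
  refine ⟨?_, ?_, ?_⟩ <;> ring

omit hB hS in
theorem _root_.Paracontact.AlmostParacontactMetric.h_xi (S : AlmostParacontactMetric 3 M) (p : M) :
    S.h S.xi p = 0 := by
  have h1 : S.phiF S.xi = 0 := funext fun q => S.phi_xi q
  rw [h, h1, bracket_self, map_zero, sub_zero,
    show bracket S.xi 0 p = 0 by simp [bracket], smul_zero]

theorem h_eq (hp : p ∈ V) (hX : SmoothFieldOn V X) {x y z : ℝ} (hXp : X p = S.vec e p x y z) :
    S.h X p = S.vec e p 0 (y * S.a₁ e p - z * S.a₂ e p) (y * S.a₂ e p - z * S.a₁ e p) := by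
  rw [hB.frame.tensorial_eq_sum (S.h_tensorialOn hB.isOpen hp) hp hX, Fin.sum_univ_three]
  simp only [Matrix.cons_val_zero, Matrix.cons_val_one, Matrix.cons_val, hXp, hB.val_vec_xi hp,
    hB.val_vec_e hp, hB.val_vec_phi hp, S.h_xi, hB.h_e hS hp, hB.h_phi hS hp, vec_smul, smul_zero,
    zero_add, vec_add]
  rw [hB.vec_inj hp]
  refine ⟨?_, ?_, ?_⟩ <;> ring

/-! #### The connection in terms of components -/

variable {u v w : M → ℝ} (hu : SmoothFunOn (d := 3) V u)
    (hv : SmoothFunOn (d := 3) V v) (hw : SmoothFunOn (d := 3) V w)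

omit hS in
include hu hv hw in
theorem nabla_comb (hp : p ∈ V) (hX : SmoothFieldOn V X) :
    S.g.nabla X (S.comb e u v w) p =
      S.vec e p (dirDeriv X u p) (dirDeriv X v p) (dirDeriv X w p) + u p • S.g.nabla X S.xi p
        + v p • S.g.nabla X e p + w p • S.g.nabla X (S.phiF e) p := by
  have hF := hB.frame
  have h1 := hu.smul hB.smooth_xi
  have h2 := hv.smul hB.smooth
  have h3 := hw.smul hB.smooth_phi
  rw [show S.comb e u v w = u • S.xi + v • e + w • S.phiF e from rfl,
    hF.nabla_add_right hp hX (h1.add h2) h3, hF.nabla_add_right hp hX h1 h2,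
    hF.nabla_smul_right hp hu hX hB.smooth_xi, hF.nabla_smul_right hp hv hX hB.smooth,
    hF.nabla_smul_right hp hw hX hB.smooth_phi, vec]
  abel

include hu hv hw in
theorem nabla_xi_comb (hp : p ∈ V) : S.g.nabla S.xi (S.comb e u v w) p =
    S.vec e p (dirDeriv S.xi u p) (dirDeriv S.xi v p + S.a₃ e p * w p)
      (dirDeriv S.xi w p + S.a₃ e p * v p) := by
  rw [hB.nabla_comb hu hv hw hp hB.smooth_xi, hB.nabla_xi_xi hS hp, hB.nabla_xi_e hS hp,
    hB.nabla_xi_phi hS hp]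
  simp only [vec_smul, vec_add]
  rw [hB.vec_inj hp]
  refine ⟨?_, ?_, ?_⟩ <;> ring

include hu hv hw in
theorem nabla_e_comb (hp : p ∈ V) : S.g.nabla e (S.comb e u v w) p =
    S.vec e p (dirDeriv e u p - S.a₂ e p * v p + (S.a₁ e p - 1) * w p)
      (dirDeriv e v p + S.a₂ e p * u p + S.coefB e p * w p)
      (dirDeriv e w p + (S.a₁ e p - 1) * u p + S.coefB e p * v p) := by
  rw [hB.nabla_comb hu hv hw hp hB.smooth, hB.nabla_e_xi hS hp, hB.nabla_e_e hS hp,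
    hB.nabla_e_phi hS hp]
  simp only [vec_smul, vec_add]
  rw [hB.vec_inj hp]
  refine ⟨?_, ?_, ?_⟩ <;> ring

include hu hv hw in
theorem nabla_phi_comb (hp : p ∈ V) : S.g.nabla (S.phiF e) (S.comb e u v w) p =
    S.vec e p (dirDeriv (S.phiF e) u p + (1 + S.a₁ e p) * v p - S.a₂ e p * w p)
      (dirDeriv (S.phiF e) v p - (1 + S.a₁ e p) * u p + S.coefC e p * w p)
      (dirDeriv (S.phiF e) w p - S.a₂ e p * u p + S.coefC e p * v p) := by
  rw [hB.nabla_comb hu hv hw hp hB.smooth_phi, hB.nabla_phi_xi hS hp, hB.nabla_phi_e hS hp,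
    hB.nabla_phi_phi hS hp]
  simp only [vec_smul, vec_add]
  rw [hB.vec_inj hp]
  refine ⟨?_, ?_, ?_⟩ <;> ring

omit hS in
include hu hv hw in
theorem nabla_comb_left (hp : p ∈ V) (hX : SmoothFieldOn V X) :
    S.g.nabla (S.comb e u v w) X p = u p • S.g.nabla S.xi X p + v p • S.g.nabla e X p
      + w p • S.g.nabla (S.phiF e) X p := by
  have hF := hB.frame
  have h1 := hu.smul hB.smooth_xi
  have h2 := hv.smul hB.smooth
  have h3 := hw.smul hB.smooth_phi
  rw [show S.comb e u v w = u • S.xi + v • e + w • S.phiF e from rfl,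
    hF.nabla_add_left hp (h1.add h2) h3 hX, hF.nabla_add_left hp h1 h2 hX,
    hF.nabla_smul_left hp hu hB.smooth_xi hX, hF.nabla_smul_left hp hv hB.smooth hX,
    hF.nabla_smul_left hp hw hB.smooth_phi hX]

include hu hv hw in
theorem nabla_comb_xi (hp : p ∈ V) : S.g.nabla (S.comb e u v w) S.xi p =
    S.vec e p 0 (S.a₂ e p * v p - (1 + S.a₁ e p) * w p)
      ((S.a₁ e p - 1) * v p - S.a₂ e p * w p) := by
  rw [hB.nabla_comb_left hu hv hw hp hB.smooth_xi, hB.nabla_xi_xi hS hp, hB.nabla_e_xi hS hp,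
    hB.nabla_phi_xi hS hp]
  simp only [vec_smul, vec_add]
  rw [hB.vec_inj hp]
  refine ⟨?_, ?_, ?_⟩ <;> ring

include hu hv hw in
theorem nabla_comb_e (hp : p ∈ V) : S.g.nabla (S.comb e u v w) e p =
    S.vec e p (-S.a₂ e p * v p + (1 + S.a₁ e p) * w p) 0
      (S.a₃ e p * u p + S.coefB e p * v p + S.coefC e p * w p) := by
  rw [hB.nabla_comb_left hu hv hw hp hB.smooth, hB.nabla_xi_e hS hp, hB.nabla_e_e hS hp,
    hB.nabla_phi_e hS hp]
  simp only [vec_smul, vec_add]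
  rw [hB.vec_inj hp]
  refine ⟨?_, ?_, ?_⟩ <;> ring

include hu hv hw in
theorem nabla_comb_phi (hp : p ∈ V) : S.g.nabla (S.comb e u v w) (S.phiF e) p =
    S.vec e p ((S.a₁ e p - 1) * v p - S.a₂ e p * w p)
      (S.a₃ e p * u p + S.coefB e p * v p + S.coefC e p * w p) 0 := by
  rw [hB.nabla_comb_left hu hv hw hp hB.smooth_phi, hB.nabla_xi_phi hS hp, hB.nabla_e_phi hS hp,
    hB.nabla_phi_phi hS hp]
  simp only [vec_smul, vec_add]
  rw [hB.vec_inj hp]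
  refine ⟨?_, ?_, ?_⟩ <;> ring

include hu hv hw in
theorem bracket_xi_comb (hp : p ∈ V) : bracket S.xi (S.comb e u v w) p =
    S.vec e p (dirDeriv S.xi u p)
      (dirDeriv S.xi v p - S.a₂ e p * v p + (S.a₃ e p + S.a₁ e p + 1) * w p)
      (dirDeriv S.xi w p + (S.a₃ e p - S.a₁ e p + 1) * v p + S.a₂ e p * w p) := by
  rw [← hB.frame.nabla_sub_nabla hp hB.smooth_xi (hB.smooth_comb hu hv hw),
    hB.nabla_xi_comb hS hu hv hw hp, hB.nabla_comb_xi hS hu hv hw hp, vec_sub, hB.vec_inj hp]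
  refine ⟨?_, ?_, ?_⟩ <;> ring

end IsPhiBasis

end AlmostParacontactMetric

end Paracontact

namespace Paracontact

/-! ### Curvature, Ricci tensor, `L_ξ g` and the trace of `L_ξ ∇` in components. -/

namespace AlmostParacontactMetric

variable {M : Type*} [TopologicalSpace M] [ChartedSpace (Model 3) M]
  [IsManifold (𝓡 3) ∞ M] {S : AlmostParacontactMetric 3 M} {V : Set M} {e X Y Z : VField 3 M}
  {p : M}

variable (S) in
/-- The `e`-component of `(∇_ξ h) e`. -/
noncomputable def nablaXiH₁ (e : VField 3 M) (p : M) : ℝ :=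
  dirDeriv S.xi (S.a₁ e) p + 2 * S.a₂ e p * S.a₃ e p

variable (S) in
/-- The `φe`-component of `(∇_ξ h) e`. -/
noncomputable def nablaXiH₂ (e : VField 3 M) (p : M) : ℝ :=
  dirDeriv S.xi (S.a₂ e) p + 2 * S.a₁ e p * S.a₃ e p

variable (S) in
/-- The value of `ϱ(ξ, ·)` on `e`, a component of the divergence of `φ h`. -/
noncomputable def divH₁ (e : VField 3 M) (p : M) : ℝ :=
  dirDeriv e (S.a₂ e) p + dirDeriv (S.phiF e) (S.a₁ e) p + 2 * S.a₁ e p * S.coefB e p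
    + 2 * S.a₂ e p * S.coefC e p

variable (S) in
/-- The value of `-ϱ(ξ, ·)` on `φe`, a component of the divergence of `φ h`. -/
noncomputable def divH₂ (e : VField 3 M) (p : M) : ℝ :=
  dirDeriv e (S.a₁ e) p + dirDeriv (S.phiF e) (S.a₂ e) p + 2 * S.a₂ e p * S.coefB e p
    + 2 * S.a₁ e p * S.coefC e p

variable (S) in
/-- Half of the trace of `h²`. -/
noncomputable def sqH (e : VField 3 M) (p : M) : ℝ := S.a₁ e p ^ 2 - S.a₂ e p ^ 2

variable (S) in
/-- The curvature coefficient of the plane of `e` and `φe`. -/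
noncomputable def coefK (e : VField 3 M) (p : M) : ℝ :=
  dirDeriv (S.phiF e) (S.coefB e) p - dirDeriv e (S.coefC e) p + S.coefB e p ^ 2
    - S.coefC e p ^ 2 - S.sqH e p + 1 - 2 * S.a₃ e p

namespace IsPhiBasis

variable (hB : S.IsPhiBasis V e)
include hB

section Congr

variable {u v w : M → ℝ} (hu : SmoothFunOn (d := 3) V u)
    (hv : SmoothFunOn (d := 3) V v) (hw : SmoothFunOn (d := 3) V w)
include hu hv hw

theorem nabla_congr_right (hp : p ∈ V) (hX : SmoothFieldOn V X)
    (hY : ∀ q ∈ V, Y q = S.vec e q (u q) (v q) (w q)) :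
    S.g.nabla X Y p = S.g.nabla X (S.comb e u v w) p :=
  hB.frame.nabla_congr hp hX (hB.smooth_comb hu hv hw) (fun _ _ => rfl) hY

theorem nabla_congr_left (hp : p ∈ V) (hY : SmoothFieldOn V Y)
    (hX : ∀ q ∈ V, X q = S.vec e q (u q) (v q) (w q)) :
    S.g.nabla X Y p = S.g.nabla (S.comb e u v w) Y p :=
  hB.frame.nabla_congr hp (hB.smooth_comb hu hv hw) hY hX (fun _ _ => rfl)

end Congr

theorem smooth_sub_one : SmoothFunOn (d := 3) V (fun q => S.a₁ e q - 1) :=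
  hB.smooth_a₁.sub (SmoothFunOn.const 1)

theorem smooth_one_add : SmoothFunOn (d := 3) V (fun q => 1 + S.a₁ e q) :=
  (SmoothFunOn.const 1).add hB.smooth_a₁

theorem smooth_bracket_coef₁ : SmoothFunOn (d := 3) V (fun q => S.a₃ e q - S.a₁ e q + 1) :=
  (hB.smooth_a₃.sub hB.smooth_a₁).add (SmoothFunOn.const 1)

theorem smooth_bracket_coef₂ : SmoothFunOn (d := 3) V (fun q => S.a₃ e q + S.a₁ e q + 1) :=
  (hB.smooth_a₃.add hB.smooth_a₁).add (SmoothFunOn.const 1)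

theorem dirDeriv_sub_one (hp : p ∈ V) :
    dirDeriv X (fun q => S.a₁ e q - 1) p = dirDeriv X (S.a₁ e) p := by
  rw [dirDeriv_sub hB.isOpen hp hB.smooth_a₁ (SmoothFunOn.const 1), dirDeriv_const, sub_zero]

theorem dirDeriv_one_add (hp : p ∈ V) :
    dirDeriv X (fun q => 1 + S.a₁ e q) p = dirDeriv X (S.a₁ e) p := by
  rw [dirDeriv_add hB.isOpen hp (SmoothFunOn.const 1) hB.smooth_a₁, dirDeriv_const, zero_add]

theorem dirDeriv_bracket_coef₁ (hp : p ∈ V) :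
    dirDeriv X (fun q => S.a₃ e q - S.a₁ e q + 1) p =
      dirDeriv X (S.a₃ e) p - dirDeriv X (S.a₁ e) p := by
  rw [dirDeriv_add hB.isOpen hp (hB.smooth_a₃.sub hB.smooth_a₁) (SmoothFunOn.const 1),
    dirDeriv_const, add_zero, dirDeriv_sub hB.isOpen hp hB.smooth_a₃ hB.smooth_a₁]

theorem dirDeriv_bracket_coef₂ (hp : p ∈ V) :
    dirDeriv X (fun q => S.a₃ e q + S.a₁ e q + 1) p =
      dirDeriv X (S.a₃ e) p + dirDeriv X (S.a₁ e) p := by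
  rw [dirDeriv_add hB.isOpen hp (hB.smooth_a₃.add hB.smooth_a₁) (SmoothFunOn.const 1),
    dirDeriv_const, add_zero, dirDeriv_add hB.isOpen hp hB.smooth_a₃ hB.smooth_a₁]

variable [T2Space M] (hS : S.IsParacontactMetric)
include hS

/-- The Jacobi identity for `ξ`, `e`, `φe`. -/
theorem jacobi (hp : p ∈ V) :
    dirDeriv S.xi (S.coefB e) p = dirDeriv e (S.a₃ e) p + dirDeriv e (S.a₁ e) p
      + dirDeriv (S.phiF e) (S.a₂ e) p + S.coefB e p * S.a₂ e p
      + S.coefC e p * (S.a₃ e p + S.a₁ e p + 1) ∧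
    dirDeriv S.xi (S.coefC e) p = dirDeriv (S.phiF e) (S.a₃ e) p
      - dirDeriv (S.phiF e) (S.a₁ e) p - dirDeriv e (S.a₂ e) p
      + S.coefB e p * (S.a₃ e p - S.a₁ e p + 1) - S.coefC e p * S.a₂ e p := by
  have hV := hB.isOpen
  have hF := hB.frame
  have hx := hB.smooth_xi
  have he := hB.smooth
  have hf := hB.smooth_phi
  have hb := hB.smooth_coefB
  have hc := hB.smooth_coefC.neg
  have h2 := SmoothFunOn.const (d := 3) (V := V) (-2)
  have h0 := SmoothFunOn.const (d := 3) (V := V) 0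
  have hna := hB.smooth_a₂.neg
  have hy := hB.smooth_bracket_coef₁
  have hz := hB.smooth_bracket_coef₂
  -- The double brackets on the right are rewritten as differences of covariant derivatives, for
  -- which component formulas exist. The components along `e` and `φe` are the two claims.
  have hJ := bracket_jacobi hV hp hx he hf
  rw [bracket_congr (X' := S.xi)
      (Y' := S.comb e (fun _ => -2) (S.coefB e) (fun q => -S.coefC e q)) hV hp (fun _ _ => rfl)
      (fun q hq => hB.bracket_e_phi hS hq),
    hB.bracket_xi_comb hS h2 hb hc hp,
    ← hF.nabla_sub_nabla hp (hx.bracket hV he) hf, ← hF.nabla_sub_nabla hp he (hx.bracket hV hf),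
    hB.nabla_congr_left h0 hna hy hp hf (fun q hq => hB.bracket_xi_e hS hq),
    hB.nabla_congr_right h0 hna hy hp hf (fun q hq => hB.bracket_xi_e hS hq),
    hB.nabla_congr_left h0 hz hB.smooth_a₂ hp he (fun q hq => hB.bracket_xi_phi hS hq),
    hB.nabla_congr_right h0 hz hB.smooth_a₂ hp he (fun q hq => hB.bracket_xi_phi hS hq),
    hB.nabla_comb_phi hS h0 hna hy hp, hB.nabla_phi_comb hS h0 hna hy hp,
    hB.nabla_e_comb hS h0 hz hB.smooth_a₂ hp, hB.nabla_comb_e hS h0 hz hB.smooth_a₂ hp] at hJ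
  simp only [vec_add, vec_sub, dirDeriv_const, dirDeriv_neg, hB.dirDeriv_bracket_coef₁ hp,
    hB.dirDeriv_bracket_coef₂ hp] at hJ
  rw [hB.vec_inj hp] at hJ
  obtain ⟨-, h3, h4⟩ := hJ
  constructor <;> linarith

section Curvature

variable (hp : p ∈ V)
include hp

theorem curvature_xi_e_xi : S.g.curvature S.xi e S.xi p =
    S.vec e p 0 (-S.nablaXiH₂ e p + S.sqH e p - 1) (-S.nablaXiH₁ e p) := by
  have h0 := SmoothFunOn.const (d := 3) (V := V) 0
  have hna := hB.smooth_a₂.neg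
  rw [PseudoRiemannianMetric.curvature,
    hB.nabla_congr_left h0 hna hB.smooth_bracket_coef₁ hp hB.smooth_xi
      (fun q hq => hB.bracket_xi_e hS hq), hB.nabla_comb_xi hS h0 hna hB.smooth_bracket_coef₁ hp,
    hB.nabla_congr_right h0 hB.smooth_a₂ hB.smooth_sub_one hp hB.smooth_xi
      (fun q hq => hB.nabla_e_xi hS hq), hB.nabla_xi_comb hS h0 hB.smooth_a₂ hB.smooth_sub_one hp,
    hB.nabla_congr_right h0 h0 h0 hp hB.smooth (fun q hq => hB.nabla_xi_xi hS hq),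
    hB.nabla_e_comb hS h0 h0 h0 hp]
  simp only [vec_sub, dirDeriv_const, hB.dirDeriv_sub_one hp]
  rw [hB.vec_inj hp, nablaXiH₁, nablaXiH₂, sqH]
  refine ⟨?_, ?_, ?_⟩ <;> ring

theorem curvature_xi_phi_xi : S.g.curvature S.xi (S.phiF e) S.xi p =
    S.vec e p 0 (S.nablaXiH₁ e p) (S.nablaXiH₂ e p + S.sqH e p - 1) := by
  have h0 := SmoothFunOn.const (d := 3) (V := V) 0
  have hna := hB.smooth_a₂.neg
  rw [PseudoRiemannianMetric.curvature,
    hB.nabla_congr_left h0 hB.smooth_bracket_coef₂ hB.smooth_a₂ hp hB.smooth_xi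
      (fun q hq => hB.bracket_xi_phi hS hq),
    hB.nabla_comb_xi hS h0 hB.smooth_bracket_coef₂ hB.smooth_a₂ hp,
    hB.nabla_congr_right h0 hB.smooth_one_add.neg hna hp hB.smooth_xi
      (fun q hq => hB.nabla_phi_xi hS hq), hB.nabla_xi_comb hS h0 hB.smooth_one_add.neg hna hp,
    hB.nabla_congr_right h0 h0 h0 hp hB.smooth_phi (fun q hq => hB.nabla_xi_xi hS hq),
    hB.nabla_phi_comb hS h0 h0 h0 hp]
  simp only [vec_sub, dirDeriv_const, dirDeriv_neg, hB.dirDeriv_one_add hp]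
  rw [hB.vec_inj hp, nablaXiH₁, nablaXiH₂, sqH]
  refine ⟨?_, ?_, ?_⟩ <;> ring

theorem curvature_e_phi_xi : S.g.curvature e (S.phiF e) S.xi p =
    S.vec e p 0 (S.divH₂ e p) (S.divH₁ e p) := by
  have h0 := SmoothFunOn.const (d := 3) (V := V) 0
  have h2 := SmoothFunOn.const (d := 3) (V := V) (-2)
  have hna := hB.smooth_a₂.neg
  have hb := hB.smooth_coefB
  have hc := hB.smooth_coefC.neg
  rw [PseudoRiemannianMetric.curvature,
    hB.nabla_congr_left h2 hb hc hp hB.smooth_xi (fun q hq => hB.bracket_e_phi hS hq),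
    hB.nabla_comb_xi hS h2 hb hc hp,
    hB.nabla_congr_right h0 hB.smooth_one_add.neg hna hp hB.smooth
      (fun q hq => hB.nabla_phi_xi hS hq), hB.nabla_e_comb hS h0 hB.smooth_one_add.neg hna hp,
    hB.nabla_congr_right h0 hB.smooth_a₂ hB.smooth_sub_one hp hB.smooth_phi
      (fun q hq => hB.nabla_e_xi hS hq), hB.nabla_phi_comb hS h0 hB.smooth_a₂ hB.smooth_sub_one hp]
  simp only [vec_sub, dirDeriv_const, dirDeriv_neg, hB.dirDeriv_one_add hp, hB.dirDeriv_sub_one hp]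
  rw [hB.vec_inj hp, divH₁, divH₂]
  refine ⟨?_, ?_, ?_⟩ <;> ring

/-- The term `∇_ξ ∇_e e` brings in `ξ(b)`. The Jacobi identity trades it for derivatives of `a₁`,
`a₂`, `a₃`, and those of `a₃` cancel. The other values `R(ξ, ·)` on `e` and `φe` work in the same
way. -/
theorem curvature_xi_e_e : S.g.curvature S.xi e e p =
    S.vec e p (S.nablaXiH₂ e p - S.sqH e p + 1) 0 (-S.divH₂ e p) := by
  have h0 := SmoothFunOn.const (d := 3) (V := V) 0
  have hna := hB.smooth_a₂.neg
  rw [PseudoRiemannianMetric.curvature,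
    hB.nabla_congr_left h0 hna hB.smooth_bracket_coef₁ hp hB.smooth
      (fun q hq => hB.bracket_xi_e hS hq), hB.nabla_comb_e hS h0 hna hB.smooth_bracket_coef₁ hp,
    hB.nabla_congr_right hna h0 hB.smooth_coefB hp hB.smooth_xi
      (fun q hq => hB.nabla_e_e hS hq), hB.nabla_xi_comb hS hna h0 hB.smooth_coefB hp,
    hB.nabla_congr_right h0 h0 hB.smooth_a₃ hp hB.smooth (fun q hq => hB.nabla_xi_e hS hq),
    hB.nabla_e_comb hS h0 h0 hB.smooth_a₃ hp, (hB.jacobi hS hp).1]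
  simp only [vec_sub, dirDeriv_const, dirDeriv_neg]
  rw [hB.vec_inj hp, divH₂, nablaXiH₂, sqH]
  refine ⟨?_, ?_, ?_⟩ <;> ring

theorem curvature_xi_e_phi : S.g.curvature S.xi e (S.phiF e) p =
    S.vec e p (-S.nablaXiH₁ e p) (-S.divH₂ e p) 0 := by
  have h0 := SmoothFunOn.const (d := 3) (V := V) 0
  have hna := hB.smooth_a₂.neg
  rw [PseudoRiemannianMetric.curvature,
    hB.nabla_congr_left h0 hna hB.smooth_bracket_coef₁ hp hB.smooth_phi
      (fun q hq => hB.bracket_xi_e hS hq), hB.nabla_comb_phi hS h0 hna hB.smooth_bracket_coef₁ hp,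
    hB.nabla_congr_right hB.smooth_sub_one hB.smooth_coefB h0 hp hB.smooth_xi
      (fun q hq => hB.nabla_e_phi hS hq),
    hB.nabla_xi_comb hS hB.smooth_sub_one hB.smooth_coefB h0 hp,
    hB.nabla_congr_right h0 hB.smooth_a₃ h0 hp hB.smooth (fun q hq => hB.nabla_xi_phi hS hq),
    hB.nabla_e_comb hS h0 hB.smooth_a₃ h0 hp, (hB.jacobi hS hp).1]
  simp only [vec_sub, dirDeriv_const, hB.dirDeriv_sub_one hp]
  rw [hB.vec_inj hp, divH₂, nablaXiH₁]
  refine ⟨?_, ?_, ?_⟩ <;> ring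

theorem curvature_xi_phi_e : S.g.curvature S.xi (S.phiF e) e p =
    S.vec e p (-S.nablaXiH₁ e p) 0 (S.divH₁ e p) := by
  have h0 := SmoothFunOn.const (d := 3) (V := V) 0
  rw [PseudoRiemannianMetric.curvature,
    hB.nabla_congr_left h0 hB.smooth_bracket_coef₂ hB.smooth_a₂ hp hB.smooth
      (fun q hq => hB.bracket_xi_phi hS hq),
    hB.nabla_comb_e hS h0 hB.smooth_bracket_coef₂ hB.smooth_a₂ hp,
    hB.nabla_congr_right hB.smooth_one_add h0 hB.smooth_coefC hp hB.smooth_xi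
      (fun q hq => hB.nabla_phi_e hS hq),
    hB.nabla_xi_comb hS hB.smooth_one_add h0 hB.smooth_coefC hp,
    hB.nabla_congr_right h0 h0 hB.smooth_a₃ hp hB.smooth_phi (fun q hq => hB.nabla_xi_e hS hq),
    hB.nabla_phi_comb hS h0 h0 hB.smooth_a₃ hp, (hB.jacobi hS hp).2]
  simp only [vec_sub, dirDeriv_const, hB.dirDeriv_one_add hp]
  rw [hB.vec_inj hp, divH₁, nablaXiH₁]
  refine ⟨?_, ?_, ?_⟩ <;> ring

theorem curvature_xi_phi_phi : S.g.curvature S.xi (S.phiF e) (S.phiF e) p =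
    S.vec e p (S.nablaXiH₂ e p + S.sqH e p - 1) (S.divH₁ e p) 0 := by
  have h0 := SmoothFunOn.const (d := 3) (V := V) 0
  have hna := hB.smooth_a₂.neg
  rw [PseudoRiemannianMetric.curvature,
    hB.nabla_congr_left h0 hB.smooth_bracket_coef₂ hB.smooth_a₂ hp hB.smooth_phi
      (fun q hq => hB.bracket_xi_phi hS hq),
    hB.nabla_comb_phi hS h0 hB.smooth_bracket_coef₂ hB.smooth_a₂ hp,
    hB.nabla_congr_right hna hB.smooth_coefC h0 hp hB.smooth_xi
      (fun q hq => hB.nabla_phi_phi hS hq),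
    hB.nabla_xi_comb hS hna hB.smooth_coefC h0 hp,
    hB.nabla_congr_right h0 hB.smooth_a₃ h0 hp hB.smooth_phi (fun q hq => hB.nabla_xi_phi hS hq),
    hB.nabla_phi_comb hS h0 hB.smooth_a₃ h0 hp, (hB.jacobi hS hp).2]
  simp only [vec_sub, dirDeriv_const, dirDeriv_neg]
  rw [hB.vec_inj hp, divH₁, nablaXiH₂, sqH]
  refine ⟨?_, ?_, ?_⟩ <;> ring

theorem curvature_e_phi_e : S.g.curvature e (S.phiF e) e p =
    S.vec e p (-S.divH₂ e p) 0 (S.coefK e p) := by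
  have h0 := SmoothFunOn.const (d := 3) (V := V) 0
  have h2 := SmoothFunOn.const (d := 3) (V := V) (-2)
  have hna := hB.smooth_a₂.neg
  have hb := hB.smooth_coefB
  have hc := hB.smooth_coefC
  rw [PseudoRiemannianMetric.curvature,
    hB.nabla_congr_left h2 hb hc.neg hp hB.smooth (fun q hq => hB.bracket_e_phi hS hq),
    hB.nabla_comb_e hS h2 hb hc.neg hp,
    hB.nabla_congr_right hB.smooth_one_add h0 hc hp hB.smooth
      (fun q hq => hB.nabla_phi_e hS hq), hB.nabla_e_comb hS hB.smooth_one_add h0 hc hp,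
    hB.nabla_congr_right hna h0 hb hp hB.smooth_phi
      (fun q hq => hB.nabla_e_e hS hq), hB.nabla_phi_comb hS hna h0 hb hp]
  simp only [vec_sub, dirDeriv_const, dirDeriv_neg, hB.dirDeriv_one_add hp]
  rw [hB.vec_inj hp, coefK, divH₂, sqH]
  refine ⟨?_, ?_, ?_⟩ <;> ring

theorem curvature_e_phi_phi : S.g.curvature e (S.phiF e) (S.phiF e) p =
    S.vec e p (S.divH₁ e p) (S.coefK e p) 0 := by
  have h0 := SmoothFunOn.const (d := 3) (V := V) 0
  have h2 := SmoothFunOn.const (d := 3) (V := V) (-2)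
  have hna := hB.smooth_a₂.neg
  have hb := hB.smooth_coefB
  have hc := hB.smooth_coefC
  rw [PseudoRiemannianMetric.curvature,
    hB.nabla_congr_left h2 hb hc.neg hp hB.smooth_phi (fun q hq => hB.bracket_e_phi hS hq),
    hB.nabla_comb_phi hS h2 hb hc.neg hp,
    hB.nabla_congr_right hna hc h0 hp hB.smooth
      (fun q hq => hB.nabla_phi_phi hS hq), hB.nabla_e_comb hS hna hc h0 hp,
    hB.nabla_congr_right hB.smooth_sub_one hb h0 hp hB.smooth_phi
      (fun q hq => hB.nabla_e_phi hS hq), hB.nabla_phi_comb hS hB.smooth_sub_one hb h0 hp]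
  simp only [vec_sub, dirDeriv_const, dirDeriv_neg, hB.dirDeriv_sub_one hp]
  rw [hB.vec_inj hp, coefK, divH₁, sqH]
  refine ⟨?_, ?_, ?_⟩ <;> ring

omit hS in
theorem curvature_self (hX : SmoothFieldOn V X) (hZ : SmoothFieldOn V Z) :
    S.g.curvature X X Z p = S.vec e p 0 0 0 := by
  have h := hB.frame.curvature_swap hp hX hX hZ
  have h2 : (2 : ℝ) • S.g.curvature X X Z p = 0 := by
    rw [two_smul]
    nth_rewrite 1 [h]
    exact neg_add_cancel _
  rw [(smul_eq_zero.1 h2).resolve_left two_ne_zero]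
  simp [vec]

omit hS in
theorem ricci_eq_sum (hY : SmoothFieldOn V Y) (hZ : SmoothFieldOn V Z) :
    S.g.ricci Y Z p = S.g.val p (S.g.curvature Y S.xi Z p) (S.xi p) +
      S.g.val p (S.g.curvature Y e Z p) (e p)
        - S.g.val p (S.g.curvature Y (S.phiF e) Z p) (S.phiF e p) := by
  rw [hB.frame.ricci_eq_sum hp hY hZ, Fin.sum_univ_three]
  simp
  ring

/-- By tensoriality only the nine values on the basis matter, and each is a signed sum of the
curvature components computed above. In particular `Qξ = (-2 + 2 sqH) ξ + divH₁ e + divH₂ φe` for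
the Ricci operator `Q`. -/
theorem ricci_eq (hX : SmoothFieldOn V X) (hY : SmoothFieldOn V Y) {x y z x' y' z' : ℝ}
    (hXp : X p = S.vec e p x y z) (hYp : Y p = S.vec e p x' y' z') :
    S.g.ricci X Y p = x * x' * (-2 + 2 * S.sqH e p)
      + (x * y' + y * x') * S.divH₁ e p - (x * z' + z * x') * S.divH₂ e p
      + y * y' * (-S.nablaXiH₂ e p + S.sqH e p - 1 + S.coefK e p)
      + z * z' * (-S.nablaXiH₂ e p - S.sqH e p + 1 - S.coefK e p)
      + (y * z' + z * y') * S.nablaXiH₁ e p := by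
  have hF := hB.frame
  have hx := hB.smooth_xi
  have he := hB.smooth
  have hf := hB.smooth_phi
  have sw : ∀ {A B C : VField 3 M} {r s t : ℝ}, SmoothFieldOn V A → SmoothFieldOn V B →
      SmoothFieldOn V C → S.g.curvature A B C p = S.vec e p r s t →
      S.g.curvature B A C p = S.vec e p (-r) (-s) (-t) := fun hA hB' hC h => by
    rw [hF.curvature_swap hp hB' hA hC, h, vec_neg]
  have c1 := hB.curvature_xi_e_xi hS hp
  have c2 := hB.curvature_xi_phi_xi hS hp
  have c3 := hB.curvature_e_phi_xi hS hp
  have c4 := hB.curvature_xi_e_e hS hp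
  have c5 := hB.curvature_xi_e_phi hS hp
  have c6 := hB.curvature_xi_phi_e hS hp
  have c7 := hB.curvature_xi_phi_phi hS hp
  have c8 := hB.curvature_e_phi_e hS hp
  have c9 := hB.curvature_e_phi_phi hS hp
  have cs : ∀ {A C : VField 3 M}, SmoothFieldOn V A → SmoothFieldOn V C →
    S.g.curvature A A C p = S.vec e p 0 0 0 := fun hA hC => hB.curvature_self hp hA hC
  have v1 := hB.val_vec_xi hp
  have v2 := hB.val_vec_e hp
  have v3 := hB.val_vec_phi hp
  rw [hF.tensorial_eq_sum (hF.ricci_tensorialOn_left hp hY) hp hX, Fin.sum_univ_three]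
  simp only [Matrix.cons_val_zero, Matrix.cons_val_one, Matrix.cons_val, hXp, v1, v2, v3,
    hF.tensorial_eq_sum (hF.ricci_tensorialOn_right hp hx) hp hY,
    hF.tensorial_eq_sum (hF.ricci_tensorialOn_right hp he) hp hY,
    hF.tensorial_eq_sum (hF.ricci_tensorialOn_right hp hf) hp hY, Fin.sum_univ_three, hYp,
    hB.ricci_eq_sum hp hx hx, hB.ricci_eq_sum hp hx he, hB.ricci_eq_sum hp hx hf,
    hB.ricci_eq_sum hp he hx, hB.ricci_eq_sum hp he he, hB.ricci_eq_sum hp he hf,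
    hB.ricci_eq_sum hp hf hx, hB.ricci_eq_sum hp hf he, hB.ricci_eq_sum hp hf hf,
    cs hx hx, cs hx he, cs hx hf, cs he hx, cs he he, cs he hf, cs hf hx, cs hf he, cs hf hf,
    c1, c2, c3, c4, c5, c6, c7, c8, c9, sw hx he hx c1, sw hx hf hx c2, sw he hf hx c3,
    sw hx he he c4, sw hx he hf c5, sw hx hf he c6, sw hx hf hf c7, sw he hf he c8,
    sw he hf hf c9, smul_eq_mul]
  ring

theorem scalarCurvature_eq :
    S.g.scalarCurvature p = -4 + 4 * S.sqH e p + 2 * S.coefK e p := by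
  have hx : S.xi p = S.vec e p 1 0 0 := by simp [vec]
  have he : e p = S.vec e p 0 1 0 := by simp [vec]
  have hf : S.phiF e p = S.vec e p 0 0 1 := by simp [vec]
  rw [hB.frame.scalarCurvature_eq_sum hp, Fin.sum_univ_three]
  simp only [Matrix.cons_val_zero, Matrix.cons_val_one, Matrix.cons_val,
    hB.ricci_eq hS hp hB.smooth_xi hB.smooth_xi hx hx, hB.ricci_eq hS hp hB.smooth hB.smooth he he,
    hB.ricci_eq hS hp hB.smooth_phi hB.smooth_phi hf hf]
  ring

/-- `L_ξ g` is twice the symmetric part of `∇ξ = -φ + φh`. The summand `φ` is skew, so `L_ξ g = 2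
g(φh ·, ·)`. -/
theorem lieMetric_eq (hX : SmoothFieldOn V X) (hY : SmoothFieldOn V Y) {x y z x' y' z' : ℝ}
    (hXp : X p = S.vec e p x y z) (hYp : Y p = S.vec e p x' y' z') :
    S.g.lieMetric S.xi X Y p = 2 * S.a₂ e p * (y * y' + z * z')
      - 2 * S.a₁ e p * (y * z' + z * y') := by
  have hF := hB.frame
  have key : ∀ {X : VField 3 M} {x y z : ℝ}, SmoothFieldOn V X → X p = S.vec e p x y z →
      S.g.nabla X S.xi p = S.vec e p 0 (S.a₂ e p * y - (1 + S.a₁ e p) * z)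
        ((S.a₁ e p - 1) * y - S.a₂ e p * z) := fun {X x y z} hX hXp => by
    have hT : TensorialOn V p (fun X => S.g.nabla X S.xi p) :=
      ⟨fun hX hY => hF.nabla_add_left hp hX hY hB.smooth_xi,
        fun hf hX => hF.nabla_smul_left hp hf hX hB.smooth_xi⟩
    have hc := fun r : ℝ => SmoothFunOn.const (d := 3) (V := V) r
    rw [hF.tensorial_ext (Y := S.comb e (fun _ => x) (fun _ => y) (fun _ => z)) hT hp hX
      (hB.smooth_comb (hc x) (hc y) (hc z)) hXp, hB.nabla_comb_xi hS (hc x) (hc y) (hc z) hp]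
  have hval : ∀ x y z x' y' z', S.g.val p (S.vec e p x y z) (S.vec e p x' y' z') =
      x * x' + y * y' - z * z' := fun x y z x' y' z' => by
    conv_lhs => rw [vec.eq_def S e p x' y' z']
    simp only [map_add, map_smul, hB.val_vec_xi hp, hB.val_vec_e hp, hB.val_vec_phi hp, smul_eq_mul]
    ring
  rw [hF.lieMetric_eq hp hB.smooth_xi hX hY, key hX hXp, key hY hYp, hXp, hYp, hval, hval]
  ring

omit hS in
theorem inner_eq {x y z x' y' z' : ℝ}
    (hXp : X p = S.vec e p x y z) (hYp : Y p = S.vec e p x' y' z') :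
    S.g.inner X Y p = x * x' + y * y' - z * z' := by
  rw [PseudoRiemannianMetric.inner, hXp, hYp]
  conv_lhs => rw [vec.eq_def S e p x' y' z']
  simp only [map_add, map_smul, hB.val_vec_xi hp, hB.val_vec_e hp, hB.val_vec_phi hp, smul_eq_mul]
  ring

theorem curvature_xi_eq (hX : SmoothFieldOn V X) (hY : SmoothFieldOn V Y) {x y z x' y' z' : ℝ}
    (hXp : X p = S.vec e p x y z) (hYp : Y p = S.vec e p x' y' z') :
    S.g.curvature X Y S.xi p =
      (x * y' - y * x') • S.vec e p 0 (-S.nablaXiH₂ e p + S.sqH e p - 1) (-S.nablaXiH₁ e p)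
      + (x * z' - z * x') • S.vec e p 0 (S.nablaXiH₁ e p) (S.nablaXiH₂ e p + S.sqH e p - 1)
      + (y * z' - z * y') • S.vec e p 0 (S.divH₂ e p) (S.divH₁ e p) := by
  have hF := hB.frame
  have hx := hB.smooth_xi
  have he := hB.smooth
  have hf := hB.smooth_phi
  rw [hF.tensorial_eq_sum (hF.curvature_tensorialOn_left hp hY hx) hp hX, Fin.sum_univ_three]
  simp only [Matrix.cons_val_zero, Matrix.cons_val_one, Matrix.cons_val, hXp, hB.val_vec_xi hp,
    hB.val_vec_e hp, hB.val_vec_phi hp,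
    hF.tensorial_eq_sum (hF.curvature_tensorialOn_middle hp hx hx) hp hY,
    hF.tensorial_eq_sum (hF.curvature_tensorialOn_middle hp he hx) hp hY,
    hF.tensorial_eq_sum (hF.curvature_tensorialOn_middle hp hf hx) hp hY, Fin.sum_univ_three, hYp,
    hF.curvature_swap hp he hx hx, hF.curvature_swap hp hf hx hx, hF.curvature_swap hp hf he hx,
    hB.curvature_xi_e_xi hS hp, hB.curvature_xi_phi_xi hS hp, hB.curvature_e_phi_xi hS hp,
    hB.curvature_self hp hx hx, hB.curvature_self hp he hx, hB.curvature_self hp hf hx,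
    vec_smul, vec_add, vec_neg]
  rw [hB.vec_inj hp]
  refine ⟨?_, ?_, ?_⟩ <;> ring

/-- The trace of `L_ξ ∇`. -/
theorem trace_lieNabla :
    ∑ i, ∑ j, S.g.inverse p i j • S.g.lieNabla S.xi (basisField p i) (basisField p j) p =
      S.vec e p (4 * S.sqH e p) (2 * S.divH₁ e p) (2 * S.divH₂ e p) := by
  have hV := hB.isOpen
  have hx := hB.smooth_xi
  have he := hB.smooth
  have hf := hB.smooth_phi
  have h0 := SmoothFunOn.const (d := 3) (V := V) 0
  have hna := hB.smooth_a₂.neg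
  have ha := hB.smooth_a₂
  have hb := hB.smooth_coefB
  have hc := hB.smooth_coefC
  have hy := hB.smooth_bracket_coef₁
  have hz := hB.smooth_bracket_coef₂
  have l1 : S.g.lieNabla S.xi S.xi S.xi p = S.vec e p 0 0 0 := by
    rw [PseudoRiemannianMetric.lieNabla, bracket_congr (X' := S.xi)
        (Y' := S.comb e (fun _ => 0) (fun _ => 0) (fun _ => 0)) hV hp (fun _ _ => rfl)
        (fun q hq => hB.nabla_xi_xi hS hq), hB.bracket_xi_comb hS h0 h0 h0 hp,
      hB.nabla_congr_left h0 h0 h0 hp hx (fun q _ => by rw [bracket_self]; simp [vec]),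
      hB.nabla_congr_right h0 h0 h0 hp hx (fun q _ => by rw [bracket_self]; simp [vec]),
      hB.nabla_comb_xi hS h0 h0 h0 hp, hB.nabla_xi_comb hS h0 h0 h0 hp]
    simp only [vec_sub, dirDeriv_const]
    rw [hB.vec_inj hp]
    refine ⟨?_, ?_, ?_⟩ <;> ring
  obtain ⟨W2, hW2⟩ : ∃ W, S.g.lieNabla S.xi e e p = W := ⟨_, rfl⟩
  have l2 := hW2
  rw [PseudoRiemannianMetric.lieNabla, bracket_congr (X' := S.xi)
      (Y' := S.comb e (fun q => -S.a₂ e q) (fun _ => 0) (S.coefB e)) hV hp (fun _ _ => rfl)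
      (fun q hq => hB.nabla_e_e hS hq), hB.bracket_xi_comb hS hna h0 hb hp,
    hB.nabla_congr_left h0 hna hy hp he (fun q hq => hB.bracket_xi_e hS hq),
    hB.nabla_congr_right h0 hna hy hp he (fun q hq => hB.bracket_xi_e hS hq),
    hB.nabla_comb_e hS h0 hna hy hp, hB.nabla_e_comb hS h0 hna hy hp] at l2
  obtain ⟨W3, hW3⟩ : ∃ W, S.g.lieNabla S.xi (S.phiF e) (S.phiF e) p = W := ⟨_, rfl⟩
  have l3 := hW3
  rw [PseudoRiemannianMetric.lieNabla, bracket_congr (X' := S.xi)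
      (Y' := S.comb e (fun q => -S.a₂ e q) (S.coefC e) (fun _ => 0)) hV hp (fun _ _ => rfl)
      (fun q hq => hB.nabla_phi_phi hS hq), hB.bracket_xi_comb hS hna hc h0 hp,
    hB.nabla_congr_left h0 hz ha hp hf (fun q hq => hB.bracket_xi_phi hS hq),
    hB.nabla_congr_right h0 hz ha hp hf (fun q hq => hB.bracket_xi_phi hS hq),
    hB.nabla_comb_phi hS h0 hz ha hp, hB.nabla_phi_comb hS h0 hz ha hp] at l3
  -- The derivatives `ξ(b)` and `ξ(c)` come from the brackets of `ξ` with `∇_e e` and `∇_{φe} φe`.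
  -- After the Jacobi identity the derivatives of `a₃` drop out and the divergence terms remain.
  obtain ⟨j1, j2⟩ := hB.jacobi hS hp
  rw [hB.frame.trace_lieNabla hp hx, Fin.sum_univ_three]
  simp only [Matrix.cons_val_zero, Matrix.cons_val_one, Matrix.cons_val]
  rw [l1, hW2, hW3, ← l2, ← l3]
  simp only [vec_sub, vec_add, vec_smul, dirDeriv_const, dirDeriv_neg,
    hB.dirDeriv_bracket_coef₁ hp, hB.dirDeriv_bracket_coef₂ hp, j1, j2]
  rw [hB.vec_inj hp, sqH, divH₁, divH₂]
  refine ⟨?_, ?_, ?_⟩ <;> ring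

end Curvature

end IsPhiBasis

end AlmostParacontactMetric

end Paracontact

namespace Paracontact

/-! ### The crossing argument in a vector space. -/

section Crossing

open Filter Topology Set

/-- A `C¹` vector field has integral curves for a uniform time, staying in a given neighbourhood. -/
theorem exists_integralCurve_mem {E : Type*} [NormedAddCommGroup E] [NormedSpace ℝ E]
    [CompleteSpace E] {f : E → E} {z₀ : E} (hf : ContDiffAt ℝ 1 f z₀) {s : Set E} (hs : s ∈ 𝓝 z₀) :
    ∃ τ > (0 : ℝ), ∀ᶠ z in 𝓝 z₀, ∃ γ : ℝ → E, γ 0 = z ∧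
      ∀ t ∈ Icc 0 τ, γ t ∈ s ∧ HasDerivAt γ (f (γ t)) t := by
  obtain ⟨ε, hε, a, r, L, K, hr, hpl⟩ := IsPicardLindelof.of_contDiffAt_one hf
  obtain ⟨α, hα, hc⟩ := (hpl 0).exists_forall_mem_closedBall_eq_hasDerivWithinAt_continuousOn
  have hN : Metric.closedBall z₀ (r : ℝ) ×ˢ Icc (0 - ε) (0 + ε) ∈ 𝓝 (z₀, (0 : ℝ)) :=
    prod_mem_nhds (Metric.closedBall_mem_nhds _ (by exact_mod_cast hr))
      (Icc_mem_nhds (by linarith) (by linarith))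
  have h0 : α (z₀, 0) = z₀ := (hα z₀ (Metric.mem_closedBall_self r.2)).1
  -- Joint continuity of the flow in initial value and time gives one time `τ` that suits all
  -- initial values near `z₀`.
  have h1 : ∀ᶠ zt in 𝓝 (z₀, (0 : ℝ)), α zt ∈ s :=
    (hc.continuousAt hN).eventually (by rwa [h0])
  obtain ⟨A, hA, B, hB, hAB⟩ := mem_nhds_prod_iff.1 h1
  obtain ⟨δ, hδ, hδB⟩ := Metric.mem_nhds_iff.1 hB
  refine ⟨min (δ / 2) (ε / 2), by positivity, ?_⟩
  filter_upwards [hA, Metric.closedBall_mem_nhds z₀ (show (0 : ℝ) < r by exact_mod_cast hr)]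
    with z hzA hzr
  refine ⟨fun t => α (z, t), (hα z hzr).1, fun t ht => ⟨hAB ⟨hzA, hδB ?_⟩, ?_⟩⟩
  · rw [mem_ball_zero_iff, Real.norm_eq_abs, abs_of_nonneg ht.1]
    linarith [ht.2, min_le_left (δ / 2) (ε / 2)]
  · have h2 := min_le_right (δ / 2) (ε / 2)
    have h3 : t < ε := by linarith [ht.2]
    exact ((hα z hzr).2 t ⟨by linarith [ht.1], by linarith⟩).hasDerivAt
      (Icc_mem_nhds (by linarith [ht.1]) (by linarith))

/-- Grönwall's inequality with time reversed: a zero at `τ` would propagate back to a zero at 0. -/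
theorem ne_zero_of_abs_deriv_le_mul_abs_self {f f' : ℝ → ℝ} {K τ : ℝ} (hτ : 0 < τ)
    (hf : ∀ t ∈ Icc 0 τ, HasDerivAt f (f' t) t) (hb : ∀ t ∈ Icc 0 τ, |f' t| ≤ K * |f t|)
    (h0 : f 0 ≠ 0) : f τ ≠ 0 := by
  intro h1
  have hm : ∀ {t}, t ∈ Icc 0 τ → τ - t ∈ Icc 0 τ := fun {t} ht =>
    ⟨by linarith [ht.2], by linarith [ht.1]⟩
  have hd : ∀ t ∈ Icc 0 τ, HasDerivAt (fun t => f (τ - t)) (-f' (τ - t)) t := fun t ht => by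
    have h := (hf _ (hm ht)).comp t ((hasDerivAt_id' t).const_sub τ)
    rw [mul_neg_one] at h
    exact h
  have := eq_zero_of_abs_deriv_le_mul_abs_self_of_eq_zero_right (K := K)
    (fun t ht => (hd t ht).continuousAt.continuousWithinAt)
    (fun t ht => (hd t (Ico_subset_Icc_self ht)).hasDerivWithinAt) (by simpa using h1)
    (fun t ht => by simpa using hb _ (hm (Ico_subset_Icc_self ht))) τ (right_mem_Icc.2 hτ.le)
  exact h0 (by simpa using this)

variable {E : Type*} [NormedAddCommGroup E] [NormedSpace ℝ E] [FiniteDimensional ℝ E]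

/-- Near `p`, a displacement can be written as a combination of a frame, with coefficients which
are small if the displacement is small. -/
theorem exists_coefficients {ι : Type*} [Fintype ι] {F : Type*} [NormedAddCommGroup F]
    [NormedSpace ℝ F] {W : ι → F → E} {q : F} (hW : ∀ i, ContDiffAt ℝ 1 (W i) q)
    (hli : LinearIndependent ℝ fun i => W i q) (hcard : Fintype.card ι = Module.finrank ℝ E) :
    ∃ c : F × E → ι → ℝ, ContDiffAt ℝ 1 c (q, 0) ∧
      (∀ᶠ z in 𝓝 (q, (0 : E)), ∑ i, c z i • W i z.1 = z.2) ∧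
      ∀ᶠ z in 𝓝 (q, (0 : E)), ∀ i, |c z i| ≤ 1 := by
  have := FiniteDimensional.complete ℝ E
  -- The coefficients are `(Λ y)⁻¹` applied to the displacement. `Λ q` is invertible by independence
  -- and the dimension count, and inversion is `C¹` near an invertible map.
  let Λ : F → (ι → ℝ) →L[ℝ] E := fun y =>
    ∑ i, ContinuousLinearMap.smulRightL ℝ (ι → ℝ) E (ContinuousLinearMap.proj i) (W i y)
  have hΛ : ∀ y c, Λ y c = ∑ i, c i • W i y := fun y c => by
    simp [Λ]
  have hΛs : ContDiffAt ℝ 1 Λ q := ContDiffAt.sum fun i _ =>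
    (ContinuousLinearMap.contDiff _).contDiffAt.comp q (hW i)
  have hinj : Function.Injective (Λ q : (ι → ℝ) →ₗ[ℝ] E) := by
    rw [← LinearMap.ker_eq_bot, LinearMap.ker_eq_bot']
    intro c hc
    exact funext (Fintype.linearIndependent_iff.1 hli c ((hΛ q c).symm.trans hc))
  let A : (ι → ℝ) ≃L[ℝ] E := (LinearEquiv.ofInjectiveOfFinrankEq _ hinj
    (by rw [Module.finrank_fintype_fun_eq_card, hcard])).toContinuousLinearEquiv
  have hA : (A : (ι → ℝ) →L[ℝ] E) = Λ q := by ext; rfl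
  have hcs : ContDiffAt ℝ 1 (fun z : F × E => (Λ z.1).inverse z.2) (q, 0) := by
    refine ContDiffAt.clm_apply ?_ contDiffAt_snd
    have h1 : ContDiffAt ℝ 1 ContinuousLinearMap.inverse (Λ q) := by
      rw [← hA]; exact contDiffAt_map_inverse A
    exact ContDiffAt.comp (q, (0 : E)) (g := fun y => (Λ y).inverse)
      (ContDiffAt.comp q h1 hΛs) contDiffAt_fst
  refine ⟨_, hcs, ?_, ?_⟩
  · have h1 : ∀ᶠ y in 𝓝 q, Λ y ∈ range ((↑) : ((ι → ℝ) ≃L[ℝ] E) → (ι → ℝ) →L[ℝ] E) :=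
      hΛs.continuousAt.eventually (by rw [← hA]; exact A.nhds)
    filter_upwards [continuousAt_fst.eventually h1] with z hz
    obtain ⟨B, hB⟩ := hz
    rw [← hΛ, ← hB, ContinuousLinearMap.inverse_equiv]
    exact B.apply_symm_apply _
  · refine eventually_all.2 fun i => ?_
    have h1 : ContinuousAt (fun z : F × E => |(Λ z.1).inverse z.2 i|) (q, 0) :=
      ((continuous_apply i).continuousAt.comp hcs.continuousAt).abs
    exact h1.eventually_le_const (by simp)

/-- Functions `α`, `β` such that the zero set of `α` is preserved by the flows of `P` and `Q`, and
the zero set of `β` is preserved by the flow of `R`, where `P`, `Q`, `R` is a frame: if `αβ = 0`,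
then `α` or `β` vanishes near `p`. -/
theorem eventually_eq_zero_or_eventually_eq_zero (hE : Module.finrank ℝ E = 3) {P Q R : E → E}
    {α β u v w : E → ℝ} {p : E} (hP : ContDiffAt ℝ 1 P p) (hQ : ContDiffAt ℝ 1 Q p)
    (hR : ContDiffAt ℝ 1 R p) (hli : LinearIndependent ℝ ![P p, Q p, R p])
    (hα : ∀ᶠ x in 𝓝 p, DifferentiableAt ℝ α x) (hβ : ∀ᶠ x in 𝓝 p, DifferentiableAt ℝ β x)
    (hu : ContinuousAt u p) (hv : ContinuousAt v p) (hw : ContinuousAt w p)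
    (hPα : ∀ᶠ x in 𝓝 p, fderiv ℝ α x (P x) = u x * α x)
    (hQα : ∀ᶠ x in 𝓝 p, fderiv ℝ α x (Q x) = v x * α x)
    (hRβ : ∀ᶠ x in 𝓝 p, fderiv ℝ β x (R x) = w x * β x)
    (h0 : ∀ᶠ x in 𝓝 p, α x * β x = 0) :
    (∀ᶠ x in 𝓝 p, α x = 0) ∨ ∀ᶠ x in 𝓝 p, β x = 0 := by
  have := FiniteDimensional.complete ℝ E
  -- The frame is split over two points: `P` and `Q` are taken at the first, `R` at the second.
  have hW : ∀ i : Fin 3, ContDiffAt ℝ 1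
      ((![fun y => P y.1, fun y => Q y.1, fun y => R y.2] : Fin 3 → E × E → E) i) (p, p) := by
    intro i
    fin_cases i
    · exact ContDiffAt.comp (g := P) (f := Prod.fst) (p, p) hP contDiffAt_fst
    · exact ContDiffAt.comp (g := Q) (f := Prod.fst) (p, p) hQ contDiffAt_fst
    · exact ContDiffAt.comp (g := R) (f := Prod.snd) (p, p) hR contDiffAt_snd
  obtain ⟨c, hc, hcsum, hcb⟩ := exists_coefficients (E := E) hW
    (by convert hli using 1; ext i; fin_cases i <;> rfl) (by simp [hE])
  -- The state is a pair of points `x`, `y` and a constant vector `δ`. With `c₀ P(x) + c₁ Q(x) + c₂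
  -- R(y) = δ`, the point `x` moves along `c₀ P + c₁ Q` and `y` along `-c₂ R`. Hence `x - y` has
  -- constant velocity `δ`.
  let G : (E × E) × E → (E × E) × E := fun z =>
    ((c z 0 • P z.1.1 + c z 1 • Q z.1.1, -(c z 2 • R z.1.2)), 0)
  have hci : ∀ i, ContDiffAt ℝ 1 (fun z => c z i) ((p, p), 0) := fun i =>
    (contDiff_apply ℝ ℝ i).contDiffAt.comp _ hc
  have h11 : ContDiffAt ℝ 1 (fun z : (E × E) × E => z.1.1) ((p, p), 0) := by fun_prop
  have h12 : ContDiffAt ℝ 1 (fun z : (E × E) × E => z.1.2) ((p, p), 0) := by fun_prop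
  have hG : ContDiffAt ℝ 1 G ((p, p), 0) :=
    ((((hci 0).smul (hP.comp ((p, p), (0 : E)) h11)).add
      ((hci 1).smul (hQ.comp ((p, p), (0 : E)) h11))).prodMk
      ((hci 2).smul (hR.comp ((p, p), (0 : E)) h12)).neg).prodMk contDiffAt_const
  have hbd : ∀ {f : E → ℝ}, ContinuousAt f p → ∀ᶠ x in 𝓝 p, |f x| ≤ |f p| + 1 := fun hf =>
    hf.abs.eventually_le_const (by linarith)
  have ev1 := h11.continuousAt.eventually ((hα.and (hPα.and hQα)).and
    ((hbd hu).and ((hbd hv).and h0)))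
  have ev2 := h12.continuousAt.eventually (hβ.and (hRβ.and (hbd hw)))
  obtain ⟨τ, hτ, hflow⟩ := exists_integralCurve_mem hG (ev1.and (ev2.and (hcsum.and hcb)))
  -- Because `τ` is fixed before `a` and `b`, the velocity `τ⁻¹ (b - a)` tends to 0 as `a` and `b`
  -- tend to `p`. This initial state therefore lies in the domain of the flow.
  have hcont : Tendsto (fun ab : E × E => ((ab.1, ab.2), τ⁻¹ • (ab.2 - ab.1))) (𝓝 (p, p))
      (𝓝 ((p, p), (0 : E))) := by
    have : Continuous (fun ab : E × E => ((ab.1, ab.2), τ⁻¹ • (ab.2 - ab.1))) := by fun_prop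
    simpa using this.tendsto (p, p)
  have hpair := hcont.eventually hflow
  obtain ⟨A, hA, B, hB, hAB⟩ := mem_nhds_prod_iff.1 hpair
  by_contra hcon
  simp only [not_or, not_eventually] at hcon
  obtain ⟨a, ha, haA⟩ := (hcon.1.and_eventually hA).exists
  obtain ⟨b, hb, hbB⟩ := (hcon.2.and_eventually hB).exists
  obtain ⟨γ, hγ0, hγ⟩ := hAB (show (a, b) ∈ A ×ˢ B from ⟨haA, hbB⟩)
  simp only at hγ0
  have hγ1 : ∀ t ∈ Icc 0 τ, HasDerivAt (fun t => (γ t).1.1)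
      (c (γ t) 0 • P (γ t).1.1 + c (γ t) 1 • Q (γ t).1.1) t := fun t ht =>
    (((ContinuousLinearMap.fst ℝ E E).comp (.fst ℝ (E × E) E)).hasFDerivAt.comp_hasDerivAt t
      (hγ t ht).2)
  have hγ2 : ∀ t ∈ Icc 0 τ, HasDerivAt (fun t => (γ t).1.2) (-(c (γ t) 2 • R (γ t).1.2)) t :=
    fun t ht => (((ContinuousLinearMap.snd ℝ E E).comp
      (.fst ℝ (E × E) E)).hasFDerivAt.comp_hasDerivAt t (hγ t ht).2)
  have hγ3 : ∀ t ∈ Icc 0 τ, HasDerivAt (fun t => (γ t).2) 0 t :=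
    fun t ht => (ContinuousLinearMap.snd ℝ (E × E) E).hasFDerivAt.comp_hasDerivAt t (hγ t ht).2
  have hd : ∀ t ∈ Icc 0 τ, (γ t).2 = τ⁻¹ • (b - a) := fun t ht => by
    have := constant_of_has_deriv_right_zero (f := fun t => (γ t).2) (a := 0) (b := τ)
      (fun t ht => (hγ3 t ht).continuousAt.continuousWithinAt)
      (fun t ht => (hγ3 t (Ico_subset_Icc_self ht)).hasDerivWithinAt) t ht
    rw [this, hγ0]
  -- The difference starts at `a - b` and grows at the rate `τ⁻¹ (b - a)`, so it is zero at time
  -- `τ`.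
  have hmeet : (γ τ).1.1 = (γ τ).1.2 := by
    have h1 : ∀ t ∈ Icc 0 τ, HasDerivAt
        (fun t => (γ t).1.1 - (γ t).1.2 - t • (τ⁻¹ • (b - a))) 0 t := fun t ht => by
      have h2 := ((hγ1 t ht).sub (hγ2 t ht)).sub
        ((hasDerivAt_id' t).smul_const (τ⁻¹ • (b - a)))
      refine h2.congr_deriv ?_
      have h3 := (hγ t ht).1.2.2.1
      simp only [Fin.sum_univ_three] at h3
      rw [← hd t ht, ← h3]
      simp
    have h4 := constant_of_has_deriv_right_zero (a := 0) (b := τ)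
      (fun t ht => (h1 t ht).continuousAt.continuousWithinAt)
      (fun t ht => (h1 t (Ico_subset_Icc_self ht)).hasDerivWithinAt) τ (right_mem_Icc.2 hτ.le)
    simp only [hγ0, smul_smul, mul_inv_cancel₀ hτ.ne', one_smul, zero_mul, zero_smul,
      sub_zero] at h4
    rw [← sub_eq_zero, sub_eq_iff_eq_add.1 h4]
    abel
  -- Along the first curve the derivative of `α` is `(c₀ u + c₁ v) α` with `|c₀|, |c₁| ≤ 1` and `u`,
  -- `v` bounded near `p`. So `α` stays nonzero, and likewise `β` along the second curve.
  have hατ : α (γ τ).1.1 ≠ 0 := by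
    refine ne_zero_of_abs_deriv_le_mul_abs_self (f := fun t => α (γ t).1.1)
      (f' := fun t => fderiv ℝ α (γ t).1.1 (c (γ t) 0 • P (γ t).1.1 + c (γ t) 1 • Q (γ t).1.1))
      (K := (|u p| + 1) + (|v p| + 1)) hτ (fun t ht => ?_) (fun t ht => ?_) ?_
    · exact (hγ t ht).1.1.1.1.hasFDerivAt.comp_hasDerivAt t (hγ1 t ht)
    · obtain ⟨⟨⟨-, e1, e2⟩, e3, e4, -⟩, -, -, e5⟩ := (hγ t ht).1
      rw [map_add, map_smul, map_smul, e1, e2, smul_eq_mul, smul_eq_mul, ← mul_assoc, ← mul_assoc,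
        ← add_mul, abs_mul]
      refine mul_le_mul_of_nonneg_right ((abs_add_le _ _).trans ?_) (abs_nonneg _)
      rw [abs_mul, abs_mul]
      have i0 := e5 0
      have i1 := e5 1
      gcongr
      · exact (mul_le_of_le_one_left (abs_nonneg _) i0).trans e3
      · exact (mul_le_of_le_one_left (abs_nonneg _) i1).trans e4
    · rwa [hγ0]
  have hβτ : β (γ τ).1.2 ≠ 0 := by
    refine ne_zero_of_abs_deriv_le_mul_abs_self (f := fun t => β (γ t).1.2)
      (f' := fun t => fderiv ℝ β (γ t).1.2 (-(c (γ t) 2 • R (γ t).1.2)))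
      (K := |w p| + 1) hτ (fun t ht => ?_) (fun t ht => ?_) ?_
    · exact (hγ t ht).1.2.1.1.hasFDerivAt.comp_hasDerivAt t (hγ2 t ht)
    · obtain ⟨-, ⟨-, e1, e2⟩, -, e5⟩ := (hγ t ht).1
      rw [map_neg, map_smul, e1, smul_eq_mul, abs_neg, ← mul_assoc, abs_mul, abs_mul]
      exact mul_le_mul_of_nonneg_right
        ((mul_le_of_le_one_left (abs_nonneg _) (e5 2)).trans e2) (abs_nonneg _)
    · rwa [hγ0]
  have := (hγ τ (right_mem_Icc.2 hτ.le)).1.1.2.2.2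
  rw [← hmeet] at hβτ
  exact (mul_ne_zero hατ hβτ) this

end Crossing

end Paracontact

namespace Paracontact

/-! ### Transfer of the crossing argument to the manifold. -/

section Chart

open Filter Topology

variable {d : ℕ} {M : Type*} [TopologicalSpace M] [ChartedSpace (Model d) M]
  [IsManifold (𝓡 d) ∞ M] {V : Set M} {f : M → ℝ} {X : VField d M} {p : M}

/-- The expression of a vector field in the preferred chart at `p`. -/
noncomputable def chartField (p : M) (X : VField d M) (x : Model d) : Model d :=
  mvfderiv (𝓡 d) (extChartAt (𝓡 d) p) ((extChartAt (𝓡 d) p).symm x)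
    (X ((extChartAt (𝓡 d) p).symm x))

/-- The tangent space at `p` is modelled on the preferred chart at `p`, whose derivative at `p` is
therefore the identity. So independence of fields at `p` carries over to the chart unchanged. -/
theorem chartField_self (X : VField d M) : chartField p X (extChartAt (𝓡 d) p p) = X p := by
  rw [chartField, extChartAt_to_inv]
  have h : mfderiv (𝓡 d) (𝓡 d) (extChartAt (𝓡 d) p) p = ContinuousLinearMap.id ℝ _ :=
    mfderiv_extChartAt_self
  exact congrArg (fun L => L (X p)) h

theorem eventually_symm_mem (hV : IsOpen V) (hp : p ∈ V) :
    ∀ᶠ x in 𝓝 (extChartAt (𝓡 d) p p),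
      x ∈ (extChartAt (𝓡 d) p).target ∧ (extChartAt (𝓡 d) p).symm x ∈ V := by
  have h : ∀ᶠ q in 𝓝 ((extChartAt (𝓡 d) p).symm (extChartAt (𝓡 d) p p)), q ∈ V := by
    rw [extChartAt_to_inv]
    exact hV.mem_nhds hp
  filter_upwards [extChartAt_target_mem_nhds (I := 𝓡 d) p,
    (continuousAt_extChartAt_symm p).eventually h] with x h1 h2 using ⟨h1, h2⟩

theorem contDiffAt_chartField (hV : IsOpen V) (hp : p ∈ V) (hX : SmoothFieldOn V X) :
    ContDiffAt ℝ 1 (chartField p X) (extChartAt (𝓡 d) p p) := by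
  have hW := hV.inter (isOpen_extChartAt_source (I := 𝓡 d) p)
  have h1 := contMDiffOn_mvfderiv_apply hW
    ((contMDiffOn_extChartAt (I := 𝓡 d) (n := ∞) (x := p)).mono
      (by rw [extChartAt_source]; exact Set.inter_subset_right)) (hX.mono Set.inter_subset_left)
  have h2 := (contMDiffOn_extChartAt_symm (I := 𝓡 d) (n := ∞) p).contMDiffAt
    (extChartAt_target_mem_nhds p)
  have h3 := h1.contMDiffAt (x := (extChartAt (𝓡 d) p).symm (extChartAt (𝓡 d) p p))
    (by rw [extChartAt_to_inv]; exact hW.mem_nhds ⟨hp, mem_extChartAt_source p⟩)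
  exact (contMDiffAt_iff_contDiffAt.1 (h3.comp _ h2)).of_le (by simp)

theorem differentiableAt_comp_symm (hV : IsOpen V) (hf : SmoothFunOn (d := d) V f) {x : Model d}
    (hx : x ∈ (extChartAt (𝓡 d) p).target) (hxV : (extChartAt (𝓡 d) p).symm x ∈ V) :
    DifferentiableAt ℝ (f ∘ (extChartAt (𝓡 d) p).symm) x := by
  have h2 := (contMDiffOn_extChartAt_symm (I := 𝓡 d) (n := ∞) p).contMDiffAt
    ((isOpen_extChartAt_target p).mem_nhds hx)
  exact (contMDiffAt_iff_contDiffAt.1 ((hf.contMDiffAt (hV.mem_nhds hxV)).comp x h2)).differentiableAt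
    (by simp)

theorem fderiv_chartField (hV : IsOpen V) (hf : SmoothFunOn (d := d) V f) {x : Model d}
    (hx : x ∈ (extChartAt (𝓡 d) p).target) (hxV : (extChartAt (𝓡 d) p).symm x ∈ V) :
    fderiv ℝ (f ∘ (extChartAt (𝓡 d) p).symm) x (chartField p X x) =
      dirDeriv X f ((extChartAt (𝓡 d) p).symm x) := by
  set φ := extChartAt (𝓡 d) p
  have hs : φ.symm x ∈ φ.source := φ.map_target hx
  have hd := differentiableAt_comp_symm hV hf hx hxV
  have hφ : MDifferentiableAt (𝓡 d) (𝓡 d) φ (φ.symm x) :=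
    mdifferentiableAt_extChartAt (by rwa [← extChartAt_source (𝓡 d)])
  have heq : f =ᶠ[𝓝 (φ.symm x)] (f ∘ φ.symm) ∘ φ := by
    filter_upwards [(isOpen_extChartAt_source (I := 𝓡 d) p).mem_nhds hs] with q hq
    simp only [Function.comp, φ.left_inv hq]
  have hxx : φ (φ.symm x) = x := φ.right_inv hx
  have hd' : MDifferentiableAt (𝓡 d) 𝓘(ℝ, ℝ) (f ∘ φ.symm) (φ (φ.symm x)) := by
    rw [hxx]; exact hd.mdifferentiableAt
  have h1 : mfderiv (𝓡 d) 𝓘(ℝ, ℝ) f (φ.symm x) =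
      (mfderiv (𝓡 d) 𝓘(ℝ, ℝ) (f ∘ φ.symm) (φ (φ.symm x))).comp
        (mfderiv (𝓡 d) (𝓡 d) φ (φ.symm x)) := by
    rw [← mfderiv_comp _ hd' hφ]
    exact heq.mfderiv_eq
  have h2 : mfderiv (𝓡 d) 𝓘(ℝ, ℝ) (f ∘ φ.symm) (φ (φ.symm x)) = fderiv ℝ (f ∘ φ.symm) x := by
    rw [hxx]; exact mfderiv_eq_fderiv
  rw [h2] at h1
  exact (congrArg (fun L => L (X (φ.symm x))) h1).symm

/-- Functions `α`, `β` such that the zero set of `α` is preserved by the flows of `X` and `Y`, and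
the zero set of `β` is preserved by the flow of `Z`, where `X`, `Y`, `Z` is a frame: if `αβ = 0`,
then `α` or `β` vanishes near `p`. -/
theorem eventually_eq_zero_or_of_frame {M : Type*} [TopologicalSpace M]
    [ChartedSpace (Model 3) M] [IsManifold (𝓡 3) ∞ M] {V : Set M} {p : M} {X Y Z : VField 3 M}
    {α β u v w : M → ℝ} (hV : IsOpen V) (hp : p ∈ V) (hX : SmoothFieldOn V X)
    (hY : SmoothFieldOn V Y) (hZ : SmoothFieldOn V Z)
    (hli : LinearIndependent ℝ ![X p, Y p, Z p])
    (hα : SmoothFunOn (d := 3) V α) (hβ : SmoothFunOn (d := 3) V β)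
    (hu : SmoothFunOn (d := 3) V u) (hv : SmoothFunOn (d := 3) V v)
    (hw : SmoothFunOn (d := 3) V w) (hXα : ∀ q ∈ V, dirDeriv X α q = u q * α q)
    (hYα : ∀ q ∈ V, dirDeriv Y α q = v q * α q) (hZβ : ∀ q ∈ V, dirDeriv Z β q = w q * β q)
    (h0 : ∀ q ∈ V, α q * β q = 0) :
    (∀ᶠ q in 𝓝 p, α q = 0) ∨ ∀ᶠ q in 𝓝 p, β q = 0 := by
  have hev := eventually_symm_mem (d := 3) hV hp
  have hc : ∀ {f : M → ℝ}, SmoothFunOn (d := 3) V f →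
      ContinuousAt (f ∘ (extChartAt (𝓡 3) p).symm) (extChartAt (𝓡 3) p p) := fun hf =>
    (differentiableAt_comp_symm hV hf (mem_extChartAt_target p)
      (by rwa [extChartAt_to_inv])).continuousAt
  have back : ∀ {f : M → ℝ}, (∀ᶠ x in 𝓝 (extChartAt (𝓡 3) p p),
      (f ∘ (extChartAt (𝓡 3) p).symm) x = 0) → ∀ᶠ q in 𝓝 p, f q = 0 := fun hf => by
    filter_upwards [(continuousAt_extChartAt p).eventually hf,
      (isOpen_extChartAt_source (I := 𝓡 3) p).mem_nhds (mem_extChartAt_source p)] with q hq hqs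
    rwa [Function.comp, (extChartAt (𝓡 3) p).left_inv hqs] at hq
  have key : ∀ {f w : M → ℝ} {X : VField 3 M}, SmoothFunOn (d := 3) V f →
      (∀ q ∈ V, dirDeriv X f q = w q * f q) → ∀ᶠ x in 𝓝 (extChartAt (𝓡 3) p p),
      fderiv ℝ (f ∘ (extChartAt (𝓡 3) p).symm) x (chartField p X x) =
        (w ∘ (extChartAt (𝓡 3) p).symm) x * (f ∘ (extChartAt (𝓡 3) p).symm) x :=
    fun hf h => by
      filter_upwards [hev] with x hx
      rw [fderiv_chartField hV hf hx.1 hx.2]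
      exact h _ hx.2
  refine (eventually_eq_zero_or_eventually_eq_zero (by simp) (contDiffAt_chartField hV hp hX)
    (contDiffAt_chartField hV hp hY) (contDiffAt_chartField hV hp hZ)
    (by rw [chartField_self, chartField_self, chartField_self]; exact hli)
    (hev.mono fun x hx => differentiableAt_comp_symm hV hα hx.1 hx.2)
    (hev.mono fun x hx => differentiableAt_comp_symm hV hβ hx.1 hx.2) (hc hu) (hc hv) (hc hw)
    (key hα hXα) (key hα hYα) (key hβ hZβ)
    (hev.mono fun x hx => h0 _ hx.2)).imp back back

end Chart

end Paracontact

namespace Paracontact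

/-! ### Normality, harmonicity, the `(-1, μ)`-condition and the soliton equation as equations in
components. -/

namespace AlmostParacontactMetric

variable {M : Type*} [TopologicalSpace M] [ChartedSpace (Model 3) M]
  [IsManifold (𝓡 3) ∞ M] {S : AlmostParacontactMetric 3 M} {V : Set M} {e X Y Z : VField 3 M}
  {p : M}

variable (S) in
/-- The `(κ, μ)`-condition at a point. -/
def IsKappaMuAt (κ μ : ℝ) (p : M) : Prop :=
  ∀ X Y : VField 3 M, SmoothField X → SmoothField Y →
    S.g.curvature X Y S.xi p =
      κ • (S.etaF X p • Y p - S.etaF Y p • X p) + μ • (S.etaF X p • S.h Y p - S.etaF Y p • S.h X p)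

theorem phiF_xi (S : AlmostParacontactMetric 3 M) : S.phiF S.xi = 0 := funext fun q => S.phi_xi q

/-- Since `φξ = 0`, only `φ²[X, ξ]` and `φ[φX, ξ]` survive. This is how normality forces `φh = 0`.
-/
theorem nijenhuis_xi_right (X : VField 3 M) (p : M) :
    S.nijenhuis X S.xi p = (2 : ℝ) • S.phi p (S.h X p) := by
  rw [nijenhuis, phiF_xi, show bracket (S.phiF X) 0 p = 0 by simp [bracket],
    show bracket X 0 p = 0 by simp [bracket], bracket_swap (X := X), bracket_swap (X := S.phiF X), h]
  simp only [map_neg, map_smul, map_sub, map_zero, smul_smul]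
  module

namespace IsPhiBasis

variable (hB : S.IsPhiBasis V e)
include hB

theorem xi_eq (p : M) : S.xi p = S.vec e p 1 0 0 := by simp [vec]

theorem e_eq (p : M) : e p = S.vec e p 0 1 0 := by simp [vec]

theorem phi_eq (p : M) : S.phiF e p = S.vec e p 0 0 1 := by simp [vec]

variable [T2Space M] (hS : S.IsParacontactMetric)
include hS

/-- Since `hξ = 0` and `h(φe) = -φ(he)`, the tensor `h` at `p` is determined by `a₁` and `a₂`. -/
theorem mem_hSupport_iff (hp : p ∈ V) : p ∈ S.hSupport ↔ ¬(S.a₁ e p = 0 ∧ S.a₂ e p = 0) := by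
  constructor
  · rintro ⟨X, hX, hXp⟩ ⟨h1, h2⟩
    refine hXp ?_
    rw [hB.h_eq hS hp (hX.on V) (hB.eq_vec hp (X p)), h1, h2, hB.vec_eq_zero hp]
    simp
  · intro hn
    obtain ⟨X, hX, hXp⟩ := exists_smoothField p (e p)
    refine ⟨X, hX, fun h0 => hn ?_⟩
    rw [hB.h_eq hS hp (hX.on V) (hXp.trans (hB.e_eq p)), hB.vec_eq_zero hp] at h0
    exact ⟨by linarith [h0.2.1], by linarith [h0.2.2]⟩

theorem phi_phi_h (hp : p ∈ V) (hX : SmoothField X) : S.phi p (S.phi p (S.h X p)) = S.h X p := by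
  rw [hB.h_eq hS hp (hX.on V) (hB.eq_vec hp (X p)), hB.phi_vec hp, hB.phi_vec hp]

/-- If `h` vanishes, then the normality condition holds. -/
theorem nijenhuis_eq_of_h_eq_zero (hp : p ∈ V) (hX : SmoothField X) (hY : SmoothField Y)
    (h1 : S.a₁ e p = 0) (h2 : S.a₂ e p = 0) :
    S.nijenhuis X Y p - (2 * S.dEta X Y p) • S.xi p = 0 := by
  have hV := hB.isOpen
  have hF := hB.frame
  have hh : ∀ {Z}, SmoothFieldOn V Z → S.h Z p = 0 := fun hZ => by
    rw [hB.h_eq hS hp hZ (hB.eq_vec hp _), h1, h2, hB.vec_eq_zero hp]; simp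
  have swap : ∀ {A B : VField 3 M}, SmoothFieldOn V A → SmoothFieldOn V B →
      S.nijenhuis A B p - (2 * S.dEta A B p) • S.xi p =
        -(S.nijenhuis B A p - (2 * S.dEta B A p) • S.xi p) := fun {A B} hA hB' => by
    rw [S.nijenhuis_swap, hB.dEta_eq hS hp hA hB', hB.dEta_eq hS hp hB' hA,
      ← neg_neg (S.g.val p (A p) _), ← S.val_phi_left, S.g.symm p (S.phi p _)]
    module
  have self : ∀ {A : VField 3 M}, SmoothFieldOn V A →
      S.nijenhuis A A p - (2 * S.dEta A A p) • S.xi p = 0 := fun {A} hA => by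
    have h3 : (2 : ℝ) • (S.nijenhuis A A p - (2 * S.dEta A A p) • S.xi p) = 0 := by
      rw [two_smul]
      nth_rewrite 1 [swap hA hA]
      exact neg_add_cancel _
    exact (smul_eq_zero.1 h3).resolve_left two_ne_zero
  have right : ∀ A : VField 3 M, TensorialOn V p
      (fun B => S.nijenhuis A B p - (2 * S.dEta A B p) • S.xi p) := fun A =>
    { add := fun hB₁ hB₂ => by
        rw [(S.nijenhuis_tensorialOn_right hV hp (X := A)).add hB₁ hB₂,
          (S.dEta_tensorialOn_right hV hp (X := A)).add hB₁ hB₂]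
        module
      smul := fun hf hB₁ => by
        rw [(S.nijenhuis_tensorialOn_right hV hp (X := A)).smul hf hB₁,
          (S.dEta_tensorialOn_right hV hp (X := A)).smul hf hB₁, smul_eq_mul]
        module }
  have xi : ∀ {A}, SmoothFieldOn V A →
      S.nijenhuis A S.xi p - (2 * S.dEta A S.xi p) • S.xi p = 0 := fun hA => by
    rw [S.nijenhuis_xi_right, hh hA, hB.dEta_eq hS hp hA hB.smooth_xi, S.phi_xi]
    simp
  -- The only pair that `h = 0` and skew-symmetry leave open. As `φ` exchanges `e` and `φe`, the
  -- torsion is `φ²[e, φe] - [e, φe] = -η([e, φe]) ξ = 2ξ`, which matches `2 dη(e, φe) = 2`.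
  have ef : S.nijenhuis e (S.phiF e) p - (2 * S.dEta e (S.phiF e) p) • S.xi p = 0 := by
    rw [nijenhuis, bracket_self, bracket_congr (X' := S.phiF e) (Y' := e) hV hp (fun _ _ => rfl)
        (fun q hq => hB.phiF_phiF_e hq), bracket_congr (X' := e) (Y' := e) hV hp (fun _ _ => rfl)
        (fun q hq => hB.phiF_phiF_e hq), bracket_self, bracket_swap (X := S.phiF e),
      hB.bracket_e_phi hS hp, hB.dEta_eq hS hp hB.smooth hB.smooth_phi, hB.phi_phi_e hp,
      show S.g.val p (e p) (e p) = 1 from hB.e_e p hp, hB.phi_vec hp, hB.phi_vec hp, map_zero,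
      sub_zero, sub_zero, hB.xi_eq p, vec_smul, vec_neg, vec_add, vec_sub, hB.vec_eq_zero hp]
    refine ⟨?_, ?_, ?_⟩ <;> ring
  have hx := hB.smooth_xi
  have he := hB.smooth
  have hf := hB.smooth_phi
  have frame : ∀ {A}, SmoothFieldOn V A →
      S.nijenhuis A S.xi p - (2 * S.dEta A S.xi p) • S.xi p = 0 →
      S.nijenhuis A e p - (2 * S.dEta A e p) • S.xi p = 0 →
      S.nijenhuis A (S.phiF e) p - (2 * S.dEta A (S.phiF e) p) • S.xi p = 0 →
      S.nijenhuis A Y p - (2 * S.dEta A Y p) • S.xi p = 0 := fun {A} hA t1 t2 t3 => by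
    rw [hF.tensorial_eq_sum (right A) hp (hY.on V), Fin.sum_univ_three]
    simp only [Matrix.cons_val_zero, Matrix.cons_val_one, Matrix.cons_val, t1, t2, t3, smul_zero,
      add_zero]
  have f1 := frame hx (self hx) (by rw [swap hx he, xi he, neg_zero])
    (by rw [swap hx hf, xi hf, neg_zero])
  have f2 := frame he (xi he) (self he) ef
  have f3 := frame hf (xi hf) (by rw [swap hf he, ef, neg_zero]) (self hf)
  rw [swap (hX.on V) (hY.on V), neg_eq_zero, hF.tensorial_eq_sum (right Y) hp (hX.on V),
    Fin.sum_univ_three]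
  simp only [Matrix.cons_val_zero, Matrix.cons_val_one, Matrix.cons_val, swap (hY.on V) hx,
    swap (hY.on V) he, swap (hY.on V) hf, f1, f2, f3, neg_zero, smul_zero, add_zero]

/-- The trace of `L_ξ ∇` equals `2(Qξ + 2ξ)` with `Q` the Ricci operator; harmonicity thus means `Qξ
= -2ξ`. -/
theorem harmonic_iff (hp : p ∈ V) :
    ∑ i, ∑ j, S.g.inverse p i j • S.g.lieNabla S.xi (basisField p i) (basisField p j) p = 0 ↔
      S.sqH e p = 0 ∧ S.divH₁ e p = 0 ∧ S.divH₂ e p = 0 := by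
  rw [hB.trace_lieNabla hS hp, hB.vec_eq_zero hp]
  simp

/-- The condition is tested on the three pairs of basis vectors. The diagonal components of `R(ξ,
e)ξ` and `R(ξ, φe)ξ` give `sqH = 0` by addition and the `∇_ξ h` equation by subtraction; the pair
`e`, `φe` gives the divergence equations. The last two equations say `∇_ξ h = -m φh`. -/
theorem isKappaMuAt_neg_one_iff (hp : p ∈ V) {m : ℝ} : S.IsKappaMuAt (-1) m p ↔
    S.sqH e p = 0 ∧ S.divH₁ e p = 0 ∧ S.divH₂ e p = 0 ∧
      S.nablaXiH₁ e p = -(m * S.a₂ e p) ∧ S.nablaXiH₂ e p = -(m * S.a₁ e p) := by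
  constructor
  · intro h
    obtain ⟨X₁, hX₁, h₁⟩ := exists_smoothField p (S.xi p)
    obtain ⟨X₂, hX₂, h₂⟩ := exists_smoothField p (e p)
    obtain ⟨X₃, hX₃, h₃⟩ := exists_smoothField p (S.phiF e p)
    rw [hB.xi_eq] at h₁
    rw [hB.e_eq] at h₂
    rw [hB.phi_eq] at h₃
    have k1 := h X₁ X₂ hX₁ hX₂
    have k2 := h X₁ X₃ hX₁ hX₃
    have k3 := h X₂ X₃ hX₂ hX₃
    rw [hB.curvature_xi_eq hS hp (hX₁.on V) (hX₂.on V) h₁ h₂, etaF, etaF,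
      hB.h_eq hS hp (hX₁.on V) h₁, hB.h_eq hS hp (hX₂.on V) h₂, h₁, h₂, hB.eta_vec hp,
      hB.eta_vec hp] at k1
    rw [hB.curvature_xi_eq hS hp (hX₁.on V) (hX₃.on V) h₁ h₃, etaF, etaF,
      hB.h_eq hS hp (hX₁.on V) h₁, hB.h_eq hS hp (hX₃.on V) h₃, h₁, h₃, hB.eta_vec hp,
      hB.eta_vec hp] at k2
    rw [hB.curvature_xi_eq hS hp (hX₂.on V) (hX₃.on V) h₂ h₃, etaF, etaF,
      hB.h_eq hS hp (hX₂.on V) h₂, hB.h_eq hS hp (hX₃.on V) h₃, h₂, h₃, hB.eta_vec hp,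
      hB.eta_vec hp] at k3
    simp only [vec_smul, vec_add, vec_sub] at k1 k2 k3
    rw [hB.vec_inj hp] at k1 k2 k3
    obtain ⟨-, k1, k1'⟩ := k1
    obtain ⟨-, k2, k2'⟩ := k2
    obtain ⟨-, k3, k3'⟩ := k3
    refine ⟨?_, ?_, ?_, ?_, ?_⟩ <;> linarith
  · rintro ⟨h1, h2, h3, h4, h5⟩ X Y hX hY
    have hXp := hB.eq_vec hp (X p)
    have hYp := hB.eq_vec hp (Y p)
    rw [hB.curvature_xi_eq hS hp (hX.on V) (hY.on V) hXp hYp, etaF, etaF,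
      hB.h_eq hS hp (hX.on V) hXp, hB.h_eq hS hp (hY.on V) hYp, h1, h2, h3, h4, h5]
    generalize S.g.val p (X p) (S.xi p) = x at *
    generalize S.g.val p (X p) (e p) = y at *
    generalize -S.g.val p (X p) (S.phiF e p) = z at *
    generalize S.g.val p (Y p) (S.xi p) = x' at *
    generalize S.g.val p (Y p) (e p) = y' at *
    generalize -S.g.val p (Y p) (S.phiF e p) = z' at *
    rw [hXp, hYp, hB.eta_vec hp, hB.eta_vec hp]
    simp only [vec_smul, vec_add, vec_sub]
    rw [hB.vec_inj hp]
    refine ⟨?_, ?_, ?_⟩ <;> ring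

/-- The factor `t` lets one computation serve twice: `t = 1` is the soliton equation, `t = 0` the
Einstein condition. -/
theorem soliton_iff (hp : p ∈ V) {t c : ℝ} : (∀ X Y : VField 3 M, SmoothField X → SmoothField Y →
    t * S.g.lieMetric S.xi X Y p + S.g.ricci X Y p = c * S.g.inner X Y p) ↔
    -2 + 2 * S.sqH e p = c ∧ S.divH₁ e p = 0 ∧ S.divH₂ e p = 0 ∧
      2 * t * S.a₂ e p - S.nablaXiH₂ e p + S.sqH e p - 1 + S.coefK e p = c ∧
      2 * t * S.a₂ e p - S.nablaXiH₂ e p - S.sqH e p + 1 - S.coefK e p = -c ∧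
      S.nablaXiH₁ e p = 2 * t * S.a₁ e p := by
  constructor
  · intro h
    have key : ∀ x y z x' y' z' : ℝ, t * (2 * S.a₂ e p * (y * y' + z * z')
        - 2 * S.a₁ e p * (y * z' + z * y')) + (x * x' * (-2 + 2 * S.sqH e p)
        + (x * y' + y * x') * S.divH₁ e p - (x * z' + z * x') * S.divH₂ e p
        + y * y' * (-S.nablaXiH₂ e p + S.sqH e p - 1 + S.coefK e p)
        + z * z' * (-S.nablaXiH₂ e p - S.sqH e p + 1 - S.coefK e p)
        + (y * z' + z * y') * S.nablaXiH₁ e p) = c * (x * x' + y * y' - z * z') :=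
      fun x y z x' y' z' => by
      obtain ⟨X, hX, hXp⟩ := exists_smoothField p (S.vec e p x y z)
      obtain ⟨Y, hY, hYp⟩ := exists_smoothField p (S.vec e p x' y' z')
      have := h X Y hX hY
      rw [hB.lieMetric_eq hS hp (hX.on V) (hY.on V) hXp hYp,
        hB.ricci_eq hS hp (hX.on V) (hY.on V) hXp hYp, hB.inner_eq hp hXp hYp] at this
      exact this
    have k1 := key 1 0 0 1 0 0
    have k2 := key 1 0 0 0 1 0
    have k3 := key 1 0 0 0 0 1
    have k4 := key 0 1 0 0 1 0
    have k5 := key 0 0 1 0 0 1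
    have k6 := key 0 1 0 0 0 1
    refine ⟨?_, ?_, ?_, ?_, ?_, ?_⟩ <;> linarith
  · rintro ⟨h1, h2, h3, h4, h5, h6⟩ X Y hX hY
    have hXp := hB.eq_vec hp (X p)
    have hYp := hB.eq_vec hp (Y p)
    rw [hB.lieMetric_eq hS hp (hX.on V) (hY.on V) hXp hYp,
      hB.ricci_eq hS hp (hX.on V) (hY.on V) hXp hYp, hB.inner_eq hp hXp hYp, h2, h3, h6]
    generalize S.g.val p (X p) (S.xi p) = x
    generalize S.g.val p (X p) (e p) = y
    generalize -S.g.val p (X p) (S.phiF e p) = z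
    generalize S.g.val p (Y p) (S.xi p) = x'
    generalize S.g.val p (Y p) (e p) = y'
    generalize -S.g.val p (Y p) (S.phiF e p) = z'
    linear_combination x * x' * h1 + y * y' * h4 + z * z' * h5

end IsPhiBasis

/-- Normality on the pairs `(X, ξ)` amounts to `φh = 0`, hence to `h = 0` because `h` takes values
in `ker η`. In dimension three the remaining pair `(e, φe)` imposes nothing new. -/
theorem isParaSasakian_iff [T2Space M] (hS : S.IsParacontactMetric) :
    S.IsParaSasakian ↔ S.hSupport = ∅ := by
  rw [Set.eq_empty_iff_forall_notMem]
  constructor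
  · rintro ⟨-, hN⟩ p ⟨X, hX, hXp⟩
    obtain ⟨V, e, hp, hB⟩ := S.exists_isPhiBasis p
    have h1 := congrArg (S.phi p) (hN X S.xi hX S.xi_smooth p)
    rw [S.nijenhuis_xi_right, map_sub, map_smul, map_smul, S.phi_xi, smul_zero, sub_zero, map_zero,
      hB.phi_phi_h hS hp hX] at h1
    exact hXp ((smul_eq_zero.1 h1).resolve_left two_ne_zero)
  · intro h
    refine ⟨hS, fun X Y hX hY p => ?_⟩
    obtain ⟨V, e, hp, hB⟩ := S.exists_isPhiBasis p
    have h1 := h p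
    rw [hB.mem_hSupport_iff hS hp, not_not] at h1
    exact hB.nijenhuis_eq_of_h_eq_zero hS hp hX hY h1.1 h1.2

end AlmostParacontactMetric

end Paracontact

/-! ### The sign `ε`, the function `μ`, and the two parts of the theorem. -/

namespace Paracontact

namespace SmoothFunOn

variable {d : ℕ} {M : Type*} [TopologicalSpace M] [ChartedSpace (Model d) M]
  [IsManifold (𝓡 d) ∞ M] {V : Set M} {f : M → ℝ} {p : M}

theorem eventually_ne (hf : SmoothFunOn (d := d) V f) (hV : IsOpen V) (hp : p ∈ V) (h0 : f p ≠ 0) :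
    ∀ᶠ q in nhds p, q ∈ V ∧ f q ≠ 0 :=
  (hV.eventually_mem hp).and
    ((ContMDiffOn.contMDiffAt hf (hV.mem_nhds hp)).continuousAt.eventually_ne h0)

theorem of_local (h : ∀ p ∈ V, ∃ (W : Set M) (g : M → ℝ), IsOpen W ∧ p ∈ W ∧
    SmoothFunOn (d := d) W g ∧ ∀ q ∈ W, f q = g q) : SmoothFunOn (d := d) V f := fun p hp => by
  obtain ⟨W, g, hW, hpW, hg, hfg⟩ := h p hp
  exact ((hg.congr hfg).contMDiffAt (hW.mem_nhds hpW)).contMDiffWithinAt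

end SmoothFunOn

namespace AlmostParacontactMetric

variable {M : Type*} [TopologicalSpace M] [ChartedSpace (Model 3) M]
  [IsManifold (𝓡 3) ∞ M] {S : AlmostParacontactMetric 3 M} {V : Set M} {e : VField 3 M} {p : M}

variable (S) in
open Classical in
/-- The sign `ε` with `φ h = ε h`, for `h` with `h² = 0`. -/
noncomputable def signH (p : M) : ℝ :=
  if ∀ X : VField 3 M, SmoothField X → S.phi p (S.h X p) = S.h X p then 1 else -1

variable (S) in
open Classical in
/-- The number `μ` in the `(-1, μ)`-condition at a point where `h` does not vanish. -/
noncomputable def muH (p : M) : ℝ :=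
  if h : ∃ m, p ∈ S.hSupport ∧ S.IsKappaMuAt (-1) m p then h.choose else 0

theorem signH_eq (p : M) : S.signH p = 1 ∨ S.signH p = -1 := by
  unfold signH
  split_ifs <;> simp

theorem signH_mul_self (p : M) : S.signH p * S.signH p = 1 := by
  rcases S.signH_eq p with h | h <;> rw [h] <;> norm_num

namespace IsPhiBasis

variable (hB : S.IsPhiBasis V e)
include hB

theorem mul_dirDeriv_a₁ {c : ℝ} (hp : p ∈ V) (hs : ∀ q ∈ V, S.sqH e q = c) :
    S.a₁ e p * dirDeriv S.xi (S.a₁ e) p = S.a₂ e p * dirDeriv S.xi (S.a₂ e) p := by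
  have hV := hB.isOpen
  have h1 := hB.smooth_a₁
  have h2 := hB.smooth_a₂
  have h := dirDeriv_congr (X := S.xi) (f := fun q => S.a₁ e q * S.a₁ e q - S.a₂ e q * S.a₂ e q)
    (g := fun _ => c) hV hp fun q hq => by rw [← hs q hq, sqH]; ring
  rw [dirDeriv_const, dirDeriv_sub hV hp (h1.mul h1) (h2.mul h2), dirDeriv_mul hV hp h1 h1,
    dirDeriv_mul hV hp h2 h2] at h
  linarith

variable [T2Space M] (hS : S.IsParacontactMetric)
include hS

/-- On `ker η` the map `φ` exchanges the two components, so `φh = ±h` is the same as `a₂ = ±a₁`.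
Since `signH` is defined without a basis, the sign is the same in every φ-basis. -/
theorem a₂_eq (hp : p ∈ V) (hs : S.sqH e p = 0) : S.a₂ e p = S.signH p * S.a₁ e p := by
  unfold signH
  split_ifs with h
  · obtain ⟨X, hX, hXp⟩ := exists_smoothField p (e p)
    have h1 := h X hX
    rw [hB.h_eq hS hp (hX.on V) (hXp.trans (hB.e_eq p)), hB.phi_vec hp, hB.vec_inj hp] at h1
    linarith [h1.2.1]
  · have h1 : (S.a₁ e p - S.a₂ e p) * (S.a₁ e p + S.a₂ e p) = 0 := by
      rw [← hs, sqH]; ring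
    rcases mul_eq_zero.1 h1 with h2 | h2
    · refine absurd (fun X hX => ?_) h
      rw [hB.h_eq hS hp (hX.on V) (hB.eq_vec hp (X p)), hB.phi_vec hp, hB.vec_inj hp,
        sub_eq_zero.1 h2]
      exact ⟨rfl, rfl, rfl⟩
    · linarith

theorem a₁_ne_zero {ε : ℝ} (hp : p ∈ V) (hpU : p ∈ S.hSupport) (h : S.a₂ e p = ε * S.a₁ e p) :
    S.a₁ e p ≠ 0 := fun h0 => by
  rw [h0, mul_zero] at h
  exact (hB.mem_hSupport_iff hS hp).1 hpU ⟨h0, h⟩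

/-- Differentiating `a₁² = a₂²` along `ξ` and cancelling `a₁ ≠ 0` gives `ξ(a₂) = ε ξ(a₁)`, without
any knowledge of how `ε` varies. -/
theorem nablaXiH_eq (hp : p ∈ V) (hpU : p ∈ S.hSupport) (hs : ∀ q ∈ V, S.sqH e q = 0) :
    S.A (S.signH p) e p = S.nablaXiH₁ e p ∧
      S.nablaXiH₂ e p = S.signH p * S.nablaXiH₁ e p := by
  have h1 := hB.a₂_eq hS hp (hs p hp)
  have h2 := hB.a₁_ne_zero hS hp hpU h1
  have h3 := hB.mul_dirDeriv_a₁ hp hs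
  have h4 := S.signH_mul_self p
  have h5 : dirDeriv S.xi (S.a₂ e) p = S.signH p * dirDeriv S.xi (S.a₁ e) p := by
    refine mul_left_cancel₀ h2 ?_
    rw [h1] at h3
    linear_combination (-S.signH p) * h3 - S.a₁ e p * dirDeriv S.xi (S.a₂ e) p * h4
  rw [A, nablaXiH₁, nablaXiH₂, h5, h1]
  refine ⟨by ring, ?_⟩
  linear_combination (-2 * S.a₁ e p * S.a₃ e p) * h4

/-- The two equations for `μ` differ by the factor `ε`, so a single number solves both. -/
theorem isKappaMuAt_of_harmonic (hH : S.g.IsInfinitesimalHarmonic S.xi) (hp : p ∈ V)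
    (hpU : p ∈ S.hSupport) : S.IsKappaMuAt (-1) (-(S.nablaXiH₂ e p / S.a₁ e p)) p := by
  have hs : ∀ q ∈ V, S.sqH e q = 0 := fun q hq => ((hB.harmonic_iff hS hq).1 (hH q)).1
  have h1 := hB.a₂_eq hS hp (hs p hp)
  have h2 := hB.a₁_ne_zero hS hp hpU h1
  obtain ⟨-, h3⟩ := hB.nablaXiH_eq hS hp hpU hs
  obtain ⟨k1, k2, k3⟩ := (hB.harmonic_iff hS hp).1 (hH p)
  refine (hB.isKappaMuAt_neg_one_iff hS hp).2 ⟨k1, k2, k3, ?_, by field_simp⟩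
  rw [h1, h3]
  field_simp
  linear_combination (-S.nablaXiH₁ e p) * S.signH_mul_self p

/-- Since `a₁ ≠ 0`, the number `μ` is unique. The basis-free choice therefore agrees with the local
formula, which is what makes it smooth. -/
theorem muH_eq (hH : S.g.IsInfinitesimalHarmonic S.xi) (hp : p ∈ V) (hpU : p ∈ S.hSupport) :
    S.muH p = -(S.nablaXiH₂ e p / S.a₁ e p) := by
  have hex : ∃ m, p ∈ S.hSupport ∧ S.IsKappaMuAt (-1) m p :=
    ⟨_, hpU, hB.isKappaMuAt_of_harmonic hS hH hp hpU⟩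
  have h2 := hB.a₁_ne_zero hS hp hpU (hB.a₂_eq hS hp ((hB.harmonic_iff hS hp).1 (hH p)).1)
  have h3 := ((hB.isKappaMuAt_neg_one_iff hS hp).1 hex.choose_spec.2).2.2.2.2
  rw [muH, dif_pos hex]
  rw [h3]
  field_simp

/-- The signs `1` and `-1` do not both occur near a point. -/
theorem eventually_add_eq_zero_or_sub_eq_zero (hp : p ∈ V) (hs : ∀ q ∈ V, S.sqH e q = 0)
    (hd₁ : ∀ q ∈ V, S.divH₁ e q = 0) (hd₂ : ∀ q ∈ V, S.divH₂ e q = 0)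
    (hq₁ : ∀ q ∈ V, S.nablaXiH₁ e q = 2 * S.a₁ e q)
    (hq₂ : ∀ q ∈ V, S.nablaXiH₂ e q = 2 * S.a₂ e q) :
    (∀ᶠ q in nhds p, S.a₁ e q + S.a₂ e q = 0) ∨ ∀ᶠ q in nhds p, S.a₁ e q - S.a₂ e q = 0 := by
  have hV := hB.isOpen
  have h1 := hB.smooth_a₁
  have h2 := hB.smooth_a₂
  have hb := hB.smooth_coefB
  have hc := hB.smooth_coefC
  have hconst := fun r : ℝ => SmoothFunOn.const (d := 3) (V := V) r
  have hli : LinearIndependent ℝ ![S.xi p, (e + S.phiF e) p, (e - S.phiF e) p] := by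
    rw [Fintype.linearIndependent_iff]
    intro c hc
    rw [Fin.sum_univ_three] at hc
    simp only [Matrix.cons_val_zero, Matrix.cons_val_one, Matrix.cons_val, Pi.add_apply,
      Pi.sub_apply] at hc
    have hc' : S.vec e p (c 0) (c 1 + c 2) (c 1 - c 2) = 0 := by
      rw [← hc, vec]; module
    obtain ⟨c0, c1, c2⟩ := (hB.vec_eq_zero hp).1 hc'
    intro i
    fin_cases i
    · exact c0
    · change c 1 = 0; linarith
    · change c 2 = 0; linarith
  have hsub : ∀ (f : M → ℝ) (q : M),
      dirDeriv (e - S.phiF e) f q = dirDeriv e f q - dirDeriv (S.phiF e) f q := fun f q =>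
    map_sub _ _ _
  -- Take `α = a₁ + a₂` and `β = a₁ - a₂`. Sums and differences of the equations for `∇_ξ h` and the
  -- divergence give `ξα = (2 - 2a₃) α`, `(e + φe)α = -2(b + c) α` and `(e - φe)β = 2(b - c) β`.
  refine eventually_eq_zero_or_of_frame hV hp hB.smooth_xi (hB.smooth.add hB.smooth_phi)
    (hB.smooth.sub hB.smooth_phi) hli (h1.add h2) (h1.sub h2)
    ((hconst 2).sub ((hconst 2).mul hB.smooth_a₃)) ((hconst (-2)).mul (hb.add hc))
    ((hconst 2).mul (hb.sub hc)) (fun q hq => ?_) (fun q hq => ?_) (fun q hq => ?_)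
    (fun q hq => ?_)
  · rw [dirDeriv_add hV hq h1 h2]
    have k1 := hq₁ q hq
    have k2 := hq₂ q hq
    rw [nablaXiH₁] at k1
    rw [nablaXiH₂] at k2
    linear_combination k1 + k2
  · rw [dirDeriv_add_field, dirDeriv_add hV hq h1 h2, dirDeriv_add hV hq h1 h2]
    have k1 := hd₁ q hq
    have k2 := hd₂ q hq
    rw [divH₁] at k1
    rw [divH₂] at k2
    linear_combination k1 + k2
  · rw [hsub, dirDeriv_sub hV hq h1 h2, dirDeriv_sub hV hq h1 h2]
    have k1 := hd₁ q hq
    have k2 := hd₂ q hq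
    rw [divH₁] at k1
    rw [divH₂] at k2
    linear_combination k2 - k1
  · rw [← hs q hq, sqH]
    ring

/-- The components of the Ricci soliton equation. -/
theorem eq_of_isRicciSoliton {c : ℝ} (h : ∀ X Y : VField 3 M, SmoothField X → SmoothField Y →
    ∀ p : M, S.g.lieMetric S.xi X Y p + S.g.ricci X Y p = c * S.g.inner X Y p) (hp : p ∈ V) :
    c = -2 ∧ S.sqH e p = 0 ∧ S.divH₁ e p = 0 ∧ S.divH₂ e p = 0 ∧
      S.nablaXiH₁ e p = 2 * S.a₁ e p ∧ S.nablaXiH₂ e p = 2 * S.a₂ e p ∧ S.coefK e p = -1 := by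
  have key := fun q hq => (hB.soliton_iff hS (p := q) (t := 1) (c := c) hq).1
    fun X Y hX hY => by rw [one_mul]; exact h X Y hX hY q
  obtain ⟨k1, k2, k3, k4, k5, k6⟩ := key p hp
  -- The `ξξ`-component of the soliton equation says that `sqH` is the constant `(c + 2) / 2`.
  have h1 := hB.mul_dirDeriv_a₁ (c := (c + 2) / 2) hp fun q hq => by linarith [(key q hq).1]
  have h2 : S.nablaXiH₂ e p = 2 * S.a₂ e p := by linarith
  have h3 : S.nablaXiH₁ e p = 2 * S.a₁ e p := by linarith
  -- In `a₁ · (∇_ξ h)₁ - a₂ · (∇_ξ h)₂` the terms with `a₃` cancel, and the derivatives cancel by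
  -- `h1`. So `2a₁² - 2a₂² = 0`.
  have h4 : S.sqH e p = 0 := by
    have e1 := h3
    have e2 := h2
    rw [nablaXiH₁] at e1
    rw [nablaXiH₂] at e2
    rw [sqH]
    linear_combination (-1 / 2 * S.a₁ e p) * e1 + (1 / 2 * S.a₂ e p) * e2 + 1 / 2 * h1
  exact ⟨by linarith, h4, k2, k3, h3, h2, by linarith⟩

end IsPhiBasis

variable [T2Space M]

theorem isOpen_hSupport (hS : S.IsParacontactMetric) : IsOpen S.hSupport := by
  refine isOpen_iff_mem_nhds.2 fun p hpU => ?_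
  obtain ⟨V, e, hp, hB⟩ := S.exists_isPhiBasis p
  have h1 := hB.smooth_a₁
  have h2 := hB.smooth_a₂
  have h0 : S.a₁ e p * S.a₁ e p + S.a₂ e p * S.a₂ e p ≠ 0 := fun h =>
    (hB.mem_hSupport_iff hS hp).1 hpU (mul_self_add_mul_self_eq_zero.1 h)
  filter_upwards [((h1.mul h1).add (h2.mul h2)).eventually_ne hB.isOpen hp h0] with q hq
  rw [hB.mem_hSupport_iff hS hq.1]
  exact fun h => hq.2 (mul_self_add_mul_self_eq_zero.2 h)

theorem isSignFunction_signH (hS : S.IsParacontactMetric)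
    (hs : ∀ V e, S.IsPhiBasis V e → ∀ p ∈ V, S.sqH e p = 0) : S.IsSignFunction S.signH :=
  ⟨fun p _ => S.signH_eq p, fun V e hB p hp => hB.a₂_eq hS hp.1 (hs V e hB p hp.1)⟩

/-- The functions `signH` and `muH` are defined globally; smoothness is local and comes from `ε = a₂
/ a₁` and the quotient formula for `μ`. That quotient is available only where `h ≠ 0`, so points of
the boundary of `hSupport` are left out. -/
theorem exists_kappaMu_of_isInfinitesimalHarmonic (hS : S.IsParacontactMetric)
    (hN : ¬S.IsParaSasakian) (hH : S.g.IsInfinitesimalHarmonic S.xi) :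
    S.hSupport.Nonempty ∧
      ∃ ε μ : M → ℝ,
        S.IsSignFunction ε ∧ ContMDiffOn (𝓡 3) 𝓘(ℝ, ℝ) ∞ ε S.hSupport ∧
        S.IsKappaMuOn (S.hSupport ∪ interior S.hSupportᶜ) (fun _ => -1) μ ∧
        ∀ (V : Set M) (e : VField 3 M), S.IsPhiBasis V e →
          ∀ p ∈ V ∩ S.hSupport,
            S.a₁ e p ≠ 0 ∧ μ p = -(ε p * S.A (ε p) e p) / S.a₁ e p := by
  have hU := isOpen_hSupport hS
  have hs : ∀ V e, S.IsPhiBasis V e → ∀ p ∈ V, S.sqH e p = 0 := fun V e hB p hp =>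
    ((hB.harmonic_iff hS hp).1 (hH p)).1
  have hne : ∀ {V e}, S.IsPhiBasis V e → ∀ p ∈ V ∩ S.hSupport, S.a₁ e p ≠ 0 :=
    fun hB p hp => hB.a₁_ne_zero hS hp.1 hp.2 (hB.a₂_eq hS hp.1 (hs _ _ hB p hp.1))
  refine ⟨Set.nonempty_iff_ne_empty.2 fun h => hN ((isParaSasakian_iff hS).2 h), S.signH, S.muH,
    isSignFunction_signH hS hs, ?_, ⟨contMDiffOn_const, ?_, ?_⟩, ?_⟩
  · refine SmoothFunOn.of_local fun p hpU => ?_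
    obtain ⟨V, e, hp, hB⟩ := S.exists_isPhiBasis p
    refine ⟨V ∩ S.hSupport, fun q => S.a₂ e q * (S.a₁ e q)⁻¹, hB.isOpen.inter hU, ⟨hp, hpU⟩,
      (hB.smooth_a₂.mono Set.inter_subset_left).mul
        ((hB.smooth_a₁.mono Set.inter_subset_left).inv (hne hB)), fun q hq => ?_⟩
    have := hne hB q hq
    change _ = S.a₂ e q * (S.a₁ e q)⁻¹
    rw [hB.a₂_eq hS hq.1 (hs _ _ hB q hq.1)]
    field_simp
  · refine SmoothFunOn.of_local fun p hpU => ?_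
    rcases hpU with hpU | hpU
    · obtain ⟨V, e, hp, hB⟩ := S.exists_isPhiBasis p
      have h2 : SmoothFunOn (d := 3) V (S.nablaXiH₂ e) :=
        (hB.smooth_a₂.dirDeriv hB.isOpen hB.smooth_xi).add
          (((SmoothFunOn.const 2).mul hB.smooth_a₁).mul hB.smooth_a₃)
      refine ⟨V ∩ S.hSupport, fun q => -(S.nablaXiH₂ e q * (S.a₁ e q)⁻¹), hB.isOpen.inter hU,
        ⟨hp, hpU⟩, ((h2.mono Set.inter_subset_left).mul
        ((hB.smooth_a₁.mono Set.inter_subset_left).inv (hne hB))).neg, fun q hq => ?_⟩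
      rw [hB.muH_eq hS hH hq.1 hq.2, div_eq_mul_inv]
    · refine ⟨interior S.hSupportᶜ, fun _ => 0, isOpen_interior, hpU, SmoothFunOn.const 0,
        fun q hq => dif_neg fun ⟨_, h, _⟩ => interior_subset hq h⟩
  · suffices h : ∀ p ∈ S.hSupport ∪ interior S.hSupportᶜ, S.IsKappaMuAt (-1) (S.muH p) p from
      fun X Y hX hY p hp => h p hp X Y hX hY
    intro p hpU
    obtain ⟨V, e, hp, hB⟩ := S.exists_isPhiBasis p
    rcases hpU with hpU | hpU
    · rw [hB.muH_eq hS hH hp hpU]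
      exact hB.isKappaMuAt_of_harmonic hS hH hp hpU
    -- Here `h` vanishes on a whole neighbourhood, so its derivatives along `ξ` vanish too and any
    -- value of `μ` would do.
    · have h0 : ∀ q ∈ V ∩ interior S.hSupportᶜ, S.a₁ e q = 0 ∧ S.a₂ e q = 0 := fun q hq => by
        by_contra h
        exact interior_subset hq.2 ((hB.mem_hSupport_iff hS hq.1).2 h)
      have hW := hB.isOpen.inter (isOpen_interior (s := S.hSupportᶜ))
      obtain ⟨k1, k2, k3⟩ := (hB.harmonic_iff hS hp).1 (hH p)
      obtain ⟨a1, a2⟩ := h0 p ⟨hp, hpU⟩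
      refine (hB.isKappaMuAt_neg_one_iff hS hp).2 ⟨k1, k2, k3, ?_, ?_⟩
      · rw [nablaXiH₁, dirDeriv_congr hW ⟨hp, hpU⟩ (fun q hq => (h0 q hq).1), dirDeriv_const, a2]
        ring
      · rw [nablaXiH₂, dirDeriv_congr hW ⟨hp, hpU⟩ (fun q hq => (h0 q hq).2), dirDeriv_const, a1]
        ring
  · intro V e hB p hp
    obtain ⟨h1, h2⟩ := hB.nablaXiH_eq hS hp.1 hp.2 (hs V e hB)
    refine ⟨hne hB p hp, ?_⟩
    rw [hB.muH_eq hS hH hp.1 hp.2, h1, h2, neg_div]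

/-- The component equations give everything pointwise. The work lies in a `μ` that is smooth on all
of `M`, including the boundary of `hSupport`. -/
theorem exists_kappaMu_of_isNontrivialParacontactRicciSoliton [SigmaCompactSpace M]
    (h : S.IsNontrivialParacontactRicciSoliton) :
    ¬S.IsParaSasakian ∧
      ∃ ε μ : M → ℝ,
        S.IsSignFunction ε ∧ S.IsKappaMuSpace (fun _ => -1) μ ∧
        (∀ p ∈ S.hSupport, μ p = -2 * ε p) ∧
        ∀ p : M, S.g.scalarCurvature p = -6 := by
  obtain ⟨hS, ⟨c, hc⟩, hE⟩ := h
  have key := fun V e (hB : S.IsPhiBasis V e) p (hp : p ∈ V) => hB.eq_of_isRicciSoliton hS hc hp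
  have hs : ∀ V e, S.IsPhiBasis V e → ∀ p ∈ V, S.sqH e p = 0 := fun V e hB p hp =>
    (key V e hB p hp).2.1
  have hsign := isSignFunction_signH hS hs
  -- At a common point of the closures both signs occur arbitrarily near. But `a₁ + a₂` or `a₁ - a₂`
  -- vanishes near that point, and this excludes `ε = 1` or `ε = -1` respectively.
  have hdisj : Disjoint (closure {p ∈ S.hSupport | S.signH p = 1})
      (closure {p ∈ S.hSupport | S.signH p = -1}) := by
    rw [Set.disjoint_left]
    intro p h1 h2
    rw [mem_closure_iff_frequently] at h1 h2
    obtain ⟨V, e, hp, hB⟩ := S.exists_isPhiBasis p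
    have hVp := hB.isOpen.eventually_mem hp
    have ha := fun q (hq : q ∈ V) => hB.a₂_eq hS hq (hs V e hB q hq)
    have hk := key V e hB
    rcases hB.eventually_add_eq_zero_or_sub_eq_zero hS hp (hs V e hB)
      (fun q hq => (hk q hq).2.2.1) (fun q hq => (hk q hq).2.2.2.1)
      (fun q hq => (hk q hq).2.2.2.2.1) (fun q hq => (hk q hq).2.2.2.2.2.1) with h3 | h3
    · obtain ⟨q, ⟨hqU, hq1⟩, hq2, hqV⟩ := (h1.and_eventually (h3.and hVp)).exists
      refine hB.a₁_ne_zero hS hqV hqU (ha q hqV) ?_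
      have := ha q hqV
      rw [hq1] at this
      linarith
    · obtain ⟨q, ⟨hqU, hq1⟩, hq2, hqV⟩ := (h2.and_eventually (h3.and hVp)).exists
      refine hB.a₁_ne_zero hS hqV hqU (ha q hqV) ?_
      have := ha q hqV
      rw [hq1] at this
      linarith
  -- Smooth Urysohn function: `-2 + 4f` takes the value `-2` where `ε = 1` and `2` where `ε = -1`.
  obtain ⟨f, hf0, hf1, -⟩ := exists_contMDiffMap_zero_one_of_isClosed (n := ⊤) (𝓡 3)
    isClosed_closure isClosed_closure hdisj
  have hμ : ∀ p ∈ S.hSupport, -2 + 4 * f p = -2 * S.signH p := fun p hp => by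
    rcases S.signH_eq p with h1 | h1
    · rw [hf0 (subset_closure ⟨hp, h1⟩), h1]
      simp
    · rw [hf1 (subset_closure ⟨hp, h1⟩), h1]
      norm_num
  refine ⟨fun hP => hE ⟨c, fun X Y hX hY p => ?_⟩, S.signH, fun p => -2 + 4 * f p, hsign,
    ⟨contMDiffOn_const, ?_, fun X Y hX hY p _ => ?_⟩, hμ, fun p => ?_⟩
  -- If `h` vanished identically, then `L_ξ g = 0` and the soliton equation would be the Einstein
  -- equation.
  · obtain ⟨V, e, hp, hB⟩ := S.exists_isPhiBasis p
    have hU : p ∉ S.hSupport := by rw [(isParaSasakian_iff hS).1 hP]; exact Set.notMem_empty p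
    rw [hB.mem_hSupport_iff hS hp, not_not] at hU
    have := hc X Y hX hY p
    rw [hB.lieMetric_eq hS hp (hX.on V) (hY.on V) (hB.eq_vec hp (X p)) (hB.eq_vec hp (Y p)),
      hU.1, hU.2] at this
    linarith
  · have hfs : SmoothFunOn (d := 3) Set.univ (fun p => f p) := f.contMDiff.contMDiffOn
    exact (SmoothFunOn.const (-2)).add ((SmoothFunOn.const 4).mul hfs)
  · obtain ⟨V, e, hp, hB⟩ := S.exists_isPhiBasis p
    obtain ⟨-, k1, k2, k3, k4, k5, -⟩ := key V e hB p hp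
    have ha := hB.a₂_eq hS hp k1
    have hm : 2 * S.a₁ e p = -((-2 + 4 * f p) * S.a₂ e p) ∧
        2 * S.a₂ e p = -((-2 + 4 * f p) * S.a₁ e p) := by
      -- Where `h = 0` both sides vanish, so the interpolated values of `μ` are harmless.
      by_cases hU : p ∈ S.hSupport
      · rw [hμ p hU, ha]
        exact ⟨by linear_combination (-2 * S.a₁ e p) * S.signH_mul_self p, by ring⟩
      · rw [hB.mem_hSupport_iff hS hp, not_not] at hU
        rw [hU.1, hU.2]
        simp
    exact (hB.isKappaMuAt_neg_one_iff hS hp).2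
      ⟨k1, k2, k3, k4.trans hm.1, k5.trans hm.2⟩ X Y hX hY
  · obtain ⟨V, e, hp, hB⟩ := S.exists_isPhiBasis p
    obtain ⟨-, k1, -, -, -, -, k6⟩ := key V e hB p hp
    rw [hB.scalarCurvature_eq hS hp, k1, k6]
    norm_num

/-- From `μ = -2ε` and `φh = εh` one gets `∇_ξ h = 2h`, and `r = -6` gives `coefK = -1`. These are
the components of the soliton equation with constant `-2`. -/
theorem isNontrivialParacontactRicciSoliton_of_kappaMu (hS : S.IsParacontactMetric)
    (hN : ¬S.IsParaSasakian) {ε μ : M → ℝ} (hε : S.IsSignFunction ε)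
    (hκ : S.IsKappaMuSpace (fun _ => -1) μ) (hμ : ∀ p ∈ S.hSupport, μ p = -2 * ε p)
    (hr : ∀ p : M, S.g.scalarCurvature p = -6) : S.IsNontrivialParacontactRicciSoliton := by
  have key : ∀ V e, S.IsPhiBasis V e → ∀ p ∈ V, S.sqH e p = 0 ∧ S.divH₁ e p = 0 ∧
      S.divH₂ e p = 0 ∧ S.nablaXiH₁ e p = 2 * S.a₁ e p ∧ S.nablaXiH₂ e p = 2 * S.a₂ e p ∧
      S.coefK e p = -1 := fun V e hB p hp => by
    obtain ⟨k1, k2, k3, k4, k5⟩ := (hB.isKappaMuAt_neg_one_iff hS hp (m := μ p)).1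
      fun X Y hX hY => hκ.2.2 X Y hX hY p (Set.mem_univ p)
    have k6 := hr p
    rw [hB.scalarCurvature_eq hS hp, k1] at k6
    have hm : S.nablaXiH₁ e p = 2 * S.a₁ e p ∧ S.nablaXiH₂ e p = 2 * S.a₂ e p := by
      rw [k4, k5]
      by_cases hU : p ∈ S.hSupport
      · have h1 : ε p * ε p = 1 := by rcases hε.1 p hU with h | h <;> rw [h] <;> norm_num
        rw [hμ p hU, hε.2 V e hB p ⟨hp, hU⟩]
        exact ⟨by linear_combination (2 * S.a₁ e p) * h1, by ring⟩
      · rw [hB.mem_hSupport_iff hS hp, not_not] at hU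
        rw [hU.1, hU.2]
        simp
    exact ⟨k1, k2, k3, hm.1, hm.2, by linarith⟩
  refine ⟨hS, ⟨-2, fun X Y hX hY p => ?_⟩, fun ⟨c, hc⟩ => ?_⟩
  · obtain ⟨V, e, hp, hB⟩ := S.exists_isPhiBasis p
    obtain ⟨k1, k2, k3, k4, k5, k6⟩ := key V e hB p hp
    have := (hB.soliton_iff hS hp (t := 1) (c := -2)).2
      ⟨by rw [k1]; ring, k2, k3, by rw [k1, k5, k6]; ring, by rw [k1, k5, k6]; ring,
        by rw [k4]; ring⟩ X Y hX hY
    rwa [one_mul] at this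
  · obtain ⟨p, hpU⟩ : S.hSupport.Nonempty :=
      Set.nonempty_iff_ne_empty.2 fun h => hN ((isParaSasakian_iff hS).2 h)
    obtain ⟨V, e, hp, hB⟩ := S.exists_isPhiBasis p
    obtain ⟨k1, k2, k3, k4, k5, k6⟩ := key V e hB p hp
    -- For an Einstein metric the sum of `h4` and `h5` together with `h6` gives `∇_ξ h = 0`. As `∇_ξ
    -- h = 2h`, this contradicts `h ≠ 0` at `p`.
    obtain ⟨-, -, -, h4, h5, h6⟩ := (hB.soliton_iff hS hp (t := 0) (c := c)).1
      fun X Y hX hY => by rw [zero_mul, zero_add]; exact hc X Y hX hY p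
    exact (hB.mem_hSupport_iff hS hp).1 hpU ⟨by linarith, by linarith⟩

end AlmostParacontactMetric

end Paracontact

theorem mainTheorem1 {M : Type*} [TopologicalSpace M]
    [ChartedSpace (EuclideanSpace ℝ (Fin 3)) M] [IsManifold (𝓡 3) ∞ M]
    [T2Space M] [SigmaCompactSpace M] [ConnectedSpace M]
    (S : Paracontact.AlmostParacontactMetric 3 M) (hS : S.IsParacontactMetric) :
    (¬ S.IsParaSasakian → S.g.IsInfinitesimalHarmonic S.xi →
      S.hSupport.Nonempty ∧
      ∃ ε μ : M → ℝ,
        S.IsSignFunction ε ∧ ContMDiffOn (𝓡 3) 𝓘(ℝ, ℝ) ∞ ε S.hSupport ∧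
        S.IsKappaMuOn (S.hSupport ∪ interior S.hSupportᶜ) (fun _ => -1) μ ∧
        ∀ (V : Set M) (e : Paracontact.VField 3 M), S.IsPhiBasis V e →
          ∀ p ∈ V ∩ S.hSupport,
            S.a₁ e p ≠ 0 ∧ μ p = -(ε p * S.A (ε p) e p) / S.a₁ e p) ∧
    (S.IsNontrivialParacontactRicciSoliton ↔
      ¬ S.IsParaSasakian ∧
      ∃ ε μ : M → ℝ,
        S.IsSignFunction ε ∧ S.IsKappaMuSpace (fun _ => -1) μ ∧
        (∀ p ∈ S.hSupport, μ p = -2 * ε p) ∧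
        ∀ p : M, S.g.scalarCurvature p = -6) := by
  refine ⟨Paracontact.AlmostParacontactMetric.exists_kappaMu_of_isInfinitesimalHarmonic hS,
    Paracontact.AlmostParacontactMetric.exists_kappaMu_of_isNontrivialParacontactRicciSoliton, ?_⟩
  rintro ⟨hN, ε, μ, hε, hκ, hμ, hr⟩
  exact Paracontact.AlmostParacontactMetric.isNontrivialParacontactRicciSoliton_of_kappaMu
    hS hN hε hκ hμ hr
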